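/- **Theorem 3.1 (regularity).** For $\gamma,\alpha\in(0,\tfrac12)$ put $G_{\gamma,\alpha}(x,y)=|x-y|^{-1-2\gamma}|x|^{-\alpha}|y|^{-\alpha}$ for $x,y\in\mathbb R$, and, formally, $\mathcal L_{\gamma,\alpha}u(x)=\mathrm{PV}\int_{\mathbb R}(u(x)-u(y))\,G_{\gamma,\alpha}(x,y)\,dy$. For $q>0$ let $L^1_q(\mathbb R)$ be the space of $u\in L^1_{loc}(\mathbb R)$ with $\|u\|_{L^1_q}:=\int_{\mathbb R}\frac{|u(x)|}{1+|x|^q}\,dx<\infty$. A function $u$ is a weak solution of $\mathcal L_{\gamma,\alpha}u=F$ in an open set $\Omega\subset\mathbb R$ if $\int_S\int_S G_{\gamma,\alpha}(x,y)(u(x)-u(y))^2\,dx\,dy<\infty$ for every compact $S\subset\Omega$ and, for every $\varphi\in C_c^\infty(\Omega)$, $$\frac12\int_{\mathbb R}\int_{\mathbb R}(u(x)-u(y))(\varphi(x)-\varphi(y))\,G_{\gamma,\alpha}(x,y)\,dx\,dy=\int_{\mathbb R}F\varphi\,dx,$$ both integrals being absolutely convergent. Let $0<\theta_0<1$. Then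 there exist $\gamma_0\in(0,\tfrac12)$ and $\sigma>0$, depending only on $\theta_0$, such that for all $M>1$ and all $A,B,K\ge 0$ there is a constant $C=C(\theta_0,M,A,B,K)$ with the following property. Let $\gamma_0\le\gamma<\tfrac12$, $\alpha\in(0,\tfrac12)$, $\theta\in[0,\theta_0)$, let $f$ be bounded and measurable on $(-2M,2M)$, and let $u\in L^1_q(\mathbb R)$, $q:=1+2\gamma+\alpha$, be bounded on every compact subset of $(-2M,2M)$ and a weak solution of $$\mathcal L_{\gamma,\alpha}u=\frac{f}{|x|^{\theta}}\quad\text{in }(-2M,2M),$$ with $\|u\|_{L^\infty(-M,M)}\le A$, $\|f\|_{L^\infty(-M,M)}\le B$ and $\|u\|_{L^1_q}\le K$. Then, after modification of $u$ on a null set, $$|u(x)-u(y)|\le C\,|x-y|^{\sigma}\qquad\text{for all }x,y\in(-\tfrac M2,\tfrac M2).$$ In particular $\sigma$ and $C$ do not depend on $\gamma,\alpha,\theta$. (Boundedness is understood up to null sets.) -/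

import Mathlib

open MeasureTheory Set
open scoped ENNReal ContDiff

noncomputable section

/-- The kernel `G_{γ,α}(x,y) = |x-y|^{-(1+2γ)} |x|^{-α} |y|^{-α}` on the real line. -/
def kernelG (γ α x y : ℝ) : ℝ :=
  1 / (|x - y| ^ (1 + 2 * γ) * |x| ^ α * |y| ^ α)

/-- The localized energy `[u]_S² = ∫_S ∫_S G_{γ,α}(x,y) |u(x)-u(y)|² dx dy`. -/
def localEnergy (γ α : ℝ) (u : ℝ → ℝ) (S : Set ℝ) : ℝ≥0∞ :=
  ∫⁻ p in S ×ˢ S, ENNReal.ofReal (kernelG γ α p.1 p.2 * (u p.1 - u p.2) ^ 2)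

/-- `φ ∈ C_c^∞(Ω)`. -/
def IsTestFunction (Ω : Set ℝ) (φ : ℝ → ℝ) : Prop :=
  ContDiff ℝ ∞ φ ∧ HasCompactSupport φ ∧ tsupport φ ⊆ Ω

/-- Membership in `L¹_q(ℝ)`. -/
def MemL1q (q : ℝ) (u : ℝ → ℝ) : Prop :=
  LocallyIntegrable u ∧ Integrable (fun x : ℝ => |u x| / (1 + |x| ^ q))

/-- The norm `‖u‖_{L¹_q(ℝ)} = ∫ |u(x)| / (1 + |x|^q) dx` of a member of `L¹_q(ℝ)`. -/
def normL1q (q : ℝ) (u : ℝ → ℝ) : ℝ :=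
  ∫ x : ℝ, |u x| / (1 + |x| ^ q)

/-- `u` is (essentially) bounded on every compact subset of `Ω`. -/
def LocallyBoundedOn (Ω : Set ℝ) (u : ℝ → ℝ) : Prop :=
  ∀ K : Set ℝ, IsCompact K → K ⊆ Ω → MemLp u ∞ (volume.restrict K)

/-- `u` is a weak (energy) solution of `L_{γ,α} u = F` in `Ω`: it has finite energy on compact
subsets of `Ω`, and for every `φ ∈ C_c^∞(Ω)`
`½ ∫∫ (u(x)-u(y)) (φ(x)-φ(y)) G_{γ,α}(x,y) dx dy = ∫ F φ dx`,
the integrals (the first one over the whole plane) being absolutely convergent. -/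
def IsWeakSolution (γ α : ℝ) (Ω : Set ℝ) (F u : ℝ → ℝ) : Prop :=
  (∀ K : Set ℝ, IsCompact K → K ⊆ Ω → localEnergy γ α u K < ⊤) ∧
  ∀ φ : ℝ → ℝ, IsTestFunction Ω φ →
    Integrable (fun p : ℝ × ℝ =>
      (u p.1 - u p.2) * (φ p.1 - φ p.2) * kernelG γ α p.1 p.2) ∧
    Integrable (fun x : ℝ => F x * φ x) ∧
    (1 / 2 : ℝ) * ∫ p : ℝ × ℝ, (u p.1 - u p.2) * (φ p.1 - φ p.2) * kernelG γ α p.1 p.2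
      = ∫ x : ℝ, F x * φ x

end

/-!
The proof is an energy argument: decay of the energy on small balls, uniform in the weights, and then
Campanato's characterization of Hölder continuity. No pointwise comparison or Harnack inequality is
needed, because in one dimension with `γ` close to `1/2` any positive power gained in the energy
beats the scaling loss `r^{2γ-1}` of the fractional Poincaré inequality. This is why `γ₀` has to be
close to `1/2`, and the gain has to be known before `γ₀` is chosen.

The gain comes from hole filling. Since the form is nonlocal, the energy on the ball `B_r(x₀)` is
replaced by the energy on `(-3M/4, 3M/4)²` with the weight `(r / max(r, |x-x₀|, |y-x₀|))^{1/2}`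
(`weightedEnergy`), which contains all the larger scales. The equation is tested with `ψ (u - c)`,
`ψ` a cutoff of `B_r` in `B_{2r}`. On `B_r × B_r` the form is the energy; outside, Young's inequality
with this weight and its inverse bounds the form by a multiple of the weighted energy outside
`B_r × B_r` plus a small multiple of the energy of `ψ (u - c)` with the growing inverse weight. The
latter is bounded by the energy on `B_{4r}` through a weighted Poincaré inequality
(`BoundedSolution.lintegral_test_energy_le`). The part outside `B_r × B_r` loses a fixed fraction when
`r` is halved, so the weighted energy decreases by a universal factor, up to the
contributions `O(r^s)`, `s = min(1/2, 1 - θ₀)`, of the right-hand side and of the values of `u` far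
away (`BoundedSolution.hole_filling`). The iteration starts from Caccioppoli's inequality
(`BoundedSolution.caccioppoli`).

Uniformity in `α` and in the position of the ball relative to the singularity at `0` rests on one
estimate: the mass of `|x|^{-a}` against a decaying profile at scale `r` around `x₀` is at most of
order `r (|x₀| + r)^{-a}` (`lintegral_decayProfile_weight`), that is, the length of `B_r(x₀)` times
the infimum of the weight on it. Its local form says that `|x|^{-2α}` is a Muckenhoupt `A₁` weight, which
is also what makes mollification bounded on the energy space (`lintegral_energy_mollify_le`) and so
allows nonsmooth test functions (`weak_form_of_finite_energy`).
-/

/-! ### Integrals of the weight `|x|^{-a}` -/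

lemma lintegral_ball_abs_rpow_neg {a s : ℝ} (ha : a < 1) (hs : 0 < s) :
    ∫⁻ x in Metric.ball (0 : ℝ) s, ENNReal.ofReal (|x| ^ (-a))
      ≤ ENNReal.ofReal (2 * s ^ (1 - a) / (1 - a)) := by
  have h1 : ∫⁻ x in Ioc 0 s, ENNReal.ofReal (|x| ^ (-a))
      = ENNReal.ofReal (s ^ (1 - a) / (1 - a)) := by
    have hi : IntervalIntegrable (fun x : ℝ => x ^ (-a)) volume 0 s :=
      intervalIntegral.intervalIntegrable_rpow' (by linarith)
    have := integral_rpow (a := 0) (b := s) (r := -a) (Or.inl (by linarith))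
    rw [intervalIntegral.integral_of_le hs.le, Real.zero_rpow (by linarith)] at this
    rw [show s ^ (1 - a) / (1 - a) = ∫ x in Ioc 0 s, x ^ (-a) by
      rw [this, sub_zero, neg_add_eq_sub],
      ofReal_integral_eq_lintegral_ofReal
        ((intervalIntegrable_iff_integrableOn_Ioc_of_le hs.le).1 hi)
        ((ae_restrict_iff' measurableSet_Ioc).2
          (ae_of_all _ fun x hx => Real.rpow_nonneg hx.1.le _))]
    exact setLIntegral_congr_fun measurableSet_Ioc fun x hx => by
      simp only [abs_of_pos hx.1]
  have h2 : ∫⁻ x in Neg.neg ⁻¹' Ioc 0 s, ENNReal.ofReal (|x| ^ (-a))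
      = ∫⁻ x in Ioc 0 s, ENNReal.ofReal (|x| ^ (-a)) := by
    rw [← (Measure.measurePreserving_neg (volume : Measure ℝ)).setLIntegral_comp_preimage
      measurableSet_Ioc (by fun_prop)]
    simp only [abs_neg]
  have hsub : Metric.ball (0 : ℝ) s ⊆ ({0} ∪ Ioc 0 s) ∪ Neg.neg ⁻¹' Ioc 0 s := by
    intro x hx
    rw [Real.ball_eq_Ioo] at hx
    rcases lt_trichotomy x 0 with h | h | h
    · right
      exact ⟨by simpa using h, by linarith [hx.1]⟩
    · left; left; simpa using h
    · left; right; exact ⟨h, by linarith [hx.2]⟩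
  calc _ ≤ _ := lintegral_mono_set hsub
    _ ≤ ((∫⁻ x in {0}, ENNReal.ofReal (|x| ^ (-a))) + ∫⁻ x in Ioc 0 s, ENNReal.ofReal (|x| ^ (-a)))
        + ∫⁻ x in Neg.neg ⁻¹' Ioc 0 s, ENNReal.ofReal (|x| ^ (-a)) :=
      (lintegral_union_le _ _ _).trans (add_le_add_left (lintegral_union_le _ _ _) _)
    _ = _ := by
      have : 0 ≤ s ^ (1 - a) / (1 - a) := by
        have : 0 < 1 - a := by linarith
        positivity
      rw [mul_div_assoc, two_mul, ENNReal.ofReal_add this this, h2, h1]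
      simp

/-- The profile `(1 + |x - x₀| / r)^{-5/4}`: an integrable majorant, at scale `r`, of the
indicator of a ball around `x₀` together with the decay of the kernel away from it. -/
noncomputable def decayProfile (x₀ r x : ℝ) : ℝ := (1 + |x - x₀| / r) ^ (-(5 / 4 : ℝ))

lemma decayProfile_nonneg {x₀ r x : ℝ} (hr : 0 < r) : 0 ≤ decayProfile x₀ r x := by
  unfold decayProfile; positivity

@[fun_prop]
lemma measurable_decayProfile (x₀ r : ℝ) : Measurable (decayProfile x₀ r) := by
  unfold decayProfile; fun_prop

/-- The mass of `decayProfile` at scale one. -/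
noncomputable def profileMass : ℝ := ∫ x : ℝ, (1 + ‖x‖) ^ (-(5 / 4 : ℝ))

lemma profileMass_nonneg : 0 ≤ profileMass :=
  integral_nonneg fun x => by positivity

lemma lintegral_one_add_abs :
    ∫⁻ x : ℝ, ENNReal.ofReal ((1 + |x|) ^ (-(5 / 4 : ℝ))) = ENNReal.ofReal profileMass := by
  rw [profileMass, ofReal_integral_eq_lintegral_ofReal]
  · simp only [Real.norm_eq_abs]
  · exact integrable_one_add_norm (by simp; norm_num)
  · exact ae_of_all _ fun x => by positivity

lemma lintegral_decayProfile (x₀ : ℝ) {r : ℝ} (hr : 0 < r) :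
    ∫⁻ x, ENNReal.ofReal (decayProfile x₀ r x) = ENNReal.ofReal (r * profileMass) := by
  have h := lintegral_one_add_abs
  have h3 : ∫⁻ x, ENNReal.ofReal (decayProfile x₀ r x)
      = ∫⁻ x, ENNReal.ofReal ((1 + |x / r|) ^ (-(5 / 4 : ℝ))) := by
    rw [← lintegral_sub_right_eq_self
      (fun x => ENNReal.ofReal ((1 + |x / r|) ^ (-(5 / 4 : ℝ)))) x₀]
    simp only [decayProfile, abs_div, abs_of_pos hr]
  have h4 : ∫⁻ x, ENNReal.ofReal ((1 + |x|) ^ (-(5 / 4 : ℝ))) ∂(volume.map (· * r⁻¹))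
      = ∫⁻ x, ENNReal.ofReal ((1 + |x / r|) ^ (-(5 / 4 : ℝ))) := by
    rw [lintegral_map (by fun_prop) (by fun_prop)]
    simp only [div_eq_mul_inv]
  rw [h3, ← h4, Real.map_volume_mul_right (inv_ne_zero hr.ne'), lintegral_smul_measure, h,
    inv_inv, abs_of_pos hr, smul_eq_mul, ← ENNReal.ofReal_mul hr.le]

/-- The integral of `decayProfile` against `|x|^{-a}` is at most what it would be if the weight
were frozen at the size `(|x₀| + r)^{-a}`. -/
lemma lintegral_decayProfile_weight (x₀ : ℝ) {r a : ℝ} (hr : 0 < r) (ha0 : 0 ≤ a) (ha : a < 1) :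
    ∫⁻ x, ENNReal.ofReal (decayProfile x₀ r x * |x| ^ (-a))
      ≤ ENNReal.ofReal ((4 * profileMass + 32 / (1 - a)) * (r * (|x₀| + r) ^ (-a))) := by
  set s := |x₀| + r with hs
  have hs0 : 0 < s := by positivity
  have h1a : 0 < 1 - a := by linarith
  have hfar : ∀ x, s / 4 ≤ |x| → |x| ^ (-a) ≤ 4 * s ^ (-a) := by
    intro x hx
    calc |x| ^ (-a) ≤ (s / 4) ^ (-a) :=
          Real.rpow_le_rpow_of_nonpos (by positivity) hx (by linarith)
      _ = (1 / 4) ^ (-a) * s ^ (-a) := by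
          rw [← Real.mul_rpow (by norm_num) hs0.le]; congr 1; ring
      _ ≤ 4 * s ^ (-a) := by
          gcongr
          rw [one_div, Real.inv_rpow (by norm_num), ← Real.rpow_neg (by norm_num), neg_neg]
          calc (4 : ℝ) ^ a ≤ 4 ^ (1 : ℝ) := by gcongr; norm_num
            _ = 4 := by norm_num
  have hnear : ∀ x, |x| < s / 4 → decayProfile x₀ r x ≤ 4 * r / s := by
    intro x hx
    have h1 : s / 4 ≤ r + |x - x₀| := by
      have := abs_sub_abs_le_abs_sub x₀ x
      rw [abs_sub_comm] at this
      have : s ≤ |x₀| + r := le_rfl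
      linarith
    have h2 : s / (4 * r) ≤ 1 + |x - x₀| / r := by
      rw [div_le_iff₀ (by positivity)]; field_simp; linarith
    have h3 : (1 : ℝ) ≤ 1 + |x - x₀| / r := by
      have : 0 ≤ |x - x₀| / r := by positivity
      linarith
    calc decayProfile x₀ r x ≤ (1 + |x - x₀| / r) ^ (-1 : ℝ) := by
          unfold decayProfile
          exact Real.rpow_le_rpow_of_exponent_le h3 (by norm_num)
      _ ≤ (s / (4 * r)) ^ (-1 : ℝ) :=
          Real.rpow_le_rpow_of_nonpos (by positivity) h2 (by norm_num)
      _ = _ := by rw [Real.rpow_neg_one, inv_div]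
  rw [← lintegral_add_compl _ (measurableSet_ball : MeasurableSet (Metric.ball (0 : ℝ) (s / 4)))]
  have e1 : ∫⁻ x in Metric.ball (0 : ℝ) (s / 4), ENNReal.ofReal (decayProfile x₀ r x * |x| ^ (-a))
      ≤ ENNReal.ofReal (32 / (1 - a) * (r * s ^ (-a))) := by
    calc _ ≤ ∫⁻ x in Metric.ball (0 : ℝ) (s / 4),
            ENNReal.ofReal (4 * r / s) * ENNReal.ofReal (|x| ^ (-a)) := by
          refine setLIntegral_mono (by fun_prop) fun x hx => ?_
          rw [← ENNReal.ofReal_mul (by positivity)]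
          gcongr
          exact hnear x (by simpa using hx)
      _ ≤ ENNReal.ofReal (4 * r / s) * ENNReal.ofReal (2 * (s / 4) ^ (1 - a) / (1 - a)) := by
          rw [lintegral_const_mul _ (by fun_prop)]
          gcongr
          exact lintegral_ball_abs_rpow_neg ha (by positivity)
      _ ≤ _ := by
          rw [← ENNReal.ofReal_mul (by positivity)]
          apply ENNReal.ofReal_le_ofReal
          have : (s / 4) ^ (1 - a) ≤ s * s ^ (-a) := by
            calc (s / 4) ^ (1 - a) ≤ s ^ (1 - a) := by gcongr; linarith
              _ = _ := by rw [sub_eq_add_neg, Real.rpow_add hs0, Real.rpow_one]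
          calc 4 * r / s * (2 * (s / 4) ^ (1 - a) / (1 - a))
              ≤ 4 * r / s * (2 * (s * s ^ (-a)) / (1 - a)) := by gcongr
            _ = 8 / (1 - a) * (r * s ^ (-a)) := by field_simp; ring
            _ ≤ _ := by gcongr; norm_num
  have e2 : ∫⁻ x in (Metric.ball (0 : ℝ) (s / 4))ᶜ,
      ENNReal.ofReal (decayProfile x₀ r x * |x| ^ (-a))
      ≤ ENNReal.ofReal (4 * profileMass * (r * s ^ (-a))) := by
    calc _ ≤ ∫⁻ x in (Metric.ball (0 : ℝ) (s / 4))ᶜ,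
            ENNReal.ofReal (4 * s ^ (-a)) * ENNReal.ofReal (decayProfile x₀ r x) := by
          refine setLIntegral_mono (by fun_prop) fun x hx => ?_
          rw [← ENNReal.ofReal_mul (by positivity), mul_comm]
          refine ENNReal.ofReal_le_ofReal (mul_le_mul_of_nonneg_right (hfar x ?_)
            (decayProfile_nonneg hr))
          simpa using hx
      _ ≤ ∫⁻ x, ENNReal.ofReal (4 * s ^ (-a)) * ENNReal.ofReal (decayProfile x₀ r x) :=
          setLIntegral_le_lintegral _ _
      _ = _ := by
          rw [lintegral_const_mul _ (by fun_prop), lintegral_decayProfile x₀ hr,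
            ← ENNReal.ofReal_mul (by positivity)]
          congr 1; ring
  calc _ ≤ _ := add_le_add e1 e2
    _ = _ := by
      have := profileMass_nonneg
      rw [← ENNReal.ofReal_add (by positivity) (by positivity)]
      congr 1; ring

lemma one_le_decayProfile {x₀ r x c : ℝ} (hr : 0 < r) (hc : 0 ≤ c) (hx : |x - x₀| ≤ c * r) :
    1 ≤ (1 + c) ^ 2 * decayProfile x₀ r x := by
  unfold decayProfile
  have h1 : 1 + |x - x₀| / r ≤ 1 + c := by
    have : |x - x₀| / r ≤ c := by rwa [div_le_iff₀ hr]
    linarith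
  have h0 : 0 < 1 + |x - x₀| / r := by positivity
  calc (1 : ℝ) = (1 + c) ^ (5 / 4 : ℝ) * (1 + c) ^ (-(5 / 4 : ℝ)) := by
        rw [← Real.rpow_add (by linarith)]; norm_num
    _ ≤ (1 + c) ^ (2 : ℝ) * (1 + |x - x₀| / r) ^ (-(5 / 4 : ℝ)) := by
        refine mul_le_mul (Real.rpow_le_rpow_of_exponent_le (by linarith) (by norm_num)) ?_
          (by positivity) (by positivity)
        exact Real.rpow_le_rpow_of_nonpos h0 h1 (by norm_num)
    _ = _ := by norm_num

lemma lintegral_ball_weight_le (x₀ : ℝ) {r a : ℝ} (hr : 0 < r) (ha0 : 0 ≤ a) (ha : a < 1) :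
    ∫⁻ x in Metric.ball x₀ r, ENNReal.ofReal (|x| ^ (-a))
      ≤ ENNReal.ofReal (4 * (4 * profileMass + 32 / (1 - a)) * (r * (|x₀| + r) ^ (-a))) := by
  calc _ ≤ ∫⁻ x in Metric.ball x₀ r,
        ENNReal.ofReal 4 * ENNReal.ofReal (decayProfile x₀ r x * |x| ^ (-a)) := by
        refine setLIntegral_mono (by fun_prop) fun x hx => ?_
        rw [← ENNReal.ofReal_mul (by norm_num), ← mul_assoc]
        apply ENNReal.ofReal_le_ofReal
        have := one_le_decayProfile (c := 1) (x₀ := x₀) (x := x) hr (by norm_num)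
          (by have := Metric.mem_ball.1 hx; rw [Real.dist_eq] at this; linarith)
        calc |x| ^ (-a) = 1 * |x| ^ (-a) := (one_mul _).symm
          _ ≤ _ := by gcongr; linarith
    _ ≤ ∫⁻ x, ENNReal.ofReal 4 * ENNReal.ofReal (decayProfile x₀ r x * |x| ^ (-a)) :=
        setLIntegral_le_lintegral _ _
    _ ≤ _ := by
        rw [lintegral_const_mul _ (by fun_prop), mul_assoc, ENNReal.ofReal_mul (by norm_num)]
        gcongr
        exact lintegral_decayProfile_weight x₀ hr ha0 ha

/-! ### The kernel: far field and the `A₁` property -/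

lemma kernelG_eq (γ α x y : ℝ) :
    kernelG γ α x y = |x - y| ^ (-(1 + 2 * γ)) * (|x| ^ (-α) * |y| ^ (-α)) := by
  unfold kernelG
  rw [Real.rpow_neg (abs_nonneg _), Real.rpow_neg (abs_nonneg _), Real.rpow_neg (abs_nonneg _),
    one_div, mul_inv, mul_inv, mul_assoc]

lemma kernelG_nonneg (γ α x y : ℝ) : 0 ≤ kernelG γ α x y := by
  unfold kernelG; positivity

lemma kernelG_comm (γ α x y : ℝ) : kernelG γ α x y = kernelG γ α y x := by
  rw [kernelG_eq, kernelG_eq, abs_sub_comm, mul_comm (|x| ^ (-α))]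

@[fun_prop]
lemma Measurable.kernelG {Z : Type*} [MeasurableSpace Z] {f g : Z → ℝ} (γ α : ℝ)
    (hf : Measurable f) (hg : Measurable g) : Measurable fun z => kernelG γ α (f z) (g z) := by
  unfold _root_.kernelG; fun_prop

/-- Between points of comparably different size the kernel splits into the weight in `x` and the
weight of `L¹_q`, `q = 1 + 2γ + α`, in `y`. -/
lemma kernelG_le_far {γ α x y : ℝ} (hγ : 0 ≤ γ) (hγ' : γ < 1 / 2) (hα : 0 ≤ α) (hα' : α < 1 / 2)
    (hy : 3 / 4 ≤ |y|) (hx : |x| ≤ 15 / 16 * |y|) :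
    kernelG γ α x y ≤ 1024 * (|x| ^ (-α) * (1 + |y| ^ (1 + 2 * γ + α))⁻¹) := by
  have hy0 : 0 < |y| := by linarith
  have h1 : |y| / 16 ≤ |x - y| := by
    have := abs_sub_abs_le_abs_sub y x
    rw [abs_sub_comm] at this
    linarith
  have h2 : |x - y| ^ (-(1 + 2 * γ)) ≤ 256 * |y| ^ (-(1 + 2 * γ)) := by
    calc |x - y| ^ (-(1 + 2 * γ)) ≤ (|y| / 16) ^ (-(1 + 2 * γ)) :=
          Real.rpow_le_rpow_of_nonpos (by positivity) h1 (by linarith)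
      _ = (1 / 16) ^ (-(1 + 2 * γ)) * |y| ^ (-(1 + 2 * γ)) := by
          rw [← Real.mul_rpow (by norm_num) hy0.le]; congr 1; ring
      _ ≤ 256 * |y| ^ (-(1 + 2 * γ)) := by
          gcongr
          rw [one_div, Real.inv_rpow (by norm_num), ← Real.rpow_neg (by norm_num), neg_neg]
          calc (16 : ℝ) ^ (1 + 2 * γ) ≤ 16 ^ (2 : ℝ) := by gcongr <;> linarith
            _ = 256 := by norm_num
  have h3 : |y| ^ (-(1 + 2 * γ)) * |y| ^ (-α) ≤ 4 * (1 + |y| ^ (1 + 2 * γ + α))⁻¹ := by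
    rw [← Real.rpow_add hy0, show -(1 + 2 * γ) + -α = -(1 + 2 * γ + α) by ring,
      Real.rpow_neg hy0.le, ← div_eq_mul_inv, inv_eq_one_div,
      div_le_div_iff₀ (by positivity) (by positivity)]
    have : (1 : ℝ) / 3 ≤ |y| ^ (1 + 2 * γ + α) := by
      calc (1 : ℝ) / 3 ≤ (3 / 4) ^ (3 : ℝ) := by norm_num
        _ ≤ (3 / 4) ^ (1 + 2 * γ + α) :=
            Real.rpow_le_rpow_of_exponent_ge (by norm_num) (by norm_num) (by linarith)
        _ ≤ _ := by gcongr
    linarith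
  rw [kernelG_eq]
  calc |x - y| ^ (-(1 + 2 * γ)) * (|x| ^ (-α) * |y| ^ (-α))
      ≤ 256 * |y| ^ (-(1 + 2 * γ)) * (|x| ^ (-α) * |y| ^ (-α)) := by gcongr
    _ = 256 * |x| ^ (-α) * (|y| ^ (-(1 + 2 * γ)) * |y| ^ (-α)) := by ring
    _ ≤ 256 * |x| ^ (-α) * (4 * (1 + |y| ^ (1 + 2 * γ + α))⁻¹) := by gcongr
    _ = _ := by ring

/-- The majorant `1_S(x) |x|^{-α} (A + |u(y)|) / (1 + |y|^{1+2γ+α})` for the interaction of a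
function supported in `S` with the values of `u` far away from `S`. -/
noncomputable def farMajorant (γ α A : ℝ) (S : Set ℝ) (u : ℝ → ℝ) (p : ℝ × ℝ) : ℝ :=
  S.indicator (fun x => |x| ^ (-α)) p.1 * ((A + |u p.2|) * (1 + |p.2| ^ (1 + 2 * γ + α))⁻¹)

lemma farMajorant_nonneg {γ α A : ℝ} (S : Set ℝ) (u : ℝ → ℝ) (hA : 0 ≤ A) (p : ℝ × ℝ) :
    0 ≤ farMajorant γ α A S u p := by
  unfold farMajorant
  have : 0 ≤ S.indicator (fun x => |x| ^ (-α)) p.1 :=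
    Set.indicator_nonneg (fun x _ => by positivity) _
  positivity

lemma measurable_farMajorant {γ α A : ℝ} {S : Set ℝ} (hS : MeasurableSet S) {u : ℝ → ℝ}
    (hu : Measurable u) : Measurable (farMajorant γ α A S u) := by
  unfold farMajorant
  have : Measurable (S.indicator fun x : ℝ => |x| ^ (-α)) :=
    Measurable.indicator (by fun_prop) hS
  fun_prop

lemma lintegral_farMajorant {γ α A : ℝ} {S : Set ℝ} (hS : MeasurableSet S) {u : ℝ → ℝ}
    (hu : Measurable u) :
    ∫⁻ p, ENNReal.ofReal (farMajorant γ α A S u p) =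
      (∫⁻ x in S, ENNReal.ofReal (|x| ^ (-α))) *
        ∫⁻ y, ENNReal.ofReal ((A + |u y|) * (1 + |y| ^ (1 + 2 * γ + α))⁻¹) := by
  have h : ∀ p : ℝ × ℝ, ENNReal.ofReal (farMajorant γ α A S u p) =
      S.indicator (fun x => ENNReal.ofReal (|x| ^ (-α))) p.1 *
        ENNReal.ofReal ((A + |u p.2|) * (1 + |p.2| ^ (1 + 2 * γ + α))⁻¹) := by
    intro p
    unfold farMajorant
    by_cases hp : p.1 ∈ S
    · simp only [hp, indicator_of_mem]
      rw [ENNReal.ofReal_mul (by positivity)]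
    · simp [hp]
  simp_rw [h]
  rw [Measure.volume_eq_prod, ← lintegral_indicator hS]
  exact lintegral_prod_mul (f := S.indicator fun x => ENNReal.ofReal (|x| ^ (-α)))
    (g := fun y => ENNReal.ofReal ((A + |u y|) * (1 + |y| ^ (1 + 2 * γ + α))⁻¹))
    (Measurable.aemeasurable (Measurable.indicator (by fun_prop) hS)) (by fun_prop)

/-- The far field of a function in `L¹_q`, bounded by its norm uniformly in the exponents. -/
lemma lintegral_tail_le {γ α A : ℝ} {u : ℝ → ℝ} (hγ : 1 / 8 ≤ γ) (hα : 0 ≤ α) (hA : 0 ≤ A)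
    (hq : MemL1q (1 + 2 * γ + α) u) :
    ∫⁻ y, ENNReal.ofReal ((A + |u y|) * (1 + |y| ^ (1 + 2 * γ + α))⁻¹)
      ≤ ENNReal.ofReal (4 * A * profileMass + normL1q (1 + 2 * γ + α) u) := by
  have h1 : ∀ y : ℝ, (1 + |y| ^ (1 + 2 * γ + α))⁻¹ ≤ 4 * (1 + |y|) ^ (-(5 / 4 : ℝ)) := by
    intro y
    rw [Real.rpow_neg (by positivity), inv_eq_one_div, ← div_eq_mul_inv,
      div_le_div_iff₀ (by positivity) (by positivity), one_mul]
    have hb : ∀ t : ℝ, 0 ≤ t → (2 * t) ^ (5 / 4 : ℝ) ≤ 4 * t ^ (5 / 4 : ℝ) := by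
      intro t ht
      rw [Real.mul_rpow (by norm_num) ht]
      gcongr
      calc (2 : ℝ) ^ (5 / 4 : ℝ) ≤ 2 ^ (2 : ℝ) := by gcongr <;> norm_num
        _ = 4 := by norm_num
    rcases le_total |y| 1 with hy | hy
    · calc (1 + |y|) ^ (5 / 4 : ℝ) ≤ (2 * 1) ^ (5 / 4 : ℝ) := by gcongr; linarith
        _ ≤ 4 * 1 ^ (5 / 4 : ℝ) := hb 1 (by norm_num)
        _ ≤ 4 * (1 + |y| ^ (1 + 2 * γ + α)) := by
          rw [Real.one_rpow]
          have : 0 ≤ |y| ^ (1 + 2 * γ + α) := by positivity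
          linarith
    · calc (1 + |y|) ^ (5 / 4 : ℝ) ≤ (2 * |y|) ^ (5 / 4 : ℝ) := by gcongr; linarith
        _ ≤ 4 * |y| ^ (5 / 4 : ℝ) := hb _ (by positivity)
        _ ≤ 4 * |y| ^ (1 + 2 * γ + α) := by
          gcongr 4 * ?_
          exact Real.rpow_le_rpow_of_exponent_le hy (by linarith)
        _ ≤ _ := by linarith
  calc _ ≤ ∫⁻ y, (ENNReal.ofReal (4 * A) * ENNReal.ofReal ((1 + |y|) ^ (-(5 / 4 : ℝ)))
        + ENNReal.ofReal (|u y| / (1 + |y| ^ (1 + 2 * γ + α)))) := by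
        refine lintegral_mono fun y => ?_
        rw [← ENNReal.ofReal_mul (by positivity), ← ENNReal.ofReal_add (by positivity)
          (by positivity)]
        apply ENNReal.ofReal_le_ofReal
        have := mul_le_mul_of_nonneg_left (h1 y) hA
        rw [add_mul, div_eq_mul_inv (|u y|)]
        refine add_le_add_left ?_ _
        linarith
    _ = _ := by
        rw [lintegral_add_left (by fun_prop), lintegral_const_mul _ (by fun_prop),
          lintegral_one_add_abs, ← ofReal_integral_eq_lintegral_ofReal hq.2
            (ae_of_all _ fun x => by positivity), ← ENNReal.ofReal_mul (by positivity), normL1q,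
          ← ENNReal.ofReal_add]
        · have := profileMass_nonneg; positivity
        · exact integral_nonneg fun x => by positivity

/-- Off the square `(-d, d)²`, the bilinear form density of `u` against a function supported well
inside `(-d, d)` is controlled by `farMajorant`. -/
lemma abs_form_le_far {γ α A b d : ℝ} {u φ : ℝ → ℝ} {S : Set ℝ}
    (hγ : 0 ≤ γ) (hγ' : γ < 1 / 2) (hα : 0 ≤ α) (hα' : α < 1 / 2) (hd : 3 / 4 ≤ d)
    (hS : S ⊆ Metric.ball 0 (15 / 16 * d)) (hA : 0 ≤ A)
    (hu : ∀ x ∈ Metric.ball 0 d, |u x| ≤ A) (hφ : ∀ x, |φ x| ≤ b) (hφS : ∀ x, x ∉ S → φ x = 0)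
    {p : ℝ × ℝ} (hp : p ∉ Metric.ball (0 : ℝ) d ×ˢ Metric.ball (0 : ℝ) d) :
    |(u p.1 - u p.2) * (φ p.1 - φ p.2) * kernelG γ α p.1 p.2|
      ≤ 1024 * b * (farMajorant γ α A S u p + farMajorant γ α A S u p.swap) := by
  have hb : 0 ≤ b := (abs_nonneg _).trans (hφ 0)
  have key : ∀ x y : ℝ, x ∈ S → y ∉ Metric.ball (0 : ℝ) d →
      |(u x - u y) * (φ x - φ y) * kernelG γ α x y| ≤ 1024 * b * farMajorant γ α A S u (x, y) := by
    intro x y hx hy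
    have hx' := hS hx
    have hyS : y ∉ S := fun h => hy (Metric.ball_subset_ball (by linarith) (hS h))
    rw [hφS y hyS, sub_zero]
    simp only [Metric.mem_ball, dist_zero_right, Real.norm_eq_abs, not_lt] at hx' hy
    have h1 : |u x - u y| ≤ A + |u y| := (abs_sub _ _).trans (by
      gcongr
      exact hu x (by simpa using by linarith))
    have h2 := kernelG_le_far (x := x) (y := y) hγ hγ' hα hα' (by linarith) (by linarith)
    rw [abs_mul, abs_mul, abs_of_nonneg (kernelG_nonneg _ _ _ _)]
    simp only [farMajorant, hx, indicator_of_mem]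
    calc |u x - u y| * |φ x| * kernelG γ α x y
        ≤ (A + |u y|) * b * (1024 * (|x| ^ (-α) * (1 + |y| ^ (1 + 2 * γ + α))⁻¹)) := by
          gcongr
          · exact kernelG_nonneg _ _ _ _
          · exact hφ x
      _ = _ := by ring
  have n1 := farMajorant_nonneg (γ := γ) (α := α) S u hA p
  have n2 := farMajorant_nonneg (γ := γ) (α := α) S u hA p.swap
  by_cases h1 : p.1 ∈ S
  · have h2 : p.2 ∉ Metric.ball (0 : ℝ) d := fun h =>
      hp ⟨Metric.ball_subset_ball (by linarith) (hS h1), h⟩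
    refine (key _ _ h1 h2).trans ?_
    gcongr
    simpa using n2
  · by_cases h2 : p.2 ∈ S
    · have h3 : p.1 ∉ Metric.ball (0 : ℝ) d := fun h =>
        hp ⟨h, Metric.ball_subset_ball (by linarith) (hS h2)⟩
      have := key _ _ h2 h3
      rw [kernelG_comm, show (u p.1 - u p.2) * (φ p.1 - φ p.2) = (u p.2 - u p.1) * (φ p.2 - φ p.1)
        by ring]
      refine this.trans ?_
      gcongr
      simpa [Prod.swap] using n1
    · rw [hφS _ h1, hφS _ h2]
      simp only [sub_self, mul_zero, zero_mul, abs_zero]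
      positivity

lemma lintegral_abs_form_far {γ α A b d : ℝ} {u φ : ℝ → ℝ} {S : Set ℝ}
    (hγ : 0 ≤ γ) (hγ' : γ < 1 / 2) (hα : 0 ≤ α) (hα' : α < 1 / 2) (hd : 3 / 4 ≤ d)
    (hS : S ⊆ Metric.ball 0 (15 / 16 * d)) (hSm : MeasurableSet S) (hA : 0 ≤ A)
    (hum : Measurable u)
    (hu : ∀ x ∈ Metric.ball 0 d, |u x| ≤ A) (hφ : ∀ x, |φ x| ≤ b)
    (hφS : ∀ x, x ∉ S → φ x = 0) :
    ∫⁻ p in (Metric.ball (0 : ℝ) d ×ˢ Metric.ball (0 : ℝ) d)ᶜ,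
        ENNReal.ofReal |(u p.1 - u p.2) * (φ p.1 - φ p.2) * kernelG γ α p.1 p.2|
      ≤ ENNReal.ofReal (2048 * b) * ((∫⁻ x in S, ENNReal.ofReal (|x| ^ (-α))) *
        ∫⁻ y, ENNReal.ofReal ((A + |u y|) * (1 + |y| ^ (1 + 2 * γ + α))⁻¹)) := by
  have hb : 0 ≤ b := (abs_nonneg _).trans (hφ 0)
  have hm := measurable_farMajorant (γ := γ) (α := α) (A := A) hSm hum
  rw [← lintegral_farMajorant hSm hum]
  have hswap : ∫⁻ p : ℝ × ℝ, ENNReal.ofReal (farMajorant γ α A S u p.swap)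
      = ∫⁻ p, ENNReal.ofReal (farMajorant γ α A S u p) := by
    rw [Measure.volume_eq_prod]
    exact lintegral_prod_swap (fun p => ENNReal.ofReal (farMajorant γ α A S u p))
  calc _ ≤ ∫⁻ p in (Metric.ball (0 : ℝ) d ×ˢ Metric.ball (0 : ℝ) d)ᶜ,
        ENNReal.ofReal (1024 * b) * (ENNReal.ofReal (farMajorant γ α A S u p) +
          ENNReal.ofReal (farMajorant γ α A S u p.swap)) := by
        refine setLIntegral_mono (by fun_prop) fun p hp => ?_
        rw [← ENNReal.ofReal_add (farMajorant_nonneg _ _ hA _) (farMajorant_nonneg _ _ hA _),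
          ← ENNReal.ofReal_mul (by positivity)]
        exact ENNReal.ofReal_le_ofReal (abs_form_le_far hγ hγ' hα hα' hd hS hA hu hφ hφS hp)
    _ ≤ ∫⁻ p, ENNReal.ofReal (1024 * b) * (ENNReal.ofReal (farMajorant γ α A S u p) +
          ENNReal.ofReal (farMajorant γ α A S u p.swap)) := setLIntegral_le_lintegral _ _
    _ = _ := by
        rw [lintegral_const_mul _ (by fun_prop), lintegral_add_left (by fun_prop), hswap,
          ← two_mul, ← mul_assoc, show 2048 * b = 1024 * b * 2 by ring,
          ENNReal.ofReal_mul (p := 1024 * b) (by positivity)]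
        simp

/-- Lipschitz functions have finite energy on bounded sets. -/
lemma lintegral_kernelG_mul_sq {γ α M : ℝ} (hγ' : γ < 1 / 2) (hα' : α < 1 / 2)
    (hM : 0 < M) :
    ∫⁻ p in Metric.ball (0 : ℝ) M ×ˢ Metric.ball (0 : ℝ) M,
        ENNReal.ofReal (kernelG γ α p.1 p.2 * (p.1 - p.2) ^ 2)
      ≤ ENNReal.ofReal ((2 * M) ^ (1 - 2 * γ) * (2 * M ^ (1 - α) / (1 - α)) ^ 2) := by
  have h1a : 0 < 1 - α := by linarith
  calc _ ≤ ∫⁻ p in Metric.ball (0 : ℝ) M ×ˢ Metric.ball (0 : ℝ) M,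
        ENNReal.ofReal ((2 * M) ^ (1 - 2 * γ)) *
          (ENNReal.ofReal (|p.1| ^ (-α)) * ENNReal.ofReal (|p.2| ^ (-α))) := by
        refine setLIntegral_mono (by fun_prop) fun p hp => ?_
        rw [← ENNReal.ofReal_mul (by positivity), ← ENNReal.ofReal_mul (by positivity)]
        apply ENNReal.ofReal_le_ofReal
        have h1 : |p.1| < M := by simpa using hp.1
        have h2 : |p.2| < M := by simpa using hp.2
        have h3 : |p.1 - p.2| ≤ 2 * M := (abs_sub _ _).trans (by linarith)
        have h4 : |p.1 - p.2| ^ (-(1 + 2 * γ)) * (p.1 - p.2) ^ 2 ≤ (2 * M) ^ (1 - 2 * γ) := by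
          rcases eq_or_ne (p.1 - p.2) 0 with h | h
          · rw [h]; simp; positivity
          · rw [← sq_abs, ← Real.rpow_two, ← Real.rpow_add (abs_pos.2 h)]
            rw [show -(1 + 2 * γ) + 2 = 1 - 2 * γ by ring]
            exact Real.rpow_le_rpow (abs_nonneg _) h3 (by linarith)
        rw [kernelG_eq]
        calc _ = |p.1 - p.2| ^ (-(1 + 2 * γ)) * (p.1 - p.2) ^ 2 *
              (|p.1| ^ (-α) * |p.2| ^ (-α)) := by ring
          _ ≤ _ := by gcongr
    _ = ENNReal.ofReal ((2 * M) ^ (1 - 2 * γ)) *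
          ((∫⁻ x in Metric.ball (0 : ℝ) M, ENNReal.ofReal (|x| ^ (-α))) *
            ∫⁻ x in Metric.ball (0 : ℝ) M, ENNReal.ofReal (|x| ^ (-α))) := by
        rw [lintegral_const_mul _ (by fun_prop), Measure.volume_eq_prod, ← Measure.prod_restrict,
          lintegral_prod_mul (f := fun x : ℝ => ENNReal.ofReal (|x| ^ (-α)))
            (g := fun x : ℝ => ENNReal.ofReal (|x| ^ (-α))) (by fun_prop) (by fun_prop)]
    _ ≤ _ := by
        rw [ENNReal.ofReal_mul (by positivity), sq, ENNReal.ofReal_mul (by positivity)]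
        gcongr <;> exact lintegral_ball_abs_rpow_neg (by linarith) hM

/-- The product weight `|x|^{-α} |y|^{-α}` is of Muckenhoupt class `A₁` along the diagonal: its
average over a translation window does not exceed a multiple of its value. This is where `α < 1/2`
enters. -/
lemma lintegral_weight_translate {α ε x y : ℝ} (hα : 0 ≤ α) (hα' : α < 1 / 2) (hε : 0 < ε)
    (hx : x ≠ 0) (hy : y ≠ 0) :
    ∫⁻ z in Metric.ball (0 : ℝ) ε, ENNReal.ofReal (|x + z| ^ (-α) * |y + z| ^ (-α))
      ≤ ENNReal.ofReal (4 * (4 * profileMass + 32 / (1 - 2 * α)) * ε *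
          (|x| ^ (-α) * |y| ^ (-α))) := by
  have hpm := profileMass_nonneg
  have h12 : 0 < 1 - 2 * α := by linarith
  set C := 4 * (4 * profileMass + 32 / (1 - 2 * α)) with hC
  have hC0 : 0 ≤ C := by positivity
  have hone : ∀ x : ℝ, x ≠ 0 → ∫⁻ z in Metric.ball (0 : ℝ) ε,
      ENNReal.ofReal (|x + z| ^ (-(2 * α))) ≤ ENNReal.ofReal (C * ε * |x| ^ (-(2 * α))) := by
    intro x hx
    have h1 : ∫⁻ z in (fun z => x + z) ⁻¹' Metric.ball x ε,
        ENNReal.ofReal (|x + z| ^ (-(2 * α)))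
        = ∫⁻ z in Metric.ball x ε, ENNReal.ofReal (|z| ^ (-(2 * α))) :=
      (measurePreserving_add_left volume x).setLIntegral_comp_preimage
        (f := fun z => ENNReal.ofReal (|z| ^ (-(2 * α)))) measurableSet_ball (by fun_prop)
    have h2 : (fun z => x + z) ⁻¹' Metric.ball x ε = Metric.ball 0 ε := by
      ext z; simp
    rw [← h2, h1]
    refine (lintegral_ball_weight_le x hε (by linarith) (by linarith)).trans ?_
    apply ENNReal.ofReal_le_ofReal
    change C * (ε * (|x| + ε) ^ (-(2 * α))) ≤ _
    rw [mul_assoc C]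
    refine mul_le_mul_of_nonneg_left (mul_le_mul_of_nonneg_left ?_ hε.le) hC0
    exact Real.rpow_le_rpow_of_nonpos (abs_pos.2 hx) (by linarith) (by linarith)
  -- the arithmetic-geometric mean inequality, balanced so that both squares scale alike
  set X := |x| ^ (-α) with hX
  set Y := |y| ^ (-α) with hY
  have hX0 : 0 < X := Real.rpow_pos_of_pos (abs_pos.2 hx) _
  have hY0 : 0 < Y := Real.rpow_pos_of_pos (abs_pos.2 hy) _
  have hsq : ∀ t : ℝ, |t| ^ (-(2 * α)) = (|t| ^ (-α)) ^ 2 := by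
    intro t
    rw [← Real.rpow_mul_natCast (abs_nonneg _)]; congr 1; push_cast; ring
  calc _ ≤ ∫⁻ z in Metric.ball (0 : ℝ) ε,
        (ENNReal.ofReal (Y / (2 * X)) * ENNReal.ofReal (|x + z| ^ (-(2 * α))) +
          ENNReal.ofReal (X / (2 * Y)) * ENNReal.ofReal (|y + z| ^ (-(2 * α)))) := by
        refine lintegral_mono fun z => ?_
        rw [← ENNReal.ofReal_mul (by positivity), ← ENNReal.ofReal_mul (by positivity),
          ← ENNReal.ofReal_add (by positivity) (by positivity)]
        apply ENNReal.ofReal_le_ofReal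
        rw [hsq, hsq]
        set a := |x + z| ^ (-α)
        set b := |y + z| ^ (-α)
        have : Y / (2 * X) * a ^ 2 + X / (2 * Y) * b ^ 2 - a * b
            = (Y * a - X * b) ^ 2 / (2 * X * Y) := by field_simp; ring
        have h0 : 0 ≤ (Y * a - X * b) ^ 2 / (2 * X * Y) := by positivity
        linarith
    _ ≤ ENNReal.ofReal (Y / (2 * X)) * ENNReal.ofReal (C * ε * |x| ^ (-(2 * α))) +
          ENNReal.ofReal (X / (2 * Y)) * ENNReal.ofReal (C * ε * |y| ^ (-(2 * α))) := by
        rw [lintegral_add_left (by fun_prop), lintegral_const_mul _ (by fun_prop),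
          lintegral_const_mul _ (by fun_prop)]
        gcongr
        · exact hone x hx
        · exact hone y hy
    _ = _ := by
        rw [← ENNReal.ofReal_mul (by positivity), ← ENNReal.ofReal_mul (by positivity),
          ← ENNReal.ofReal_add (by positivity) (by positivity), hsq, hsq]
        congr 1
        rw [← hX, ← hY]
        field_simp
        ring

/-! ### Weak convergence and mollification in the energy space -/

open Filter Topology in
/-- A bounded sequence in `L²` that converges almost everywhere converges weakly. -/
lemma tendsto_integral_mul_of_bounded_sq {X : Type*} [MeasurableSpace X] {μ : Measure X}
    {U g : X → ℝ} {gn : ℕ → X → ℝ} {C : ℝ} (hU : MemLp U 2 μ) (hg : MemLp g 2 μ)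
    (hgn : ∀ n, MemLp (gn n) 2 μ) (hC : ∀ n, ∫ x, gn n x ^ 2 ∂μ ≤ C)
    (hlim : ∀ᵐ x ∂μ, Tendsto (fun n => gn n x) atTop (𝓝 (g x))) :
    Tendsto (fun n => ∫ x, U x * gn n x ∂μ) atTop (𝓝 (∫ x, U x * g x ∂μ)) := by
  have hUg : Integrable (fun x => U x * g x) μ := hU.integrable_mul hg
  have hUgn : ∀ n, Integrable (fun x => U x * gn n x) μ := fun n => hU.integrable_mul (hgn n)
  have hd : ∀ n, MemLp (fun x => gn n x - g x) 2 μ := fun n => (hgn n).sub hg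
  have hh : ∀ n, Integrable (fun x => |U x| * |gn n x - g x|) μ := fun n => by
    have := (hU.integrable_mul (hd n)).norm
    simpa [abs_mul] using this
  set C' := 2 * C + 2 * ∫ x, g x ^ 2 ∂μ with hC'
  have hC0 : 0 ≤ C' := by
    have h1 : 0 ≤ ∫ x, g x ^ 2 ∂μ := integral_nonneg fun x => sq_nonneg _
    have h2 : 0 ≤ ∫ x, gn 0 x ^ 2 ∂μ := integral_nonneg fun x => sq_nonneg _
    linarith [hC 0]
  have hdC : ∀ n, ∫ x, (gn n x - g x) ^ 2 ∂μ ≤ C' := fun n => by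
    calc ∫ x, (gn n x - g x) ^ 2 ∂μ ≤ ∫ x, (2 * gn n x ^ 2 + 2 * g x ^ 2) ∂μ := by
          refine integral_mono (hd n).integrable_sq
            (((hgn n).integrable_sq.const_mul 2).add (hg.integrable_sq.const_mul 2)) fun x => ?_
          dsimp only
          nlinarith [sq_nonneg (gn n x + g x)]
      _ ≤ C' := by
          rw [integral_add ((hgn n).integrable_sq.const_mul 2) (hg.integrable_sq.const_mul 2),
            integral_const_mul, integral_const_mul]
          linarith [hC n]
  -- where `|gn n - g| ≤ N |U|` dominated convergence applies; elsewhere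
  -- `|U| |gn n - g| ≤ |gn n - g|² / N`
  have hmin : ∀ N : ℝ, 0 < N → Tendsto
      (fun n => ∫ x, min (|U x| * |gn n x - g x|) (N * U x ^ 2) ∂μ) atTop (𝓝 0) := by
    intro N hN
    rw [← integral_zero X ℝ (μ := μ)]
    refine tendsto_integral_of_dominated_convergence (fun x => N * U x ^ 2) (fun n => ?_)
      (hU.integrable_sq.const_mul N) (fun n => ae_of_all _ fun x => ?_) ?_
    · exact ((hh n).inf (hU.integrable_sq.const_mul N)).aestronglyMeasurable
    · rw [Real.norm_of_nonneg (le_min (by positivity) (by positivity))]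
      exact min_le_right _ _
    · filter_upwards [hlim] with x hx
      have h1 : Tendsto (fun n => |U x| * |gn n x - g x|) atTop (𝓝 0) := by
        have := ((hx.sub_const (g x)).abs).const_mul |U x|
        simpa using this
      refine squeeze_zero (fun n => le_min (by positivity) (by positivity))
        (fun n => min_le_left _ _) h1
  rw [Metric.tendsto_atTop]
  intro ε hε
  set N := 2 * (C' + 1) / ε with hN
  have hN0 : 0 < N := by positivity
  obtain ⟨n0, hn0⟩ := (Metric.tendsto_atTop.1 (hmin N hN0)) (ε / 2) (by positivity)
  refine ⟨n0, fun n hn => ?_⟩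
  have h1 := hn0 n hn
  rw [Real.dist_eq, sub_zero] at h1
  have hImin : Integrable (fun x => min (|U x| * |gn n x - g x|) (N * U x ^ 2)) μ :=
    (hh n).inf (hU.integrable_sq.const_mul N)
  have hsplit : ∫ x, |U x| * |gn n x - g x| ∂μ
      ≤ ∫ x, min (|U x| * |gn n x - g x|) (N * U x ^ 2) ∂μ + N⁻¹ * C' := by
    calc _ ≤ ∫ x, (min (|U x| * |gn n x - g x|) (N * U x ^ 2)
            + N⁻¹ * (gn n x - g x) ^ 2) ∂μ := by
          refine integral_mono (hh n) (hImin.add ((hd n).integrable_sq.const_mul _)) fun x => ?_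
          dsimp only
          rcases le_total |gn n x - g x| (N * |U x|) with h | h
          · rw [min_eq_left]
            · have : 0 ≤ N⁻¹ * (gn n x - g x) ^ 2 := by positivity
              linarith
            · rw [← sq_abs (U x)]
              nlinarith [abs_nonneg (U x)]
          · have h2 : |U x| * |gn n x - g x| ≤ N⁻¹ * (gn n x - g x) ^ 2 := by
              rw [← sq_abs (gn n x - g x), inv_mul_eq_div, le_div_iff₀ hN0]
              nlinarith [abs_nonneg (gn n x - g x)]
            have h3 : 0 ≤ min (|U x| * |gn n x - g x|) (N * U x ^ 2) :=
              le_min (by positivity) (by positivity)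
            linarith
      _ ≤ _ := by
          rw [integral_add hImin ((hd n).integrable_sq.const_mul _), integral_const_mul]
          have := hdC n
          gcongr
  rw [Real.dist_eq, ← integral_sub (hUgn n) hUg]
  calc |∫ x, (U x * gn n x - U x * g x) ∂μ| ≤ ∫ x, |U x| * |gn n x - g x| ∂μ := by
        refine (abs_integral_le_integral_abs).trans_eq ?_
        congr 1; ext x; rw [← mul_sub, abs_mul]
    _ ≤ _ := hsplit
    _ < ε := by
        have h3 : N⁻¹ * C' < ε / 2 := by
          rw [hN, inv_div, div_mul_eq_mul_div, div_lt_div_iff₀ (by positivity) (by norm_num)]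
          nlinarith
        linarith [le_abs_self (∫ x, min (|U x| * |gn n x - g x|) (N * U x ^ 2) ∂μ)]

/-- Jensen's inequality for the square against a probability density. -/
lemma sq_integral_mul_le {ρ h : ℝ → ℝ} (hρ : Integrable ρ) (hρ0 : ∀ x, 0 ≤ ρ x)
    (hρ1 : ∫ x, ρ x = 1) (hh : Measurable h) {b : ℝ} (hb : ∀ x, |h x| ≤ b) :
    (∫ x, ρ x * h x) ^ 2 ≤ ∫ x, ρ x * h x ^ 2 := by
  have i1 : Integrable fun x => ρ x * h x :=
    hρ.mul_bdd (c := b) hh.aestronglyMeasurable (ae_of_all _ hb)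
  have i2 : Integrable fun x => ρ x * h x ^ 2 := by
    refine hρ.mul_bdd (c := b ^ 2) (by fun_prop) (ae_of_all _ fun x => ?_)
    rw [Real.norm_eq_abs, abs_pow]
    gcongr
    exact hb x
  set m := ∫ x, ρ x * h x with hm
  have h0 : 0 ≤ ∫ x, ρ x * (h x - m) ^ 2 :=
    integral_nonneg fun x => mul_nonneg (hρ0 x) (sq_nonneg _)
  have h1 : ∫ x, ρ x * (h x - m) ^ 2 = (∫ x, ρ x * h x ^ 2) - m ^ 2 := by
    calc _ = ∫ x, (ρ x * h x ^ 2 - 2 * m * (ρ x * h x) + m ^ 2 * ρ x) := by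
          congr 1; ext x; ring
      _ = _ := by
          have i3 : Integrable fun x => ρ x * h x ^ 2 - 2 * m * (ρ x * h x) :=
            i2.sub (i1.const_mul _)
          rw [integral_add i3 (hρ.const_mul _),
            integral_sub i2 (i1.const_mul _), integral_const_mul, integral_const_mul, hρ1, ← hm]
          ring
  rw [h1] at h0
  exact sub_nonneg.1 h0

lemma ae_prod_ne_zero : ∀ᵐ p : ℝ × ℝ, p.1 ≠ 0 ∧ p.2 ≠ 0 := by
  have h0 : ∀ᵐ x : ℝ, x ≠ 0 := by simp [ae_iff]
  rw [Measure.volume_eq_prod]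
  filter_upwards [Measure.quasiMeasurePreserving_fst.ae h0,
    Measure.quasiMeasurePreserving_snd.ae h0] with p h1 h2 using ⟨h1, h2⟩

/-- Mollification is bounded on the weighted energy space, uniformly in the radius, provided the
bump functions have comparable inner and outer radii. -/
lemma lintegral_energy_mollify_le {γ α : ℝ} (hα : 0 ≤ α) (hα' : α < 1 / 2)
    (ρ : ContDiffBump (0 : ℝ)) (hρ : ρ.rOut = 2 * ρ.rIn) {φ : ℝ → ℝ} (hφ : Measurable φ) {b : ℝ}
    (hb : ∀ x, |φ x| ≤ b) :
    ∫⁻ p : ℝ × ℝ, ENNReal.ofReal (kernelG γ α p.1 p.2 *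
        ((∫ z, ρ.normed volume z * φ (p.1 - z)) - ∫ z, ρ.normed volume z * φ (p.2 - z)) ^ 2)
      ≤ ENNReal.ofReal (4 * (4 * profileMass + 32 / (1 - 2 * α))) *
        ∫⁻ p : ℝ × ℝ, ENNReal.ofReal (kernelG γ α p.1 p.2 * (φ p.1 - φ p.2) ^ 2) := by
  set η := ρ.normed volume with hη
  have hηm : Measurable η := ρ.continuous_normed.measurable
  have hη0 : ∀ x, 0 ≤ η x := ρ.nonneg_normed
  have hηi : Integrable η := ρ.integrable_normed
  have hη1 : ∫ x, η x = 1 := ρ.integral_normed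
  have hε : 0 < ρ.rIn := ρ.rIn_pos
  have hηle : ∀ z, ENNReal.ofReal (η z) ≤
      ENNReal.ofReal (1 / ρ.rOut) * (Metric.ball (0 : ℝ) ρ.rOut).indicator 1 z := by
    intro z
    by_cases hz : z ∈ Metric.ball (0 : ℝ) ρ.rOut
    · rw [indicator_of_mem hz, Pi.one_apply, mul_one]
      apply ENNReal.ofReal_le_ofReal
      have := ρ.normed_le_div_measure_closedBall_rIn volume z
      rwa [Measure.real, Real.volume_closedBall, ENNReal.toReal_ofReal (by positivity), ← hρ]
        at this
    · have : η z = 0 := by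
        rw [← ρ.support_normed_eq (μ := volume)] at hz
        simpa using hz
      rw [this]; simp
  have hpt : ∀ p : ℝ × ℝ, ENNReal.ofReal (kernelG γ α p.1 p.2 *
        ((∫ z, η z * φ (p.1 - z)) - ∫ z, η z * φ (p.2 - z)) ^ 2)
      ≤ ∫⁻ z, ENNReal.ofReal (η z) * ENNReal.ofReal (kernelG γ α p.1 p.2 *
          (φ (p.1 - z) - φ (p.2 - z)) ^ 2) := by
    intro p
    have hb' : ∀ z, |φ (p.1 - z) - φ (p.2 - z)| ≤ 2 * b := fun z =>
      (abs_sub _ _).trans (by linarith [hb (p.1 - z), hb (p.2 - z)])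
    have e1 : (∫ z, η z * φ (p.1 - z)) - ∫ z, η z * φ (p.2 - z)
        = ∫ z, η z * (φ (p.1 - z) - φ (p.2 - z)) := by
      rw [← integral_sub]
      · congr 1; ext z; ring
      · exact hηi.mul_bdd (c := b) (hφ.comp (measurable_const.sub measurable_id)).aestronglyMeasurable
          (ae_of_all _ fun _ => hb _)
      · exact hηi.mul_bdd (c := b) (hφ.comp (measurable_const.sub measurable_id)).aestronglyMeasurable
          (ae_of_all _ fun _ => hb _)
    have i2 : Integrable fun z => η z * (φ (p.1 - z) - φ (p.2 - z)) ^ 2 := by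
      refine hηi.mul_bdd (c := (2 * b) ^ 2) (by fun_prop) (ae_of_all _ fun x => ?_)
      rw [Real.norm_eq_abs, abs_pow]
      gcongr
      exact hb' x
    have h2 := sq_integral_mul_le hηi hη0 hη1
      (h := fun z => φ (p.1 - z) - φ (p.2 - z)) (by fun_prop) hb'
    rw [e1]
    calc _ ≤ ENNReal.ofReal (kernelG γ α p.1 p.2 * ∫ z, η z * (φ (p.1 - z) - φ (p.2 - z)) ^ 2) :=
          ENNReal.ofReal_le_ofReal (mul_le_mul_of_nonneg_left h2 (kernelG_nonneg _ _ _ _))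
      _ = ∫⁻ z, ENNReal.ofReal (kernelG γ α p.1 p.2 * (η z * (φ (p.1 - z) - φ (p.2 - z)) ^ 2)) := by
          rw [← integral_const_mul, ofReal_integral_eq_lintegral_ofReal (i2.const_mul _)]
          exact ae_of_all _ fun z => mul_nonneg (kernelG_nonneg _ _ _ _)
            (mul_nonneg (hη0 z) (sq_nonneg _))
      _ = _ := by
          congr 1; ext z
          rw [← ENNReal.ofReal_mul (hη0 z)]
          congr 1; ring
  have hae := ae_prod_ne_zero
  calc _ ≤ ∫⁻ p : ℝ × ℝ, ∫⁻ z, ENNReal.ofReal (η z) * ENNReal.ofReal (kernelG γ α p.1 p.2 *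
          (φ (p.1 - z) - φ (p.2 - z)) ^ 2) := lintegral_mono hpt
    _ = ∫⁻ z, ∫⁻ p : ℝ × ℝ, ENNReal.ofReal (η z) * ENNReal.ofReal (kernelG γ α p.1 p.2 *
          (φ (p.1 - z) - φ (p.2 - z)) ^ 2) :=
        lintegral_lintegral_swap (Measurable.aemeasurable (by fun_prop))
    _ = ∫⁻ z, ∫⁻ p : ℝ × ℝ, ENNReal.ofReal (η z) * ENNReal.ofReal (kernelG γ α (p.1 + z) (p.2 + z) *
          (φ p.1 - φ p.2) ^ 2) := by
        congr 1; ext z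
        rw [← lintegral_add_right_eq_self _ ((z, z) : ℝ × ℝ)]
        simp
    _ = ∫⁻ p : ℝ × ℝ, ∫⁻ z, ENNReal.ofReal (η z) * ENNReal.ofReal (kernelG γ α (p.1 + z) (p.2 + z) *
          (φ p.1 - φ p.2) ^ 2) :=
        lintegral_lintegral_swap (Measurable.aemeasurable (by fun_prop))
    _ ≤ ∫⁻ p : ℝ × ℝ, ENNReal.ofReal (4 * (4 * profileMass + 32 / (1 - 2 * α))) *
          ENNReal.ofReal (kernelG γ α p.1 p.2 * (φ p.1 - φ p.2) ^ 2) := by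
        refine lintegral_mono_ae ?_
        filter_upwards [hae] with p hp
        have hC0 : 0 ≤ 4 * (4 * profileMass + 32 / (1 - 2 * α)) := by
          have := profileMass_nonneg
          have : 0 < 1 - 2 * α := by linarith
          positivity
        set C := 4 * (4 * profileMass + 32 / (1 - 2 * α)) with hC
        set D := |p.1 - p.2| ^ (-(1 + 2 * γ)) * (φ p.1 - φ p.2) ^ 2 with hD
        have hD0 : 0 ≤ D := by positivity
        calc _ ≤ ∫⁻ z, (Metric.ball (0 : ℝ) ρ.rOut).indicator (fun z =>
              ENNReal.ofReal (1 / ρ.rOut * D) *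
                ENNReal.ofReal (|p.1 + z| ^ (-α) * |p.2 + z| ^ (-α))) z := by
              refine lintegral_mono fun z => ?_
              dsimp only
              refine (mul_le_mul_left (hηle z) _).trans_eq ?_
              by_cases hz : z ∈ Metric.ball (0 : ℝ) ρ.rOut
              · have := ρ.rOut_pos
                simp only [hz, indicator_of_mem, Pi.one_apply, mul_one]
                rw [← ENNReal.ofReal_mul (by positivity), ← ENNReal.ofReal_mul (by positivity),
                  kernelG_eq, hD]
                congr 1
                rw [show p.1 + z - (p.2 + z) = p.1 - p.2 by ring]
                ring
              · simp [hz]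
          _ = ENNReal.ofReal (1 / ρ.rOut * D) * ∫⁻ z in Metric.ball (0 : ℝ) ρ.rOut,
                ENNReal.ofReal (|p.1 + z| ^ (-α) * |p.2 + z| ^ (-α)) := by
              rw [lintegral_indicator measurableSet_ball, lintegral_const_mul _ (by fun_prop)]
          _ ≤ ENNReal.ofReal (1 / ρ.rOut * D) * ENNReal.ofReal (C * ρ.rOut *
                (|p.1| ^ (-α) * |p.2| ^ (-α))) := by
              gcongr
              exact lintegral_weight_translate hα hα' ρ.rOut_pos hp.1 hp.2
          _ = _ := by
              have := ρ.rOut_pos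
              rw [← ENNReal.ofReal_mul (by positivity), ← ENNReal.ofReal_mul hC0, kernelG_eq, hD]
              congr 1
              field_simp
    _ = _ := lintegral_const_mul _ (by fun_prop)

/-! ### Test functions of finite energy -/

/-- Functions of finite energy on `s`, viewed as elements of `L²(s)` by multiplying their
differences with `√G`. -/
lemma memLp_two_mul_sqrt_kernelG {γ α : ℝ} {h : ℝ × ℝ → ℝ} (hh : Measurable h)
    {s : Set (ℝ × ℝ)} (hs : ∫⁻ p in s, ENNReal.ofReal (kernelG γ α p.1 p.2 * h p ^ 2) < ⊤) :
    MemLp (fun p => h p * √(kernelG γ α p.1 p.2)) 2 (volume.restrict s) ∧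
      ∫ p in s, (h p * √(kernelG γ α p.1 p.2)) ^ 2
        = (∫⁻ p in s, ENNReal.ofReal (kernelG γ α p.1 p.2 * h p ^ 2)).toReal := by
  have e : ∀ p : ℝ × ℝ, (h p * √(kernelG γ α p.1 p.2)) ^ 2 = kernelG γ α p.1 p.2 * h p ^ 2 := by
    intro p; rw [mul_pow, Real.sq_sqrt (kernelG_nonneg _ _ _ _), mul_comm]
  have hn : ∀ p : ℝ × ℝ, 0 ≤ kernelG γ α p.1 p.2 * h p ^ 2 := fun p =>
    mul_nonneg (kernelG_nonneg _ _ _ _) (sq_nonneg _)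
  constructor
  · rw [memLp_two_iff_integrable_sq (by fun_prop)]
    simp_rw [e]
    exact (lintegral_ofReal_ne_top_iff_integrable (by fun_prop) (ae_of_all _ hn)).1 hs.ne
  · simp_rw [e]
    exact integral_eq_lintegral_of_nonneg_ae (ae_of_all _ hn) (by fun_prop)

lemma integrable_farMajorant {γ α A : ℝ} {S : Set ℝ} (hS : MeasurableSet S) {u : ℝ → ℝ}
    (hu : Measurable u) (hA : 0 ≤ A) (h1 : ∫⁻ x in S, ENNReal.ofReal (|x| ^ (-α)) < ⊤)
    (h2 : ∫⁻ y, ENNReal.ofReal ((A + |u y|) * (1 + |y| ^ (1 + 2 * γ + α))⁻¹) < ⊤) :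
    Integrable (farMajorant γ α A S u) := by
  refine (lintegral_ofReal_ne_top_iff_integrable
    (measurable_farMajorant hS hu).aestronglyMeasurable
    (ae_of_all _ fun p => farMajorant_nonneg _ _ hA p)).1 ?_
  rw [lintegral_farMajorant hS hu]
  exact (ENNReal.mul_lt_top h1 h2).ne

lemma memL1q_zero (q : ℝ) : MemL1q q (fun _ => (0 : ℝ)) := by
  refine ⟨locallyIntegrable_zero, ?_⟩
  simp

lemma IsWeakSolution.energy_lt_top {γ α M : ℝ} {F u : ℝ → ℝ} (hM : 0 < M)
    (hw : IsWeakSolution γ α (Ioo (-(2 * M)) (2 * M)) F u) :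
    ∫⁻ p in Metric.ball (0 : ℝ) M ×ˢ Metric.ball (0 : ℝ) M,
      ENNReal.ofReal (kernelG γ α p.1 p.2 * (u p.1 - u p.2) ^ 2) < ⊤ := by
  refine lt_of_le_of_lt (lintegral_mono_set ?_)
    (hw.1 (Metric.closedBall 0 M) (isCompact_closedBall _ _) ?_)
  · exact prod_mono Metric.ball_subset_closedBall Metric.ball_subset_closedBall
  · rw [Real.closedBall_eq_Icc]
    exact fun x hx => ⟨by linarith [hx.1], by linarith [hx.2]⟩

open Filter Topology Convolution in
/-- The weak formulation extends from smooth test functions to bounded functions of finite energy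
supported well inside `(-M, M)`. The test function is mollified; on `(-M, M)²` the mollified
differences stay bounded in `L²(G dx dy)` and so converge weakly, off this square dominated
convergence applies. -/
lemma weak_form_of_finite_energy {γ α M A b : ℝ} {F u φ : ℝ → ℝ}
    (hγ : 1 / 8 ≤ γ) (hγ' : γ < 1 / 2) (hα : 0 ≤ α) (hα' : α < 1 / 2) (hM : 1 < M) (hA : 0 ≤ A)
    (hum : Measurable u) (hu : ∀ x ∈ Metric.ball 0 M, |u x| ≤ A)
    (hq : MemL1q (1 + 2 * γ + α) u)
    (hw : IsWeakSolution γ α (Ioo (-(2 * M)) (2 * M)) F u)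
    (hφm : Measurable φ) (hφb : ∀ x, |φ x| ≤ b) (hφS : ∀ x, 7 / 8 * M ≤ |x| → φ x = 0)
    (hφE : ∫⁻ p in Metric.ball (0 : ℝ) M ×ˢ Metric.ball (0 : ℝ) M,
      ENNReal.ofReal (kernelG γ α p.1 p.2 * (φ p.1 - φ p.2) ^ 2) < ⊤) :
    Integrable (fun p : ℝ × ℝ => (u p.1 - u p.2) * (φ p.1 - φ p.2) * kernelG γ α p.1 p.2) ∧
      ∫ p : ℝ × ℝ, (u p.1 - u p.2) * (φ p.1 - φ p.2) * kernelG γ α p.1 p.2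
        = 2 * ∫ x, F x * φ x := by
  have hb : 0 ≤ b := (abs_nonneg _).trans (hφb 0)
  have hM0 : 0 < M := by linarith
  set D2 := Metric.ball (0 : ℝ) M ×ˢ Metric.ball (0 : ℝ) M with hD2
  have hD2m : MeasurableSet D2 := measurableSet_ball.prod measurableSet_ball
  set S := Metric.ball (0 : ℝ) (15 / 16 * M) with hS
  have hSm : MeasurableSet S := measurableSet_ball
  have hS1 : ∫⁻ x in S, ENNReal.ofReal (|x| ^ (-α)) < ⊤ :=
    (lintegral_ball_abs_rpow_neg (by linarith) (by positivity)).trans_lt ENNReal.ofReal_lt_top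
  have hφS' : ∀ x, x ∉ S → φ x = 0 := fun x hx => hφS x (by
    simp only [hS, Metric.mem_ball, dist_zero_right, Real.norm_eq_abs, not_lt] at hx
    linarith)
  have hUE : ∫⁻ p in D2, ENNReal.ofReal (kernelG γ α p.1 p.2 * (u p.1 - u p.2) ^ 2) < ⊤ :=
    hw.energy_lt_top hM0
  have hφtot : ∫⁻ p : ℝ × ℝ, ENNReal.ofReal (kernelG γ α p.1 p.2 * (φ p.1 - φ p.2) ^ 2) < ⊤ := by
    rw [← lintegral_add_compl _ hD2m]
    refine ENNReal.add_lt_top.2 ⟨hφE, ?_⟩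
    have h1 := lintegral_abs_form_far (u := φ) (φ := φ) (by linarith) hγ' hα hα'
      (by linarith : 3 / 4 ≤ M) hS.subset hSm hb hφm (fun x _ => hφb x) hφb hφS'
    refine lt_of_le_of_lt (lintegral_mono fun p => ?_) (h1.trans_lt ?_)
    · apply ENNReal.ofReal_le_ofReal
      rw [← sq, mul_comm]
      exact le_abs_self _
    · refine ENNReal.mul_lt_top ENNReal.ofReal_lt_top (ENNReal.mul_lt_top hS1 ?_)
      refine lt_of_le_of_lt (lintegral_mono fun y => ?_) ((lintegral_tail_le hγ hα
        (A := 2 * b) (by positivity) (memL1q_zero _)).trans_lt ENNReal.ofReal_lt_top)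
      apply ENNReal.ofReal_le_ofReal
      refine mul_le_mul_of_nonneg_right ?_ (by positivity)
      change b + |φ y| ≤ 2 * b + |(0 : ℝ)|
      rw [abs_zero]
      linarith [hφb y]
  -- the inner radius is half the outer one, as the mollification estimate requires, and the outer
  -- radius is so small that the mollified functions are supported in `S`
  let ρ : ℕ → ContDiffBump (0 : ℝ) := fun n =>
    ⟨M / 64 / (n + 1), 2 * (M / 64 / (n + 1)), by positivity, by
      have : 0 < M / 64 / (n + 1 : ℝ) := by positivity
      linarith⟩
  have hρ2 : ∀ n, (ρ n).rOut = 2 * (ρ n).rIn := fun n => rfl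
  have hρM : ∀ n, (ρ n).rOut ≤ M / 32 := fun n => by
    have h1 : M / 64 / ((n : ℝ) + 1) ≤ M / 64 :=
      div_le_self (by positivity) (by linarith [(Nat.cast_nonneg n : (0 : ℝ) ≤ n)])
    change 2 * (M / 64 / ((n : ℝ) + 1)) ≤ _
    linarith
  have hρlim : Tendsto (fun n => (ρ n).rOut) atTop (𝓝 0) := by
    have := (tendsto_const_div_atTop_nhds_zero_nat (M / 64)).comp (tendsto_add_atTop_nat 1)
    have := this.const_mul 2
    simpa using this
  let φn : ℕ → ℝ → ℝ := fun n x => ∫ z, (ρ n).normed volume z * φ (x - z)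
  have hφint : Integrable φ := by
    have h1 : IntegrableOn φ S := by
      refine IntegrableOn.of_bound measure_ball_lt_top hφm.aestronglyMeasurable b
        (ae_of_all _ hφb)
    have h2 : S.indicator φ = φ := by
      ext x
      by_cases hx : x ∈ S
      · simp [hx]
      · simp [hx, hφS' x hx]
    rw [← h2]
    exact (integrable_indicator_iff hSm).2 h1
  have hφn_lim : ∀ᵐ x, Tendsto (fun n => φn n x) atTop (𝓝 (φ x)) :=
    ContDiffBump.ae_convolution_tendsto_right_of_locallyIntegrable (K := 2) hρlim
      (Eventually.of_forall fun n => (hρ2 n).le) hφint.locallyIntegrable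
  have hφn_diff : ∀ n, ContDiff ℝ ∞ (φn n) := fun n =>
    HasCompactSupport.contDiff_convolution_left (ContinuousLinearMap.lsmul ℝ ℝ)
      (ρ n).hasCompactSupport_normed (ρ n).contDiff_normed hφint.locallyIntegrable
  have hφn_zero : ∀ n x, 29 / 32 * M ≤ |x| → φn n x = 0 := by
    intro n x hx
    refine integral_eq_zero_of_ae (ae_of_all _ fun z => ?_)
    by_cases hz : z ∈ Metric.ball (0 : ℝ) (ρ n).rOut
    · have : φ (x - z) = 0 := hφS _ (by
        simp only [Metric.mem_ball, dist_zero_right, Real.norm_eq_abs] at hz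
        have := abs_sub_abs_le_abs_sub x z
        linarith [hρM n])
      simp [this]
    · rw [← (ρ n).support_normed_eq (μ := volume)] at hz
      simp [Function.notMem_support.1 hz]
  have hφn_S : ∀ n x, x ∉ S → φn n x = 0 := fun n x hx => hφn_zero n x (by
    simp only [hS, Metric.mem_ball, dist_zero_right, Real.norm_eq_abs, not_lt] at hx
    linarith)
  have hφn_b : ∀ n x, |φn n x| ≤ b := by
    intro n x
    calc |φn n x| ≤ ∫ z, (ρ n).normed volume z * b := by
          refine abs_integral_le_integral_abs.trans (integral_mono_of_nonneg
            (ae_of_all _ fun z => abs_nonneg _) ((ρ n).integrable_normed.mul_const b)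
            (ae_of_all _ fun z => ?_))
          dsimp only
          rw [abs_mul, abs_of_nonneg ((ρ n).nonneg_normed z)]
          exact mul_le_mul_of_nonneg_left (hφb _) ((ρ n).nonneg_normed z)
      _ = b := by rw [integral_mul_const, (ρ n).integral_normed, one_mul]
  have hφn_test : ∀ n, IsTestFunction (Ioo (-(2 * M)) (2 * M)) (φn n) := by
    intro n
    have hsub : Function.support (φn n) ⊆ Metric.closedBall 0 (29 / 32 * M) := by
      intro x hx
      by_contra h
      simp only [Metric.mem_closedBall, dist_zero_right, Real.norm_eq_abs, not_le] at h
      exact hx (hφn_zero n x h.le)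
    refine ⟨hφn_diff n, HasCompactSupport.of_support_subset_isCompact
      (isCompact_closedBall 0 (29 / 32 * M)) hsub, ?_⟩
    refine (closure_minimal hsub Metric.isClosed_closedBall).trans ?_
    rw [Real.closedBall_eq_Icc]
    exact fun x hx => ⟨by linarith [hx.1], by linarith [hx.2]⟩
  have hae : ∀ᵐ p : ℝ × ℝ, Tendsto (fun n => φn n p.1) atTop (𝓝 (φ p.1)) ∧
      Tendsto (fun n => φn n p.2) atTop (𝓝 (φ p.2)) := by
    rw [Measure.volume_eq_prod]
    filter_upwards [Measure.quasiMeasurePreserving_fst.ae hφn_lim,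
      Measure.quasiMeasurePreserving_snd.ae hφn_lim] with p h1 h2 using ⟨h1, h2⟩
  have hφn_m : ∀ n, Measurable (φn n) := fun n => (hφn_diff n).continuous.measurable
  -- On `D2` the form is the `L²` pairing of `(u(x) - u(y)) √G` and `(φ(x) - φ(y)) √G`, and the
  -- mollifications converge weakly in the second factor.
  have hU := memLp_two_mul_sqrt_kernelG (γ := γ) (α := α) (h := fun p => u p.1 - u p.2)
    (by fun_prop) hUE
  have hg := memLp_two_mul_sqrt_kernelG (γ := γ) (α := α) (h := fun p => φ p.1 - φ p.2)
    (by fun_prop) hφE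
  have hfin : ENNReal.ofReal (4 * (4 * profileMass + 32 / (1 - 2 * α))) *
        ∫⁻ p : ℝ × ℝ, ENNReal.ofReal (kernelG γ α p.1 p.2 * (φ p.1 - φ p.2) ^ 2) < ⊤ :=
    ENNReal.mul_lt_top ENNReal.ofReal_lt_top hφtot
  have hgE : ∀ n, ∫⁻ p in D2, ENNReal.ofReal (kernelG γ α p.1 p.2 * (φn n p.1 - φn n p.2) ^ 2)
      ≤ ENNReal.ofReal (4 * (4 * profileMass + 32 / (1 - 2 * α))) *
        ∫⁻ p : ℝ × ℝ, ENNReal.ofReal (kernelG γ α p.1 p.2 * (φ p.1 - φ p.2) ^ 2) := fun n =>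
    (setLIntegral_le_lintegral _ _).trans
      (lintegral_energy_mollify_le hα hα' (ρ n) (hρ2 n) hφm hφb)
  have hgn := fun n => memLp_two_mul_sqrt_kernelG (γ := γ) (α := α)
    (h := fun p => φn n p.1 - φn n p.2) (by have := hφn_m n; fun_prop) ((hgE n).trans_lt hfin)
  have hsqrt : ∀ (p : ℝ × ℝ) (a c : ℝ), a * √(kernelG γ α p.1 p.2) * (c * √(kernelG γ α p.1 p.2))
      = a * c * kernelG γ α p.1 p.2 := by
    intro p a c
    rw [mul_mul_mul_comm, Real.mul_self_sqrt (kernelG_nonneg _ _ _ _)]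
  have hnear := tendsto_integral_mul_of_bounded_sq hU.1 hg.1 (fun n => (hgn n).1)
    (fun n => (hgn n).2.trans_le (ENNReal.toReal_mono hfin.ne (hgE n))) (by
      refine ae_restrict_of_ae ?_
      filter_upwards [hae] with p hp
      exact (hp.1.sub hp.2).mul_const _)
  simp only [hsqrt] at hnear
  have hInear : IntegrableOn
      (fun p : ℝ × ℝ => (u p.1 - u p.2) * (φ p.1 - φ p.2) * kernelG γ α p.1 p.2) D2 := by
    have := hU.1.integrable_mul hg.1
    refine this.congr (ae_of_all _ fun p => ?_)
    exact hsqrt p _ _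
  -- off `D2` the densities have a common integrable majorant
  have hmaj : Integrable (farMajorant γ α A S u) := integrable_farMajorant hSm hum hA hS1
    ((lintegral_tail_le hγ hα hA hq).trans_lt ENNReal.ofReal_lt_top)
  have hmaj2 : Integrable fun p : ℝ × ℝ =>
      1024 * b * (farMajorant γ α A S u p + farMajorant γ α A S u p.swap) :=
    (hmaj.add hmaj.swap).const_mul _
  have hfar : Tendsto (fun n => ∫ p in D2ᶜ,
      (u p.1 - u p.2) * (φn n p.1 - φn n p.2) * kernelG γ α p.1 p.2) atTop
      (𝓝 (∫ p in D2ᶜ, (u p.1 - u p.2) * (φ p.1 - φ p.2) * kernelG γ α p.1 p.2)) := by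
    refine tendsto_integral_of_dominated_convergence _ (fun n => ?_) hmaj2.integrableOn
      (fun n => ?_) ?_
    · have := hφn_m n
      exact Measurable.aestronglyMeasurable (by fun_prop)
    · refine (ae_restrict_iff' hD2m.compl).2 (ae_of_all _ fun p hp => ?_)
      exact abs_form_le_far (by linarith) hγ' hα hα' (by linarith) hS.subset hA hu (hφn_b n)
        (hφn_S n) hp
    · refine ae_restrict_of_ae ?_
      filter_upwards [hae] with p hp
      exact ((hp.1.sub hp.2).const_mul _).mul_const _
  have hIfar : IntegrableOn
      (fun p : ℝ × ℝ => (u p.1 - u p.2) * (φ p.1 - φ p.2) * kernelG γ α p.1 p.2) D2ᶜ := by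
    refine Integrable.mono' hmaj2.integrableOn (Measurable.aestronglyMeasurable (by fun_prop)) ?_
    refine (ae_restrict_iff' hD2m.compl).2 (ae_of_all _ fun p hp => ?_)
    exact abs_form_le_far (by linarith) hγ' hα hα' (by linarith) hS.subset hA hu hφb hφS' hp
  have hI : Integrable
      (fun p : ℝ × ℝ => (u p.1 - u p.2) * (φ p.1 - φ p.2) * kernelG γ α p.1 p.2) := by
    rw [← integrableOn_univ, ← union_compl_self D2]
    exact hInear.union hIfar
  -- `F` is integrable near the supports since the definition can be tested with a bump `χ`
  let χ : ContDiffBump (0 : ℝ) := ⟨15 / 16 * M, M, by positivity, by linarith⟩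
  have hχ : Integrable fun x => F x * χ x := by
    refine (hw.2 χ ⟨χ.contDiff, χ.hasCompactSupport, ?_⟩).2.1
    rw [χ.tsupport_eq, Real.closedBall_eq_Icc]
    exact fun x hx => ⟨by linarith [hx.1], by linarith [hx.2]⟩
  have hFχ : ∀ n x, |F x * φn n x| ≤ |F x * χ x| * b := by
    intro n x
    by_cases hx : x ∈ S
    · rw [χ.one_of_mem_closedBall (Metric.ball_subset_closedBall hx), mul_one, abs_mul]
      gcongr
      exact hφn_b n x
    · rw [hφn_S n x hx, mul_zero, abs_zero]; positivity
  have hrhs : Tendsto (fun n => ∫ x, F x * φn n x) atTop (𝓝 (∫ x, F x * φ x)) := by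
    refine tendsto_integral_of_dominated_convergence (fun x => |F x * χ x| * b)
      (fun n => (hw.2 _ (hφn_test n)).2.1.aestronglyMeasurable) (hχ.abs.mul_const b)
      (fun n => ae_of_all _ (hFχ n)) ?_
    filter_upwards [hφn_lim] with x hx
    exact hx.const_mul _
  refine ⟨hI, ?_⟩
  rw [← integral_add_compl hD2m hI]
  refine tendsto_nhds_unique (hnear.add hfar) ?_
  refine (hrhs.const_mul 2).congr fun n => ?_
  have h1 := hw.2 _ (hφn_test n)
  rw [integral_add_compl hD2m h1.1, ← h1.2.2]
  ring

/-! ### Caccioppoli's inequality -/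

lemma ofReal_abs_integral_le {X : Type*} [MeasurableSpace X] {μ : Measure X} (f : X → ℝ) :
    ENNReal.ofReal |∫ x, f x ∂μ| ≤ ∫⁻ x, ENNReal.ofReal |f x| ∂μ := by
  have := enorm_integral_le_lintegral_enorm (μ := μ) f
  simpa only [Real.enorm_eq_ofReal_abs] using this

/-- The Lipschitz cutoff around `x₀` with slope `k`, equal to `1` where `k |x - x₀| ≤ b - 1` and
to `0` where `k |x - x₀| ≥ b`. -/
noncomputable def cutoff (b k x₀ x : ℝ) : ℝ := max 0 (min 1 (b - k * |x - x₀|))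

lemma cutoff_nonneg (b k x₀ x : ℝ) : 0 ≤ cutoff b k x₀ x := le_max_left _ _

lemma cutoff_le_one (b k x₀ x : ℝ) : cutoff b k x₀ x ≤ 1 :=
  max_le zero_le_one (min_le_left _ _)

lemma cutoff_eq_one {b k x₀ x : ℝ} (h : k * |x - x₀| ≤ b - 1) : cutoff b k x₀ x = 1 := by
  unfold cutoff
  rw [min_eq_left (by linarith), max_eq_right zero_le_one]

lemma cutoff_eq_zero {b k x₀ x : ℝ} (h : b ≤ k * |x - x₀|) : cutoff b k x₀ x = 0 := by
  unfold cutoff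
  rw [max_eq_left]
  exact (min_le_right _ _).trans (by linarith)

lemma abs_cutoff_sub_le {b k x₀ : ℝ} (hk : 0 ≤ k) (x y : ℝ) :
    |cutoff b k x₀ x - cutoff b k x₀ y| ≤ k * |x - y| := by
  unfold cutoff
  refine (abs_max_sub_max_le_max _ _ _ _).trans (max_le ?_ ?_)
  · simp only [sub_self, abs_zero]; positivity
  · refine (abs_min_sub_min_le_max _ _ _ _).trans (max_le ?_ ?_)
    · simp only [sub_self, abs_zero]; positivity
    · rw [show b - k * |x - x₀| - (b - k * |y - x₀|) = k * (|y - x₀| - |x - x₀|) by ring, abs_mul,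
        abs_of_nonneg hk]
      refine mul_le_mul_of_nonneg_left ?_ hk
      have := abs_abs_sub_abs_le (y - x₀) (x - x₀)
      rwa [sub_sub_sub_cancel_right, abs_sub_comm y x] at this

@[fun_prop]
lemma measurable_cutoff (b k x₀ : ℝ) : Measurable (cutoff b k x₀) := by
  unfold cutoff; fun_prop

/-- A measurable representative `u` of a weak solution on `(-2M, 2M)`, pointwise bounded on
`(-M, M)`, together with the bounds on the data on which the regularity estimate depends.
The lower bound on `γ` leaves room for the polynomial weights in the hole-filling argument. -/
structure BoundedSolution (θ₀ M A B K γ α θ : ℝ) (F u : ℝ → ℝ) : Prop where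
  one_lt_M : 1 < M
  A_nonneg : 0 ≤ A
  B_nonneg : 0 ≤ B
  K_nonneg : 0 ≤ K
  le_γ : 3 / 8 ≤ γ
  γ_lt : γ < 1 / 2
  α_nonneg : 0 ≤ α
  α_lt : α < 1 / 2
  θ_nonneg : 0 ≤ θ
  θ_le : θ ≤ θ₀
  θ₀_lt : θ₀ < 1
  measurable : Measurable u
  abs_le : ∀ x ∈ Metric.ball (0 : ℝ) M, |u x| ≤ A
  memL1q : MemL1q (1 + 2 * γ + α) u
  norm_le : normL1q (1 + 2 * γ + α) u ≤ K
  rhs_le : ∀ᵐ x ∂volume.restrict (Metric.ball (0 : ℝ) M), |F x| ≤ B * |x| ^ (-θ)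
  weak : IsWeakSolution γ α (Ioo (-(2 * M)) (2 * M)) F u

namespace BoundedSolution

variable {θ₀ M A B K γ α θ : ℝ} {F u : ℝ → ℝ}

/-- The far field of the solution, bounded in terms of the data. -/
lemma lintegral_tail (h : BoundedSolution θ₀ M A B K γ α θ F u) :
    ∫⁻ y, ENNReal.ofReal ((A + |u y|) * (1 + |y| ^ (1 + 2 * γ + α))⁻¹)
      ≤ ENNReal.ofReal (4 * A * profileMass + K) :=
  (lintegral_tail_le (by linarith [h.le_γ]) h.α_nonneg h.A_nonneg h.memL1q).trans
    (ENNReal.ofReal_le_ofReal (by linarith [h.norm_le]))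

lemma ofReal_abs_rhs_le (h : BoundedSolution θ₀ M A B K γ α θ F u) {φ : ℝ → ℝ} {b : ℝ}
    {S : Set ℝ} (hS : S ⊆ Metric.ball 0 M) (hb : ∀ x, |φ x| ≤ b)
    (hφ : ∀ x, x ∉ S → φ x = 0) :
    ENNReal.ofReal |∫ x, F x * φ x|
      ≤ ENNReal.ofReal (b * B) * ∫⁻ x in S, ENNReal.ofReal (|x| ^ (-θ)) := by
  have hb0 : 0 ≤ b := (abs_nonneg _).trans (hb 0)
  have h1 : ∫ x, F x * φ x = ∫ x in S, F x * φ x :=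
    (setIntegral_eq_integral_of_forall_compl_eq_zero fun x hx => by simp [hφ x hx]).symm
  rw [h1, ← lintegral_const_mul _ (by fun_prop)]
  refine (ofReal_abs_integral_le _).trans (lintegral_mono_ae ?_)
  filter_upwards [ae_mono (Measure.restrict_mono hS le_rfl) h.rhs_le] with x hx
  rw [← ENNReal.ofReal_mul (mul_nonneg hb0 h.B_nonneg)]
  apply ENNReal.ofReal_le_ofReal
  rw [abs_mul]
  have : 0 ≤ B * |x| ^ (-θ) := (abs_nonneg _).trans hx
  calc |F x| * |φ x| ≤ B * |x| ^ (-θ) * b := by gcongr; exact hb x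
    _ = _ := by ring

/-- The weak formulation tested with `ψ (u - c)`, `ψ` a Lipschitz cutoff. -/
lemma weak_form_cutoff (h : BoundedSolution θ₀ M A B K γ α θ F u) {ψ : ℝ → ℝ} {k : ℝ}
    (hψm : Measurable ψ) (h0 : ∀ x, 0 ≤ ψ x) (h1 : ∀ x, ψ x ≤ 1)
    (hk : ∀ x y, |ψ x - ψ y| ≤ k * |x - y|) (hz : ∀ x, 7 / 8 * M ≤ |x| → ψ x = 0) (c : ℝ) :
    Integrable (fun p : ℝ × ℝ => (u p.1 - u p.2) *
        (ψ p.1 * (u p.1 - c) - ψ p.2 * (u p.2 - c)) * kernelG γ α p.1 p.2) ∧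
      ∫ p : ℝ × ℝ, (u p.1 - u p.2) * (ψ p.1 * (u p.1 - c) - ψ p.2 * (u p.2 - c)) *
        kernelG γ α p.1 p.2 = 2 * ∫ x, F x * (ψ x * (u x - c)) := by
  have hM := h.one_lt_M
  have hum := h.measurable
  have hA := h.A_nonneg
  have hw : ∀ x ∈ Metric.ball (0 : ℝ) M, |u x - c| ≤ A + |c| := fun x hx =>
    (abs_sub _ _).trans (by linarith [h.abs_le x hx])
  refine weak_form_of_finite_energy (b := A + |c|) (φ := fun x => ψ x * (u x - c))
    (by linarith [h.le_γ]) h.γ_lt h.α_nonneg h.α_lt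
    hM hA hum h.abs_le h.memL1q h.weak (by fun_prop) (fun x => ?_)
    (fun x hx => by simp [hz x hx]) ?_
  · by_cases hx : x ∈ Metric.ball (0 : ℝ) M
    · rw [abs_mul, abs_of_nonneg (h0 x)]
      calc ψ x * |u x - c| ≤ 1 * (A + |c|) := by gcongr; exacts [h1 x, hw x hx]
        _ = _ := one_mul _
    · have : ψ x = 0 := hz x (by
        simp only [Metric.mem_ball, dist_zero_right, Real.norm_eq_abs, not_lt] at hx
        linarith)
      rw [this, zero_mul, abs_zero]; positivity
  · calc _ ≤ ∫⁻ p in Metric.ball (0 : ℝ) M ×ˢ Metric.ball (0 : ℝ) M,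
          (2 * ENNReal.ofReal (kernelG γ α p.1 p.2 * (u p.1 - u p.2) ^ 2) +
            ENNReal.ofReal (2 * (A + |c|) ^ 2 * k ^ 2) *
              ENNReal.ofReal (kernelG γ α p.1 p.2 * (p.1 - p.2) ^ 2)) := by
          refine setLIntegral_mono (by fun_prop) fun p hp => ?_
          have g0 := kernelG_nonneg γ α p.1 p.2
          rw [← ENNReal.ofReal_mul (by positivity), ← ENNReal.ofReal_ofNat 2,
            ← ENNReal.ofReal_mul (by norm_num), ← ENNReal.ofReal_add (by positivity)
            (by positivity)]
          apply ENNReal.ofReal_le_ofReal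
          have e1 : (ψ p.1 * (u p.1 - c) - ψ p.2 * (u p.2 - c)) ^ 2 ≤
              2 * (u p.1 - u p.2) ^ 2 + 2 * (A + |c|) ^ 2 * k ^ 2 * (p.1 - p.2) ^ 2 := by
            have e2 : (ψ p.1 - ψ p.2) ^ 2 ≤ k ^ 2 * (p.1 - p.2) ^ 2 := by
              rw [← sq_abs, ← sq_abs (p.1 - p.2), ← mul_pow]
              gcongr
              exact hk _ _
            have e3 : (u p.2 - c) ^ 2 ≤ (A + |c|) ^ 2 := by
              rw [← sq_abs]; gcongr; exact hw _ hp.2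
            have e4 : ψ p.1 ^ 2 ≤ 1 := pow_le_one₀ (h0 _) (h1 _)
            calc _ = (ψ p.1 * (u p.1 - u p.2) + (u p.2 - c) * (ψ p.1 - ψ p.2)) ^ 2 := by ring
              _ ≤ 2 * (ψ p.1 ^ 2 * (u p.1 - u p.2) ^ 2) +
                  2 * ((u p.2 - c) ^ 2 * (ψ p.1 - ψ p.2) ^ 2) := by
                nlinarith [sq_nonneg (ψ p.1 * (u p.1 - u p.2) - (u p.2 - c) * (ψ p.1 - ψ p.2))]
              _ ≤ 2 * (1 * (u p.1 - u p.2) ^ 2) +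
                  2 * ((A + |c|) ^ 2 * (k ^ 2 * (p.1 - p.2) ^ 2)) := by gcongr
              _ = _ := by ring
          calc _ ≤ kernelG γ α p.1 p.2 * (2 * (u p.1 - u p.2) ^ 2 +
                2 * (A + |c|) ^ 2 * k ^ 2 * (p.1 - p.2) ^ 2) := by gcongr
            _ = _ := by ring
      _ < ⊤ := by
          rw [lintegral_add_left (by fun_prop), lintegral_const_mul _ (by fun_prop),
            lintegral_const_mul _ (by fun_prop)]
          refine ENNReal.add_lt_top.2 ⟨ENNReal.mul_lt_top (by simp)
            (h.weak.energy_lt_top (by linarith)), ENNReal.mul_lt_top ENNReal.ofReal_lt_top ?_⟩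
          exact (lintegral_kernelG_mul_sq h.γ_lt h.α_lt (by linarith)).trans_lt
            ENNReal.ofReal_lt_top

/-- The energy bound on `(-3M/4, 3M/4)` furnished by the Caccioppoli inequality. -/
noncomputable def energyBound (θ₀ M A B K : ℝ) : ℝ :=
  2 * (A * B * (2 * M / (1 - θ₀))) + 2048 * A * (4 * M * (4 * A * profileMass + K)) +
    64 * A ^ 2 * (2 * M * (4 * M) ^ 2)

lemma lintegral_ball_abs_rpow_neg_le {a a₀ M : ℝ} (ha0 : 0 ≤ a) (ha : a ≤ a₀) (ha₀ : a₀ < 1)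
    (hM : 1 ≤ M) :
    ∫⁻ x in Metric.ball (0 : ℝ) M, ENNReal.ofReal (|x| ^ (-a))
      ≤ ENNReal.ofReal (2 * M / (1 - a₀)) := by
  refine (lintegral_ball_abs_rpow_neg (by linarith) (by linarith)).trans
    (ENNReal.ofReal_le_ofReal ?_)
  have h1 : M ^ (1 - a) ≤ M := by
    calc M ^ (1 - a) ≤ M ^ (1 : ℝ) := Real.rpow_le_rpow_of_exponent_le hM (by linarith)
      _ = M := Real.rpow_one M
  have : 0 < 1 - a₀ := by linarith
  gcongr

/-- Caccioppoli's inequality, from testing with `η² u`: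
`(u(x) - u(y)) (η²u(x) - η²u(y)) = (ηu(x) - ηu(y))² - u(x) u(y) (η(x) - η(y))²`. -/
lemma caccioppoli (h : BoundedSolution θ₀ M A B K γ α θ F u) :
    ∫⁻ p in Metric.ball (0 : ℝ) (3 / 4 * M) ×ˢ Metric.ball (0 : ℝ) (3 / 4 * M),
        ENNReal.ofReal (kernelG γ α p.1 p.2 * (u p.1 - u p.2) ^ 2)
      ≤ ENNReal.ofReal (energyBound θ₀ M A B K) := by
  have hM := h.one_lt_M
  have hM0 : 0 < M := by linarith
  have hum := h.measurable
  have hA := h.A_nonneg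
  have hB := h.B_nonneg
  have hK := h.K_nonneg
  have hpm := profileMass_nonneg
  have hθ₀ := h.θ₀_lt
  have hγ := h.le_γ
  have hγ' := h.γ_lt
  have hθ1 : 0 < 1 - θ₀ := by linarith
  set D2 := Metric.ball (0 : ℝ) M ×ˢ Metric.ball (0 : ℝ) M with hD2
  have hD2m : MeasurableSet D2 := measurableSet_ball.prod measurableSet_ball
  set η := cutoff 7 (8 / M) 0 with hη
  have η0 : ∀ x, 0 ≤ η x := cutoff_nonneg _ _ _
  have η1 : ∀ x, η x ≤ 1 := cutoff_le_one _ _ _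
  have ηm : Measurable η := measurable_cutoff _ _ _
  have ηL : ∀ x y, |η x - η y| ≤ 8 * |x - y| := fun x y => by
    refine (abs_cutoff_sub_le (by positivity) x y).trans ?_
    gcongr
    exact div_le_self (by norm_num) hM.le
  have ηz : ∀ x, 7 / 8 * M ≤ |x| → η x = 0 := fun x hx => cutoff_eq_zero (by
    rw [sub_zero, div_mul_eq_mul_div, le_div_iff₀ hM0]; linarith)
  have ηo : ∀ x, |x| < 3 / 4 * M → η x = 1 := fun x hx => cutoff_eq_one (by
    rw [sub_zero, div_mul_eq_mul_div, div_le_iff₀ hM0]; linarith)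
  set φ : ℝ → ℝ := fun x => η x ^ 2 * (u x - 0) with hφ
  obtain ⟨hI, hIeq⟩ := h.weak_form_cutoff (ψ := fun x => η x ^ 2) (k := 16) (by fun_prop)
    (fun x => by positivity) (fun x => pow_le_one₀ (η0 x) (η1 x)) (fun x y => by
      rw [show η x ^ 2 - η y ^ 2 = (η x + η y) * (η x - η y) by ring, abs_mul,
        abs_of_nonneg (add_nonneg (η0 x) (η0 y))]
      calc (η x + η y) * |η x - η y| ≤ 2 * (8 * |x - y|) := by
            gcongr
            · linarith [η1 x, η1 y]
            · exact ηL x y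
        _ = _ := by ring) (fun x hx => by simp [ηz x hx]) 0
  set I : ℝ × ℝ → ℝ := fun p => (u p.1 - u p.2) * (φ p.1 - φ p.2) * kernelG γ α p.1 p.2 with hIdef
  change Integrable I at hI
  change ∫ p, I p = 2 * ∫ x, F x * φ x at hIeq
  set S := Metric.ball (0 : ℝ) (15 / 16 * M) with hS
  have hSM : S ⊆ Metric.ball 0 M := Metric.ball_subset_ball (by linarith)
  have hφS : ∀ x, x ∉ S → φ x = 0 := fun x hx => by
    simp only [hS, Metric.mem_ball, dist_zero_right, Real.norm_eq_abs, not_lt] at hx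
    simp [hφ, ηz x (by linarith)]
  have hφb : ∀ x, |φ x| ≤ A := fun x => by
    by_cases hx : x ∈ S
    · simp only [hφ, sub_zero, abs_mul, abs_pow, abs_of_nonneg (η0 x)]
      calc η x ^ 2 * |u x| ≤ 1 * A := by
            gcongr
            exacts [pow_le_one₀ (η0 x) (η1 x), h.abs_le x (hSM hx)]
        _ = A := one_mul A
    · rw [hφS x hx, abs_zero]; exact hA
  -- the source, the far field, and the commutator `Q` with the cutoff are bounded separately
  have b1 : ENNReal.ofReal |∫ x, F x * φ x| ≤ ENNReal.ofReal (A * B * (2 * M / (1 - θ₀))) := by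
    refine (h.ofReal_abs_rhs_le hSM hφb hφS).trans ?_
    rw [ENNReal.ofReal_mul (p := A * B) (by positivity)]
    gcongr
    exact (lintegral_mono_set hSM).trans
      (lintegral_ball_abs_rpow_neg_le h.θ_nonneg h.θ_le h.θ₀_lt hM.le)
  have b2 : ENNReal.ofReal |∫ p in D2ᶜ, I p|
      ≤ ENNReal.ofReal (2048 * A * (4 * M * (4 * A * profileMass + K))) := by
    refine (ofReal_abs_integral_le _).trans ((lintegral_abs_form_far (by linarith) hγ' h.α_nonneg
      h.α_lt (by linarith) hS.subset measurableSet_ball hA hum h.abs_le hφb hφS).trans ?_)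
    rw [ENNReal.ofReal_mul (p := 2048 * A) (by positivity),
      ENNReal.ofReal_mul (p := 4 * M) (by positivity)]
    gcongr
    · refine (lintegral_mono_set hSM).trans ((lintegral_ball_abs_rpow_neg_le h.α_nonneg h.α_lt.le
        (by norm_num) hM.le).trans_eq ?_)
      congr 1; ring
    · exact h.lintegral_tail
  set Q : ℝ × ℝ → ℝ := fun p => u p.1 * u p.2 * (η p.1 - η p.2) ^ 2 * kernelG γ α p.1 p.2 with hQ
  have b3' : ∫⁻ p in D2, ENNReal.ofReal |Q p|
      ≤ ENNReal.ofReal (64 * A ^ 2 * (2 * M * (4 * M) ^ 2)) := by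
    calc _ ≤ ∫⁻ p in D2, ENNReal.ofReal (64 * A ^ 2) *
          ENNReal.ofReal (kernelG γ α p.1 p.2 * (p.1 - p.2) ^ 2) := by
          refine setLIntegral_mono (by fun_prop) fun p hp => ?_
          rw [← ENNReal.ofReal_mul (by positivity)]
          apply ENNReal.ofReal_le_ofReal
          have g0 := kernelG_nonneg γ α p.1 p.2
          have e2 : (η p.1 - η p.2) ^ 2 ≤ 64 * (p.1 - p.2) ^ 2 := by
            rw [← sq_abs, ← sq_abs (p.1 - p.2)]
            calc |η p.1 - η p.2| ^ 2 ≤ (8 * |p.1 - p.2|) ^ 2 := by gcongr; exact ηL _ _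
              _ = _ := by ring
          simp only [hQ]
          rw [abs_mul, abs_mul, abs_mul, abs_of_nonneg g0,
            abs_of_nonneg (sq_nonneg (η p.1 - η p.2))]
          calc |u p.1| * |u p.2| * (η p.1 - η p.2) ^ 2 * kernelG γ α p.1 p.2
              ≤ A * A * (64 * (p.1 - p.2) ^ 2) * kernelG γ α p.1 p.2 := by
                gcongr
                exacts [h.abs_le _ hp.1, h.abs_le _ hp.2]
            _ = _ := by ring
      _ ≤ _ := by
          rw [lintegral_const_mul _ (by fun_prop),
            ENNReal.ofReal_mul (p := 64 * A ^ 2) (by positivity)]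
          gcongr
          refine (lintegral_kernelG_mul_sq hγ' h.α_lt hM0).trans (ENNReal.ofReal_le_ofReal ?_)
          have h1a : 1 / 2 ≤ 1 - α := by linarith [h.α_lt]
          have h2 : M ^ (1 - α) ≤ M := by
            calc M ^ (1 - α) ≤ M ^ (1 : ℝ) :=
                  Real.rpow_le_rpow_of_exponent_le hM.le (by linarith [h.α_nonneg])
              _ = M := Real.rpow_one M
          have h3 : (2 * M) ^ (1 - 2 * γ) ≤ 2 * M := by
            calc (2 * M) ^ (1 - 2 * γ) ≤ (2 * M) ^ (1 : ℝ) :=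
                  Real.rpow_le_rpow_of_exponent_le (by linarith) (by linarith)
              _ = 2 * M := Real.rpow_one _
          have h4 : 2 * M ^ (1 - α) / (1 - α) ≤ 4 * M := by
            rw [div_le_iff₀ (by linarith)]
            nlinarith
          gcongr
  have hQi : IntegrableOn Q D2 := by
    refine ⟨Measurable.aestronglyMeasurable (by fun_prop), ?_⟩
    rw [hasFiniteIntegral_iff_enorm]
    simp_rw [Real.enorm_eq_ofReal_abs]
    exact b3'.trans_lt ENNReal.ofReal_lt_top
  have b3 := (ofReal_abs_integral_le (μ := volume.restrict D2) Q).trans b3'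
  have hid : ∀ p : ℝ × ℝ, kernelG γ α p.1 p.2 * (η p.1 * u p.1 - η p.2 * u p.2) ^ 2
      = I p + Q p := by
    intro p; simp only [hIdef, hQ, hφ]; ring
  have hsum : ∫ p in D2, kernelG γ α p.1 p.2 * (η p.1 * u p.1 - η p.2 * u p.2) ^ 2
      = 2 * (∫ x, F x * φ x) - (∫ p in D2ᶜ, I p) + ∫ p in D2, Q p := by
    simp_rw [hid]
    rw [integral_add hI.integrableOn hQi, ← hIeq, ← integral_add_compl hD2m hI]
    ring
  calc _ = ∫⁻ p in Metric.ball (0 : ℝ) (3 / 4 * M) ×ˢ Metric.ball (0 : ℝ) (3 / 4 * M),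
        ENNReal.ofReal (kernelG γ α p.1 p.2 * (η p.1 * u p.1 - η p.2 * u p.2) ^ 2) := by
        refine setLIntegral_congr_fun (measurableSet_ball.prod measurableSet_ball) fun p hp => ?_
        have h1 : |p.1| < 3 / 4 * M := by simpa using hp.1
        have h2 : |p.2| < 3 / 4 * M := by simpa using hp.2
        simp only [ηo _ h1, ηo _ h2, one_mul]
    _ ≤ ∫⁻ p in D2, ENNReal.ofReal
          (kernelG γ α p.1 p.2 * (η p.1 * u p.1 - η p.2 * u p.2) ^ 2) :=
        lintegral_mono_set (prod_mono (Metric.ball_subset_ball (by linarith))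
          (Metric.ball_subset_ball (by linarith)))
    _ = ENNReal.ofReal
          (2 * (∫ x, F x * φ x) - (∫ p in D2ᶜ, I p) + ∫ p in D2, Q p) := by
        rw [← hsum, ofReal_integral_eq_lintegral_ofReal]
        · simp_rw [hid]
          exact hI.integrableOn.add hQi
        · exact ae_of_all _ fun p => mul_nonneg (kernelG_nonneg _ _ _ _) (sq_nonneg _)
    _ ≤ ENNReal.ofReal (2 * |∫ x, F x * φ x| + |∫ p in D2ᶜ, I p| + |∫ p in D2, Q p|) := by
        apply ENNReal.ofReal_le_ofReal
        linarith [le_abs_self (∫ x, F x * φ x), neg_abs_le (∫ p in D2ᶜ, I p),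
          le_abs_self (∫ p in D2, Q p)]
    _ = 2 * ENNReal.ofReal |∫ x, F x * φ x| + ENNReal.ofReal |∫ p in D2ᶜ, I p| +
          ENNReal.ofReal |∫ p in D2, Q p| := by
        rw [ENNReal.ofReal_add (by positivity) (by positivity), ENNReal.ofReal_add (by positivity)
          (by positivity), ENNReal.ofReal_mul (by norm_num)]
        simp
    _ ≤ 2 * ENNReal.ofReal (A * B * (2 * M / (1 - θ₀))) +
          ENNReal.ofReal (2048 * A * (4 * M * (4 * A * profileMass + K))) +
          ENNReal.ofReal (64 * A ^ 2 * (2 * M * (4 * M) ^ 2)) := by gcongr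
    _ = _ := by
        rw [energyBound, ENNReal.ofReal_add (by positivity) (by positivity), ENNReal.ofReal_add
          (by positivity) (by positivity), ENNReal.ofReal_mul (p := 2) (by norm_num)]
        simp

end BoundedSolution

/-! ### Weighted energies and the Poincaré inequality -/

/-- The weight `(r / max(r, |x - x₀|, |y - x₀|))^{1/2}` on pairs `p = (x, y)`: it is `1` on the
square over the ball of radius `r` around `x₀` and decays polynomially away from it. -/
noncomputable def scaleWeight (x₀ r : ℝ) (p : ℝ × ℝ) : ℝ :=
  √(r / max r (max |p.1 - x₀| |p.2 - x₀|))

/-- The energy of `u` on `D × D`, weighted by `scaleWeight`. Letting all scales above `r` enter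
with decaying weights is what makes hole filling work for a nonlocal form. -/
noncomputable def weightedEnergy (γ α : ℝ) (u : ℝ → ℝ) (D : Set ℝ) (x₀ r : ℝ) : ℝ≥0∞ :=
  ∫⁻ p in D ×ˢ D, ENNReal.ofReal (kernelG γ α p.1 p.2 * (u p.1 - u p.2) ^ 2) *
    ENNReal.ofReal (scaleWeight x₀ r p)

@[fun_prop]
lemma measurable_scaleWeight (x₀ r : ℝ) : Measurable (scaleWeight x₀ r) := by
  unfold scaleWeight; fun_prop

lemma scaleWeight_pos {x₀ r : ℝ} (hr : 0 < r) (p : ℝ × ℝ) : 0 < scaleWeight x₀ r p := by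
  unfold scaleWeight
  have : 0 < max r (max |p.1 - x₀| |p.2 - x₀|) := lt_max_of_lt_left hr
  positivity

lemma scaleWeight_le_one {x₀ r : ℝ} (hr : 0 < r) (p : ℝ × ℝ) : scaleWeight x₀ r p ≤ 1 := by
  unfold scaleWeight
  rw [Real.sqrt_le_left zero_le_one, one_pow]
  exact div_le_one_of_le₀ (le_max_left _ _) (hr.le.trans (le_max_left _ _))

lemma mem_ball_prod_iff {x₀ r : ℝ} {p : ℝ × ℝ} :
    p ∈ Metric.ball x₀ r ×ˢ Metric.ball x₀ r ↔ max |p.1 - x₀| |p.2 - x₀| < r := by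
  simp [mem_prod, Real.dist_eq]

lemma scaleWeight_eq_one {x₀ r : ℝ} (hr : 0 < r) {p : ℝ × ℝ}
    (hp : p ∈ Metric.ball x₀ r ×ˢ Metric.ball x₀ r) : scaleWeight x₀ r p = 1 := by
  unfold scaleWeight
  rw [max_eq_left (mem_ball_prod_iff.1 hp).le, div_self hr.ne', Real.sqrt_one]

lemma inv_scaleWeight (x₀ r : ℝ) (p : ℝ × ℝ) :
    (scaleWeight x₀ r p)⁻¹ = √(max r (max |p.1 - x₀| |p.2 - x₀|) / r) := by
  unfold scaleWeight
  rw [← Real.sqrt_inv, inv_div]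

lemma inv_scaleWeight_le_two {x₀ r : ℝ} (hr : 0 < r) {p : ℝ × ℝ}
    (hp : p ∈ Metric.ball x₀ (4 * r) ×ˢ Metric.ball x₀ (4 * r)) :
    (scaleWeight x₀ r p)⁻¹ ≤ 2 := by
  rw [inv_scaleWeight, Real.sqrt_le_left (by norm_num), div_le_iff₀ hr]
  exact max_le (by linarith) (by linarith [mem_ball_prod_iff.1 hp])

lemma scaleWeight_half_le {x₀ r : ℝ} (hr : 0 < r) (p : ℝ × ℝ) :
    scaleWeight x₀ (r / 2) p ≤ scaleWeight x₀ r p := by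
  unfold scaleWeight
  set e := max |p.1 - x₀| |p.2 - x₀| with he
  apply Real.sqrt_le_sqrt
  rw [div_le_div_iff₀ (lt_max_of_lt_left (by positivity)) (lt_max_of_lt_left hr)]
  rcases le_total r e with h | h
  · rw [max_eq_right h, max_eq_right (by linarith)]
    nlinarith
  · rw [max_eq_left h]
    nlinarith [le_max_left (r / 2) e]

lemma scaleWeight_half_add_le {x₀ r : ℝ} (hr : 0 < r) {p : ℝ × ℝ}
    (hp : p ∉ Metric.ball x₀ r ×ˢ Metric.ball x₀ r) :
    scaleWeight x₀ (r / 2) p + 1 / 4 * scaleWeight x₀ r p ≤ scaleWeight x₀ r p := by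
  rw [mem_ball_prod_iff, not_lt] at hp
  unfold scaleWeight
  set e := max |p.1 - x₀| |p.2 - x₀| with he
  rw [max_eq_right hp, max_eq_right (by linarith)]
  have h1 : √(r / 2 / e) ≤ 3 / 4 * √(r / e) := by
    rw [show r / 2 / e = (1 / 2) * (r / e) by ring, Real.sqrt_mul (by norm_num)]
    gcongr
    rw [Real.sqrt_le_left (by norm_num)]
    norm_num
  linarith

namespace BoundedSolution

variable {θ₀ M A B K γ α θ : ℝ} {F u : ℝ → ℝ}

/-- Weighted Poincaré inequality. The constant subtracted is a well-chosen value of `u`. -/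
lemma poincare (h : BoundedSolution θ₀ M A B K γ α θ F u) (x₀ : ℝ) {R : ℝ} (hR : 0 < R) :
    ∃ x₁ ∈ Metric.ball x₀ R, ENNReal.ofReal (2 * R * (|x₀| + R) ^ (-α)) *
        ∫⁻ y in Metric.ball x₀ R, ENNReal.ofReal (|y| ^ (-α) * (u y - u x₁) ^ 2)
      ≤ ENNReal.ofReal ((2 * R) ^ (1 + 2 * γ)) *
        ∫⁻ p in Metric.ball x₀ R ×ˢ Metric.ball x₀ R,
          ENNReal.ofReal (kernelG γ α p.1 p.2 * (u p.1 - u p.2) ^ 2) := by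
  have hum := h.measurable
  have hγ := h.le_γ
  set f : ℝ → ℝ≥0∞ := fun x => ∫⁻ y in Metric.ball x₀ R,
    ENNReal.ofReal (|y| ^ (-α) * (u y - u x) ^ 2) with hf
  have hfm : Measurable f := by
    refine Measurable.lintegral_prod_right' (f := fun q : ℝ × ℝ =>
      ENNReal.ofReal (|q.2| ^ (-α) * (u q.2 - u q.1) ^ 2)) ?_
    fun_prop
  have hvol : volume (Metric.ball x₀ R \ {0}) = ENNReal.ofReal (2 * R) := by
    rw [measure_sdiff_null (by simp), Real.volume_ball]
  obtain ⟨x₁, hx₁, hle⟩ := exists_le_setLAverage (μ := volume) (s := Metric.ball x₀ R \ {0})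
    (f := fun x => ENNReal.ofReal (|x| ^ (-α)) * f x)
    (by rw [hvol]; simp [hR]) (by rw [hvol]; exact ENNReal.ofReal_ne_top) (by fun_prop)
  refine ⟨x₁, hx₁.1, ?_⟩
  have hx₁0 : 0 < |x₁| := abs_pos.2 hx₁.2
  have hlow : (|x₀| + R) ^ (-α) ≤ |x₁| ^ (-α) := by
    refine Real.rpow_le_rpow_of_nonpos hx₁0 ?_ (by linarith [h.α_nonneg])
    have h1 := Metric.mem_ball.1 hx₁.1
    rw [Real.dist_eq] at h1
    have := abs_sub_abs_le_abs_sub x₁ x₀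
    linarith
  have h2R : ENNReal.ofReal (2 * R) ≠ 0 := by simp [hR]
  calc ENNReal.ofReal (2 * R * (|x₀| + R) ^ (-α)) * f x₁
      ≤ ENNReal.ofReal (2 * R) * (ENNReal.ofReal (|x₁| ^ (-α)) * f x₁) := by
        rw [ENNReal.ofReal_mul (by positivity), mul_assoc]
        gcongr
    _ ≤ ENNReal.ofReal (2 * R) * ((∫⁻ x in Metric.ball x₀ R, ENNReal.ofReal (|x| ^ (-α)) * f x) /
          ENNReal.ofReal (2 * R)) := by
        rw [setLAverage_eq, hvol] at hle
        refine mul_le_mul_right (hle.trans (ENNReal.div_le_div_right ?_ _)) _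
        exact lintegral_mono_set sdiff_subset
    _ = ∫⁻ x in Metric.ball x₀ R, ENNReal.ofReal (|x| ^ (-α)) * f x :=
        ENNReal.mul_div_cancel h2R ENNReal.ofReal_ne_top
    _ = ∫⁻ x in Metric.ball x₀ R, ∫⁻ y in Metric.ball x₀ R, ENNReal.ofReal (|x| ^ (-α)) *
          ENNReal.ofReal (|y| ^ (-α) * (u y - u x) ^ 2) := by
        congr 1; ext x
        rw [lintegral_const_mul _ (by fun_prop)]
    _ = ∫⁻ p in Metric.ball x₀ R ×ˢ Metric.ball x₀ R, ENNReal.ofReal (|p.1| ^ (-α)) *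
          ENNReal.ofReal (|p.2| ^ (-α) * (u p.2 - u p.1) ^ 2) := by
        rw [Measure.volume_eq_prod, ← Measure.prod_restrict,
          lintegral_prod _ (Measurable.aemeasurable (by fun_prop))]
    _ ≤ ∫⁻ p in Metric.ball x₀ R ×ˢ Metric.ball x₀ R, ENNReal.ofReal ((2 * R) ^ (1 + 2 * γ)) *
          ENNReal.ofReal (kernelG γ α p.1 p.2 * (u p.1 - u p.2) ^ 2) := by
        refine setLIntegral_mono (by fun_prop) fun p hp => ?_
        rw [← ENNReal.ofReal_mul (by positivity), ← ENNReal.ofReal_mul (by positivity)]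
        apply ENNReal.ofReal_le_ofReal
        rcases eq_or_ne p.1 p.2 with he | he
        · simp [he]
        · have hd : 0 < |p.1 - p.2| := abs_pos.2 (sub_ne_zero.2 he)
          have hd2 : |p.1 - p.2| ≤ 2 * R := by
            have h1 := hp.1
            have h2 := hp.2
            rw [Metric.mem_ball, Real.dist_eq] at h1 h2
            have := abs_sub_le p.1 x₀ p.2
            rw [abs_sub_comm x₀] at this
            linarith
          have h1 : 1 ≤ (2 * R) ^ (1 + 2 * γ) * |p.1 - p.2| ^ (-(1 + 2 * γ)) := by
            rw [Real.rpow_neg hd.le, ← div_eq_mul_inv, one_le_div (by positivity)]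
            gcongr
          rw [kernelG_eq]
          calc _ = 1 * (|p.1| ^ (-α) * |p.2| ^ (-α) * (u p.1 - u p.2) ^ 2) := by ring
            _ ≤ (2 * R) ^ (1 + 2 * γ) * |p.1 - p.2| ^ (-(1 + 2 * γ)) *
                (|p.1| ^ (-α) * |p.2| ^ (-α) * (u p.1 - u p.2) ^ 2) := by gcongr
            _ = _ := by ring
    _ = _ := lintegral_const_mul _ (by fun_prop)

end BoundedSolution

/-- The kernel against a far point, with the inverse of `scaleWeight`, still decays integrably. -/
lemma kernel_far_le {γ x₀ r x y : ℝ} (hγ : 3 / 8 ≤ γ) (hγ' : γ < 1 / 2) (hr : 0 < r)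
    (hx : 4 * r ≤ |x - x₀|) (hy : |y - x₀| < 2 * r) :
    |x - y| ^ (-(1 + 2 * γ)) * √(|x - x₀| / r)
      ≤ 8 * r ^ (-(1 + 2 * γ)) * decayProfile x₀ r x := by
  set t := |x - x₀| / r with ht
  have ht4 : 4 ≤ t := by rw [ht, le_div_iff₀ hr]; exact hx
  have hxe : |x - x₀| = r * t := by rw [ht]; field_simp
  have h1 : r * (t / 2) ≤ |x - y| := by
    have := abs_sub_abs_le_abs_sub (x - x₀) (y - x₀)
    rw [sub_sub_sub_cancel_right] at this
    nlinarith
  have h2 : |x - y| ^ (-(1 + 2 * γ)) ≤ r ^ (-(1 + 2 * γ)) * (t / 2) ^ (-(1 + 2 * γ)) := by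
    rw [← Real.mul_rpow hr.le (by linarith)]
    exact Real.rpow_le_rpow_of_nonpos (by positivity) h1 (by linarith)
  have h3 : (t / 2) ^ (-(1 + 2 * γ)) * √t ≤ 8 * (1 + t) ^ (-(5 / 4 : ℝ)) := by
    have ht0 : 0 < t := by linarith
    have e1 : (t / 2) ^ (-(1 + 2 * γ)) ≤ (t / 2) ^ (-(7 / 4 : ℝ)) :=
      Real.rpow_le_rpow_of_exponent_le (by linarith) (by linarith)
    have e2 : (t / 2) ^ (-(7 / 4 : ℝ)) = 2 ^ (7 / 4 : ℝ) * t ^ (-(7 / 4 : ℝ)) := by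
      rw [Real.div_rpow ht0.le (by norm_num), Real.rpow_neg (by norm_num : (0 : ℝ) ≤ 2),
        div_inv_eq_mul, mul_comm]
    have e3 : t ^ (-(7 / 4 : ℝ)) * √t = t ^ (-(5 / 4 : ℝ)) := by
      rw [Real.sqrt_eq_rpow, ← Real.rpow_add ht0]; norm_num
    have e4 : (2 : ℝ) ^ (7 / 4 : ℝ) ≤ 4 := by
      calc (2 : ℝ) ^ (7 / 4 : ℝ) ≤ 2 ^ (2 : ℝ) := by gcongr <;> norm_num
        _ = 4 := by norm_num
    have e5 : t ^ (-(5 / 4 : ℝ)) ≤ ((1 + t) * (4 / 5)) ^ (-(5 / 4 : ℝ)) :=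
      Real.rpow_le_rpow_of_nonpos (by positivity) (by linarith) (by norm_num)
    have e6 : (4 / 5 : ℝ) ^ (-(5 / 4 : ℝ)) ≤ 2 := by
      calc (4 / 5 : ℝ) ^ (-(5 / 4 : ℝ)) ≤ (4 / 5 : ℝ) ^ (-(2 : ℝ)) :=
            Real.rpow_le_rpow_of_exponent_ge (by norm_num) (by norm_num) (by norm_num)
        _ ≤ 2 := by rw [Real.rpow_neg (by norm_num)]; norm_num
    rw [Real.mul_rpow (by positivity) (by norm_num)] at e5
    calc (t / 2) ^ (-(1 + 2 * γ)) * √t ≤ (t / 2) ^ (-(7 / 4 : ℝ)) * √t := by gcongr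
      _ = 2 ^ (7 / 4 : ℝ) * t ^ (-(5 / 4 : ℝ)) := by rw [e2, mul_assoc, e3]
      _ ≤ 4 * ((1 + t) ^ (-(5 / 4 : ℝ)) * 2) := by
          gcongr
          refine e5.trans ?_
          gcongr
      _ = _ := by ring
  calc _ ≤ r ^ (-(1 + 2 * γ)) * (t / 2) ^ (-(1 + 2 * γ)) * √t := by gcongr
    _ = r ^ (-(1 + 2 * γ)) * ((t / 2) ^ (-(1 + 2 * γ)) * √t) := by ring
    _ ≤ r ^ (-(1 + 2 * γ)) * (8 * (1 + t) ^ (-(5 / 4 : ℝ))) := by gcongr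
    _ = _ := by unfold decayProfile; ring

lemma kernel_near_le {γ x₀ r x y : ℝ} (hγ : 3 / 8 ≤ γ) (hγ' : γ < 1 / 2) (hr : 0 < r)
    (hx : |x - x₀| < 4 * r) (hy : |y - x₀| < 4 * r) :
    |x - y| ^ (-(1 + 2 * γ)) * (1 / r * |x - y|) ^ 2
      ≤ 200 * r ^ (-(1 + 2 * γ)) * decayProfile x₀ r x := by
  have h1 := one_le_decayProfile (c := 4) hr (by norm_num) hx.le
  have hd : |x - y| ≤ 8 * r := by
    have := abs_sub_le x x₀ y
    rw [abs_sub_comm x₀] at this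
    linarith
  have h2 : |x - y| ^ (-(1 + 2 * γ)) * (1 / r * |x - y|) ^ 2 ≤ 8 * r ^ (-(1 + 2 * γ)) := by
    rcases (abs_nonneg (x - y)).eq_or_lt' with h0 | h0
    · rw [h0]; simp; positivity
    · have e1 : |x - y| ^ (-(1 + 2 * γ)) * |x - y| ^ 2 ≤ (8 * r) ^ (1 - 2 * γ) := by
        rw [← Real.rpow_two, ← Real.rpow_add h0, show -(1 + 2 * γ) + 2 = 1 - 2 * γ by ring]
        exact Real.rpow_le_rpow (abs_nonneg _) hd (by linarith)
      have e2 : (8 * r) ^ (1 - 2 * γ) ≤ 8 * r ^ (1 - 2 * γ) := by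
        rw [Real.mul_rpow (by norm_num) hr.le]
        gcongr
        calc (8 : ℝ) ^ (1 - 2 * γ) ≤ 8 ^ (1 : ℝ) := by gcongr <;> linarith
          _ = 8 := by norm_num
      have e3 : (1 / r) ^ 2 * r ^ (1 - 2 * γ) = r ^ (-(1 + 2 * γ)) := by
        rw [one_div, inv_pow, ← Real.rpow_two, ← Real.rpow_neg hr.le, ← Real.rpow_add hr]
        congr 1; ring
      calc _ = (1 / r) ^ 2 * (|x - y| ^ (-(1 + 2 * γ)) * |x - y| ^ 2) := by ring
        _ ≤ (1 / r) ^ 2 * (8 * r ^ (1 - 2 * γ)) := by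
          exact mul_le_mul_of_nonneg_left (e1.trans e2) (by positivity)
        _ = 8 * ((1 / r) ^ 2 * r ^ (1 - 2 * γ)) := by ring
        _ = _ := by rw [e3]
  calc _ ≤ 8 * r ^ (-(1 + 2 * γ)) * 1 := by rw [mul_one]; exact h2
    _ ≤ 8 * r ^ (-(1 + 2 * γ)) * ((1 + 4) ^ 2 * decayProfile x₀ r x) := by gcongr
    _ = _ := by ring

/-- The constant of `BoundedSolution.lintegral_test_energy_le`. -/
noncomputable def testConst : ℝ := 4 + 25600 * (4 * profileMass + 64)

lemma testConst_pos : 0 < testConst := by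
  have := profileMass_nonneg
  unfold testConst
  positivity

/-- The majorant of the energy density of a cut-off function in `lintegral_test_energy_le`: the
square of the function near `x₀`, against the profile in the other variable. -/
noncomputable def crossMajorant (α x₀ r : ℝ) (w : ℝ → ℝ) (x y : ℝ) : ℝ≥0∞ :=
  ENNReal.ofReal (decayProfile x₀ r x * |x| ^ (-α)) *
    (Metric.ball x₀ (4 * r)).indicator (fun y => ENNReal.ofReal (|y| ^ (-α) * w y ^ 2)) y

lemma measurable_crossMajorant {Z : Type*} [MeasurableSpace Z] {α x₀ r : ℝ} {w : ℝ → ℝ}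
    (hw : Measurable w) {f g : Z → ℝ} (hf : Measurable f) (hg : Measurable g) :
    Measurable fun z => crossMajorant α x₀ r w (f z) (g z) := by
  unfold crossMajorant
  have : Measurable ((Metric.ball x₀ (4 * r)).indicator
      (fun y => ENNReal.ofReal (|y| ^ (-α) * w y ^ 2))) :=
    Measurable.indicator (by fun_prop) measurableSet_ball
  fun_prop

/-- Pointwise bound for the energy density of the cut-off function `ψ w`, `w = u - c`. -/
lemma test_energy_density_le {γ α x₀ r c : ℝ} {u : ℝ → ℝ} (hγ : 3 / 8 ≤ γ) (hγ' : γ < 1 / 2)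
    (hr : 0 < r) (p : ℝ × ℝ) :
    ENNReal.ofReal (kernelG γ α p.1 p.2 *
        (cutoff 2 (1 / r) x₀ p.1 * (u p.1 - c) - cutoff 2 (1 / r) x₀ p.2 * (u p.2 - c)) ^ 2 *
          (scaleWeight x₀ r p)⁻¹)
      ≤ (Metric.ball x₀ (4 * r) ×ˢ Metric.ball x₀ (4 * r)).indicator (fun p => 4 *
          ENNReal.ofReal (kernelG γ α p.1 p.2 * (u p.1 - u p.2) ^ 2)) p +
        ENNReal.ofReal (800 * r ^ (-(1 + 2 * γ))) *
          (crossMajorant α x₀ r (fun x => u x - c) p.1 p.2 +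
            crossMajorant α x₀ r (fun x => u x - c) p.2 p.1) := by
  obtain ⟨x, y⟩ := p
  dsimp only
  set ψ := cutoff 2 (1 / r) x₀ with hψ
  have ψ0 : ∀ x, 0 ≤ ψ x := cutoff_nonneg _ _ _
  have ψ1 : ∀ x, ψ x ≤ 1 := cutoff_le_one _ _ _
  have ψz : ∀ x, 2 * r ≤ |x - x₀| → ψ x = 0 := fun x hx => cutoff_eq_zero (by
    rw [div_mul_eq_mul_div, le_div_iff₀ hr]; linarith)
  have hm0 : ∀ x, 0 ≤ decayProfile x₀ r x := fun x => decayProfile_nonneg hr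
  -- the far case, with the roles of the two variables fixed
  have far : ∀ x y : ℝ, 4 * r ≤ |x - x₀| → ∀ q : ℝ × ℝ, (q = (x, y) ∨ q = (y, x)) →
      ENNReal.ofReal (kernelG γ α x y * (ψ x * (u x - c) - ψ y * (u y - c)) ^ 2 *
          (scaleWeight x₀ r q)⁻¹)
        ≤ ENNReal.ofReal (800 * r ^ (-(1 + 2 * γ))) * crossMajorant α x₀ r (fun x => u x - c) x y := by
    intro x y hx q hq
    rw [ψz x (by linarith), zero_mul, zero_sub, neg_sq]
    rcases le_or_gt (2 * r) |y - x₀| with hy | hy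
    · rw [ψz y hy]; simp
    · have hsw : (scaleWeight x₀ r q)⁻¹ = √(|x - x₀| / r) := by
        rw [inv_scaleWeight]
        have : max |q.1 - x₀| |q.2 - x₀| = |x - x₀| := by
          rcases hq with rfl | rfl
          · exact max_eq_left (by dsimp only; linarith)
          · exact max_eq_right (by dsimp only; linarith)
        rw [this, max_eq_right (by linarith)]
      have hyb : y ∈ Metric.ball x₀ (4 * r) := by
        rw [Metric.mem_ball, Real.dist_eq]; linarith
      have hk := kernel_far_le hγ hγ' hr hx hy
      have hψ2 : (ψ y * (u y - c)) ^ 2 ≤ (u y - c) ^ 2 := by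
        rw [mul_pow]
        exact mul_le_of_le_one_left (sq_nonneg _) (pow_le_one₀ (ψ0 y) (ψ1 y))
      have := hm0 x
      unfold crossMajorant
      rw [indicator_of_mem hyb, ← ENNReal.ofReal_mul (by positivity),
        ← ENNReal.ofReal_mul (by positivity), hsw, kernelG_eq]
      apply ENNReal.ofReal_le_ofReal
      calc _ = |x - y| ^ (-(1 + 2 * γ)) * √(|x - x₀| / r) * (|x| ^ (-α) * |y| ^ (-α)) *
            (ψ y * (u y - c)) ^ 2 := by ring
        _ ≤ 8 * r ^ (-(1 + 2 * γ)) * decayProfile x₀ r x * (|x| ^ (-α) * |y| ^ (-α)) *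
            (u y - c) ^ 2 := by gcongr
        _ ≤ 800 * r ^ (-(1 + 2 * γ)) * decayProfile x₀ r x * (|x| ^ (-α) * |y| ^ (-α)) *
            (u y - c) ^ 2 := by gcongr; norm_num
        _ = _ := by ring
  rcases le_or_gt (4 * r) |x - x₀| with hx | hx
  · refine (far x y hx _ (Or.inl rfl)).trans (le_add_left ?_)
    gcongr
    exact le_self_add
  rcases le_or_gt (4 * r) |y - x₀| with hy | hy
  · rw [kernelG_comm, ← neg_sub, neg_sq]
    refine (far y x hy _ (Or.inr rfl)).trans (le_add_left ?_)
    gcongr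
    exact le_add_self
  -- both points are close to `x₀`
  have hxb : x ∈ Metric.ball x₀ (4 * r) := by rwa [Metric.mem_ball, Real.dist_eq]
  have hyb : y ∈ Metric.ball x₀ (4 * r) := by rwa [Metric.mem_ball, Real.dist_eq]
  have hp : ((x, y) : ℝ × ℝ) ∈ Metric.ball x₀ (4 * r) ×ˢ Metric.ball x₀ (4 * r) := ⟨hxb, hyb⟩
  have hk := kernel_near_le hγ hγ' hr hx hy
  have hsw := inv_scaleWeight_le_two hr hp
  have hsw0 := scaleWeight_pos (x₀ := x₀) hr (x, y)
  have hg0 := kernelG_nonneg γ α x y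
  have := hm0 x
  have hL : |ψ x - ψ y| ≤ 1 / r * |x - y| := abs_cutoff_sub_le (by positivity) x y
  have e1 : (ψ x * (u x - c) - ψ y * (u y - c)) ^ 2 ≤
      2 * (u x - u y) ^ 2 + 2 * ((u y - c) ^ 2 * (1 / r * |x - y|) ^ 2) := by
    have e4 : ψ x ^ 2 ≤ 1 := pow_le_one₀ (ψ0 _) (ψ1 _)
    have e5 : (ψ x - ψ y) ^ 2 ≤ (1 / r * |x - y|) ^ 2 := by rw [← sq_abs]; gcongr
    calc _ = (ψ x * (u x - u y) + (u y - c) * (ψ x - ψ y)) ^ 2 := by ring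
      _ ≤ 2 * (ψ x ^ 2 * (u x - u y) ^ 2) + 2 * ((u y - c) ^ 2 * (ψ x - ψ y) ^ 2) := by
        nlinarith [sq_nonneg (ψ x * (u x - u y) - (u y - c) * (ψ x - ψ y))]
      _ ≤ 2 * (1 * (u x - u y) ^ 2) + 2 * ((u y - c) ^ 2 * (1 / r * |x - y|) ^ 2) := by gcongr
      _ = _ := by ring
  have e2 : kernelG γ α x y * (ψ x * (u x - c) - ψ y * (u y - c)) ^ 2 * (scaleWeight x₀ r (x, y))⁻¹
      ≤ 4 * (kernelG γ α x y * (u x - u y) ^ 2) + 800 * r ^ (-(1 + 2 * γ)) *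
        (decayProfile x₀ r x * |x| ^ (-α) * (|y| ^ (-α) * (u y - c) ^ 2)) := by
    calc _ ≤ kernelG γ α x y *
          (2 * (u x - u y) ^ 2 + 2 * ((u y - c) ^ 2 * (1 / r * |x - y|) ^ 2)) * 2 := by gcongr
      _ = 4 * (kernelG γ α x y * (u x - u y) ^ 2) +
          4 * (|x - y| ^ (-(1 + 2 * γ)) * (1 / r * |x - y|) ^ 2) *
            (|x| ^ (-α) * |y| ^ (-α) * (u y - c) ^ 2) := by rw [kernelG_eq]; ring
      _ ≤ 4 * (kernelG γ α x y * (u x - u y) ^ 2) +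
          4 * (200 * r ^ (-(1 + 2 * γ)) * decayProfile x₀ r x) *
            (|x| ^ (-α) * |y| ^ (-α) * (u y - c) ^ 2) := by gcongr
      _ = _ := by ring
  rw [indicator_of_mem hp]
  calc _ ≤ _ := ENNReal.ofReal_le_ofReal e2
    _ = 4 * ENNReal.ofReal (kernelG γ α x y * (u x - u y) ^ 2) +
        ENNReal.ofReal (800 * r ^ (-(1 + 2 * γ))) *
          crossMajorant α x₀ r (fun x => u x - c) x y := by
        unfold crossMajorant
        rw [indicator_of_mem hyb, ← ENNReal.ofReal_mul (by positivity),
          ← ENNReal.ofReal_mul (by positivity), ENNReal.ofReal_add (by positivity) (by positivity),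
          ENNReal.ofReal_mul (p := 4) (by norm_num)]
        simp
    _ ≤ _ := by
        gcongr
        exact le_self_add

/-- The weighted mass of the profile is at most a multiple of the length of the ball of radius `4r`
times the value of the weight at the far end of this ball, the factor in the Poincaré
inequality. -/
lemma lintegral_profile_le_ball_mass {α : ℝ} (hα : 0 ≤ α) (hα' : α < 1 / 2) (x₀ : ℝ) {r : ℝ}
    (hr : 0 < r) :
    ∫⁻ x, ENNReal.ofReal (decayProfile x₀ r x * |x| ^ (-α))
      ≤ ENNReal.ofReal ((4 * profileMass + 64) / 4) *
        ENNReal.ofReal (2 * (4 * r) * (|x₀| + 4 * r) ^ (-α)) := by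
  have hpm := profileMass_nonneg
  refine (lintegral_decayProfile_weight x₀ hr hα (by linarith)).trans ?_
  rw [← ENNReal.ofReal_mul (by positivity)]
  apply ENNReal.ofReal_le_ofReal
  have h12 : 0 < 1 - α := by linarith
  have e1 : 32 / (1 - α) ≤ 64 := by rw [div_le_iff₀ h12]; linarith
  have e2 : (|x₀| + r) ^ (-α) ≤ 2 * (|x₀| + 4 * r) ^ (-α) := by
    calc (|x₀| + r) ^ (-α) ≤ (1 / 4 * (|x₀| + 4 * r)) ^ (-α) :=
          Real.rpow_le_rpow_of_nonpos (by positivity)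
            (by linarith [abs_nonneg x₀]) (by linarith)
      _ = (1 / 4) ^ (-α) * (|x₀| + 4 * r) ^ (-α) :=
          Real.mul_rpow (by norm_num) (by positivity)
      _ ≤ _ := by
          gcongr
          rw [one_div, Real.inv_rpow (by norm_num), ← Real.rpow_neg (by norm_num), neg_neg]
          calc (4 : ℝ) ^ α ≤ 4 ^ (1 / 2 : ℝ) := by gcongr; norm_num
            _ = 2 := by
              rw [← Real.sqrt_eq_rpow, show (4 : ℝ) = 2 ^ 2 by norm_num]
              exact Real.sqrt_sq (by norm_num)
  calc (4 * profileMass + 32 / (1 - α)) * (r * (|x₀| + r) ^ (-α))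
      ≤ (4 * profileMass + 64) * (r * (2 * (|x₀| + 4 * r) ^ (-α))) := by gcongr
    _ = _ := by ring

namespace BoundedSolution

variable {θ₀ M A B K γ α θ : ℝ} {F u : ℝ → ℝ}

/-- For a suitable constant `c`, the energy of the cut-off function `ψ (u - c)` at scale `r`, even
with the growing weight `scaleWeight⁻¹`, is controlled by the energy of `u` on the ball of radius
`4r`, by a universal constant. -/
lemma lintegral_test_energy_le (h : BoundedSolution θ₀ M A B K γ α θ F u) (x₀ : ℝ) {r : ℝ}
    (hr : 0 < r) :
    ∃ x₁ ∈ Metric.ball x₀ (4 * r), ∫⁻ p : ℝ × ℝ, ENNReal.ofReal (kernelG γ α p.1 p.2 *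
        (cutoff 2 (1 / r) x₀ p.1 * (u p.1 - u x₁) - cutoff 2 (1 / r) x₀ p.2 * (u p.2 - u x₁)) ^ 2 *
          (scaleWeight x₀ r p)⁻¹)
      ≤ ENNReal.ofReal testConst *
        ∫⁻ p in Metric.ball x₀ (4 * r) ×ˢ Metric.ball x₀ (4 * r),
          ENNReal.ofReal (kernelG γ α p.1 p.2 * (u p.1 - u p.2) ^ 2) := by
  have hum := h.measurable
  have hγ := h.le_γ
  have hγ' := h.γ_lt
  have hα := h.α_nonneg
  have hα' := h.α_lt
  have hpm := profileMass_nonneg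
  obtain ⟨x₁, hx₁, hP⟩ := h.poincare x₀ (R := 4 * r) (by positivity)
  refine ⟨x₁, hx₁, ?_⟩
  set E := ∫⁻ p in Metric.ball x₀ (4 * r) ×ˢ Metric.ball x₀ (4 * r),
          ENNReal.ofReal (kernelG γ α p.1 p.2 * (u p.1 - u p.2) ^ 2) with hE
  set W := ∫⁻ y in Metric.ball x₀ (4 * r), ENNReal.ofReal (|y| ^ (-α) * (u y - u x₁) ^ 2) with hW
  set Z := ∫⁻ x, ENNReal.ofReal (decayProfile x₀ r x * |x| ^ (-α)) with hZ
  have hwm : Measurable fun x => u x - u x₁ := by fun_prop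
  have hcm : Measurable fun p : ℝ × ℝ => crossMajorant α x₀ r (fun x => u x - u x₁) p.1 p.2 :=
    measurable_crossMajorant hwm measurable_fst measurable_snd
  have hcross : ∫⁻ p : ℝ × ℝ, crossMajorant α x₀ r (fun x => u x - u x₁) p.1 p.2 = Z * W := by
    unfold crossMajorant
    rw [hW, ← lintegral_indicator measurableSet_ball, Measure.volume_eq_prod]
    exact lintegral_prod_mul (f := fun x => ENNReal.ofReal (decayProfile x₀ r x * |x| ^ (-α)))
      (g := (Metric.ball x₀ (4 * r)).indicator
        (fun y => ENNReal.ofReal (|y| ^ (-α) * (u y - u x₁) ^ 2)))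
      (by fun_prop) (Measurable.aemeasurable (Measurable.indicator (by fun_prop)
        measurableSet_ball))
  have hcross' : ∫⁻ p : ℝ × ℝ, crossMajorant α x₀ r (fun x => u x - u x₁) p.2 p.1 = Z * W := by
    rw [← hcross, Measure.volume_eq_prod]
    exact lintegral_prod_swap (fun p : ℝ × ℝ => crossMajorant α x₀ r (fun x => u x - u x₁) p.1 p.2)
  have hZle := lintegral_profile_le_ball_mass hα hα' x₀ hr
  rw [← hZ] at hZle
  have hZW : ENNReal.ofReal (800 * r ^ (-(1 + 2 * γ))) * (Z * W)
      ≤ ENNReal.ofReal (12800 * (4 * profileMass + 64)) * E := by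
    calc _ ≤ ENNReal.ofReal (800 * r ^ (-(1 + 2 * γ))) *
          (ENNReal.ofReal ((4 * profileMass + 64) / 4) *
            ENNReal.ofReal (2 * (4 * r) * (|x₀| + 4 * r) ^ (-α)) * W) := by gcongr
      _ = ENNReal.ofReal (800 * r ^ (-(1 + 2 * γ)) * ((4 * profileMass + 64) / 4)) *
          (ENNReal.ofReal (2 * (4 * r) * (|x₀| + 4 * r) ^ (-α)) * W) := by
          rw [ENNReal.ofReal_mul (q := (4 * profileMass + 64) / 4) (by positivity)]
          simp only [mul_assoc]
      _ ≤ ENNReal.ofReal (800 * r ^ (-(1 + 2 * γ)) * ((4 * profileMass + 64) / 4)) *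
          (ENNReal.ofReal ((2 * (4 * r)) ^ (1 + 2 * γ)) * E) := by gcongr
      _ ≤ _ := by
          rw [← mul_assoc, ← ENNReal.ofReal_mul (by positivity)]
          gcongr ENNReal.ofReal ?_ * E
          have e1 : (2 * (4 * r)) ^ (1 + 2 * γ) ≤ 64 * r ^ (1 + 2 * γ) := by
            rw [show 2 * (4 * r) = 8 * r by ring, Real.mul_rpow (by norm_num) hr.le]
            gcongr
            calc (8 : ℝ) ^ (1 + 2 * γ) ≤ 8 ^ (2 : ℝ) := by gcongr <;> linarith
              _ = 64 := by norm_num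
          have e2 : r ^ (-(1 + 2 * γ)) * r ^ (1 + 2 * γ) = 1 := by
            rw [← Real.rpow_add hr]; simp
          calc _ ≤ 800 * r ^ (-(1 + 2 * γ)) * ((4 * profileMass + 64) / 4) *
                (64 * r ^ (1 + 2 * γ)) := mul_le_mul_of_nonneg_left e1 (by positivity)
            _ = 12800 * (4 * profileMass + 64) * (r ^ (-(1 + 2 * γ)) * r ^ (1 + 2 * γ)) := by ring
            _ = _ := by rw [e2, mul_one]
  calc _ ≤ ∫⁻ p : ℝ × ℝ, ((Metric.ball x₀ (4 * r) ×ˢ Metric.ball x₀ (4 * r)).indicator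
          (fun p => 4 * ENNReal.ofReal (kernelG γ α p.1 p.2 * (u p.1 - u p.2) ^ 2)) p +
        ENNReal.ofReal (800 * r ^ (-(1 + 2 * γ))) *
          (crossMajorant α x₀ r (fun x => u x - u x₁) p.1 p.2 +
            crossMajorant α x₀ r (fun x => u x - u x₁) p.2 p.1)) :=
        lintegral_mono fun p => test_energy_density_le hγ hγ' hr p
    _ = 4 * E + ENNReal.ofReal (800 * r ^ (-(1 + 2 * γ))) * (Z * W + Z * W) := by
        have hs : MeasurableSet (Metric.ball x₀ (4 * r) ×ˢ Metric.ball x₀ (4 * r)) :=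
          measurableSet_ball.prod measurableSet_ball
        rw [lintegral_add_left (Measurable.indicator (by fun_prop) hs), lintegral_indicator hs,
          lintegral_const_mul _ (by fun_prop),
          lintegral_const_mul' _ _ ENNReal.ofReal_ne_top, lintegral_add_left hcm,
          hcross, hcross']
    _ ≤ 4 * E + 2 * (ENNReal.ofReal (12800 * (4 * profileMass + 64)) * E) := by
        rw [← two_mul, mul_left_comm]
        gcongr
    _ = _ := by
        rw [testConst, ENNReal.ofReal_add (by norm_num) (by positivity), add_mul,
          show 25600 * (4 * profileMass + 64) = 2 * (12800 * (4 * profileMass + 64)) by ring,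
          ENNReal.ofReal_mul (p := 2) (by norm_num), mul_assoc]
        simp

end BoundedSolution

/-! ### Hole filling -/

/-- Small balls have weighted mass at most a multiple of `r^s`, uniformly in their centre: this makes
the source and the far field lower order terms. -/
lemma lintegral_small_ball_le {a a₀ s M r : ℝ} (ha : 0 ≤ a) (ha' : a ≤ a₀) (ha₀ : a₀ < 1)
    (hs' : s ≤ 1 - a₀) (hM : 1 ≤ M) (hr : 0 < r) (hrM : r ≤ M) (hs : 0 ≤ s) (x₀ : ℝ) :
    ∫⁻ x in Metric.ball x₀ (2 * r), ENNReal.ofReal (|x| ^ (-a))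
      ≤ ENNReal.ofReal (8 * (4 * profileMass + 32 / (1 - a₀)) * (M * r ^ s)) := by
  have hpm := profileMass_nonneg
  refine (lintegral_ball_weight_le x₀ (by positivity) ha (by linarith)).trans
    (ENNReal.ofReal_le_ofReal ?_)
  have h1 : 0 < 1 - a₀ := by linarith
  have h2 : 32 / (1 - a) ≤ 32 / (1 - a₀) := by gcongr
  have h1a : 0 < 1 - a := by linarith
  have h3 : r * (|x₀| + 2 * r) ^ (-a) ≤ M * r ^ s := by
    calc r * (|x₀| + 2 * r) ^ (-a) ≤ r * r ^ (-a) := by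
          refine mul_le_mul_of_nonneg_left ?_ hr.le
          exact Real.rpow_le_rpow_of_nonpos hr (by linarith [abs_nonneg x₀]) (by linarith)
      _ = r ^ (1 - a - s) * r ^ s := by
          rw [← Real.rpow_add hr, ← Real.rpow_one_add' hr.le (by linarith)]
          congr 1; ring
      _ ≤ M ^ (1 - a - s) * r ^ s := by
          gcongr
          linarith
      _ ≤ M ^ (1 : ℝ) * r ^ s := by
          gcongr ?_ * _
          exact Real.rpow_le_rpow_of_exponent_le hM (by linarith)
      _ = _ := by rw [Real.rpow_one]
  calc 4 * (4 * profileMass + 32 / (1 - a)) * (2 * r * (|x₀| + 2 * r) ^ (-a))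
      = 8 * (4 * profileMass + 32 / (1 - a)) * (r * (|x₀| + 2 * r) ^ (-a)) := by ring
    _ ≤ _ := by gcongr

/-- The factor by which hole filling reduces the weighted energy is `1 - 1 / holeConst`. -/
noncomputable def holeConst : ℝ := 32 * testConst + 8

/-- The constant in front of the lower order term `r^s` in `BoundedSolution.hole_filling`. -/
noncomputable def sourceConst (θ₀ M A B K : ℝ) : ℝ :=
  2 * (2 * A * B * (8 * (4 * profileMass + 32 / (1 - θ₀)) * M)) +
    2048 * (2 * A) * (8 * (4 * profileMass + 64) * M * (4 * A * profileMass + K))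

/-- Young's inequality, with the weight `k` and its inverse distributed on the two factors. -/
lemma scaleWeight_young {k N a b G : ℝ} (hk : 0 < k) (hN : 0 < N) (hG : 0 ≤ G) :
    |a * b * G| ≤ N * (G * a ^ 2 * k) + N⁻¹ * (G * b ^ 2 * k⁻¹) := by
  rw [abs_mul, abs_of_nonneg hG]
  have h1 : N * k * a ^ 2 + (N * k)⁻¹ * b ^ 2 - |a * b| ≥ 0 := by
    have h0 : 0 < N * k := by positivity
    have : N * k * a ^ 2 + (N * k)⁻¹ * b ^ 2 - |a * b|
        = ((N * k * |a| - |b|) ^ 2 + N * k * |a| * |b|) / (N * k) := by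
      rw [abs_mul, ← sq_abs a, ← sq_abs b]
      field_simp; ring
    rw [this]
    positivity
  calc |a * b| * G ≤ (N * k * a ^ 2 + (N * k)⁻¹ * b ^ 2) * G := by gcongr; linarith
    _ = _ := by rw [mul_inv]; ring

namespace BoundedSolution

variable {θ₀ M A B K γ α θ : ℝ} {F u : ℝ → ℝ}

/-- The weak formulation tested with a cut-off of `u`: the energy on the ball of radius `r` is
controlled by the weighted energy outside, a small multiple of the energy on the ball of radius
`4r`, and lower order terms. -/
lemma energy_ball_le (h : BoundedSolution θ₀ M A B K γ α θ F u) {s : ℝ} (hs : 0 ≤ s)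
    (hs1 : s ≤ 1 / 2) (hs2 : s ≤ 1 - θ₀) {x₀ : ℝ} (hx₀ : |x₀| < M / 2) {r N : ℝ} (hr : 0 < r)
    (hrM : r ≤ M / 32) (hN : 0 < N) {D : Set ℝ} (hD : D = Metric.ball (0 : ℝ) (3 / 4 * M)) :
    ∫⁻ p in Metric.ball x₀ r ×ˢ Metric.ball x₀ r,
        ENNReal.ofReal (kernelG γ α p.1 p.2 * (u p.1 - u p.2) ^ 2)
      ≤ ENNReal.ofReal N * (∫⁻ p in (D ×ˢ D) \ (Metric.ball x₀ r ×ˢ Metric.ball x₀ r),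
          ENNReal.ofReal (kernelG γ α p.1 p.2 * (u p.1 - u p.2) ^ 2) *
            ENNReal.ofReal (scaleWeight x₀ r p)) +
        ENNReal.ofReal N⁻¹ * (ENNReal.ofReal testConst *
          ∫⁻ p in Metric.ball x₀ (4 * r) ×ˢ Metric.ball x₀ (4 * r),
            ENNReal.ofReal (kernelG γ α p.1 p.2 * (u p.1 - u p.2) ^ 2)) +
        ENNReal.ofReal (sourceConst θ₀ M A B K * r ^ s) := by
  have hM := h.one_lt_M
  have hM0 : 0 < M := by linarith
  have hum := h.measurable
  have hA := h.A_nonneg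
  have hB := h.B_nonneg
  have hK := h.K_nonneg
  have hpm := profileMass_nonneg
  have hθ₀ := h.θ₀_lt
  have hγ := h.le_γ
  have hγ' := h.γ_lt
  have hθ1 : 0 < 1 - θ₀ := by linarith
  obtain ⟨x₁, hx₁, hT⟩ := h.lintegral_test_energy_le x₀ hr
  have hball : ∀ x t, |x - x₀| < t → |x| < M / 2 + t := fun x t hx => by
    have := abs_sub_abs_le_abs_sub x x₀
    linarith
  set ψ := cutoff 2 (1 / r) x₀ with hψ
  have ψ0 : ∀ x, 0 ≤ ψ x := cutoff_nonneg _ _ _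
  have ψ1 : ∀ x, ψ x ≤ 1 := cutoff_le_one _ _ _
  have ψm : Measurable ψ := measurable_cutoff _ _ _
  have ψz : ∀ x, 2 * r ≤ |x - x₀| → ψ x = 0 := fun x hx => cutoff_eq_zero (by
    rw [div_mul_eq_mul_div, le_div_iff₀ hr]; linarith)
  have ψo : ∀ x, |x - x₀| < r → ψ x = 1 := fun x hx => cutoff_eq_one (by
    rw [div_mul_eq_mul_div, div_le_iff₀ hr]; linarith)
  set φ : ℝ → ℝ := fun x => ψ x * (u x - u x₁) with hφ
  obtain ⟨hI, hIeq⟩ := h.weak_form_cutoff ψm ψ0 ψ1 (abs_cutoff_sub_le (by positivity))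
    (fun x hx => ψz x (by
      by_contra hlt
      have := hball x (2 * r) (not_le.1 hlt)
      linarith)) (u x₁)
  set I : ℝ × ℝ → ℝ := fun p => (u p.1 - u p.2) * (φ p.1 - φ p.2) * kernelG γ α p.1 p.2 with hIdef
  change Integrable I at hI
  change ∫ p, I p = 2 * ∫ x, F x * φ x at hIeq
  set S := Metric.ball x₀ (2 * r) with hS
  have hSD : S ⊆ Metric.ball 0 (15 / 16 * (3 / 4 * M)) := fun x hx => by
    rw [hS, Metric.mem_ball, Real.dist_eq] at hx
    have := hball x _ hx
    simp only [Metric.mem_ball, dist_zero_right, Real.norm_eq_abs]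
    linarith
  have hSM : S ⊆ Metric.ball 0 M := hSD.trans (Metric.ball_subset_ball (by linarith))
  have hφS : ∀ x, x ∉ S → φ x = 0 := fun x hx => by
    rw [hS, Metric.mem_ball, Real.dist_eq, not_lt] at hx
    simp [hφ, ψz x hx]
  have hux₁ : |u x₁| ≤ A := h.abs_le x₁ (by
    rw [Metric.mem_ball, Real.dist_eq] at hx₁
    have := hball x₁ _ hx₁
    simp only [Metric.mem_ball, dist_zero_right, Real.norm_eq_abs]
    linarith)
  have hφb : ∀ x, |φ x| ≤ 2 * A := fun x => by
    by_cases hx : x ∈ S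
    · simp only [hφ, abs_mul, abs_of_nonneg (ψ0 x)]
      calc ψ x * |u x - u x₁| ≤ 1 * (2 * A) := by
            gcongr
            exacts [ψ1 x, (abs_sub _ _).trans (by linarith [h.abs_le x (hSM hx)])]
        _ = 2 * A := one_mul _
    · rw [hφS x hx, abs_zero]; positivity
  have b1 : ENNReal.ofReal |∫ x, F x * φ x|
      ≤ ENNReal.ofReal (2 * A * B * (8 * (4 * profileMass + 32 / (1 - θ₀)) * (M * r ^ s))) := by
    refine (h.ofReal_abs_rhs_le hSM hφb hφS).trans ?_
    rw [ENNReal.ofReal_mul (p := 2 * A * B) (by positivity)]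
    gcongr
    exact lintegral_small_ball_le h.θ_nonneg h.θ_le h.θ₀_lt hs2 hM.le hr (by linarith) hs x₀
  set D2 := D ×ˢ D with hD2
  set B2 := Metric.ball x₀ r ×ˢ Metric.ball x₀ r with hB2
  have hDm : MeasurableSet D := hD ▸ measurableSet_ball
  have hD2m : MeasurableSet D2 := hDm.prod hDm
  have hB2m : MeasurableSet B2 := measurableSet_ball.prod measurableSet_ball
  have hBD : B2 ⊆ D2 := by
    have : Metric.ball x₀ r ⊆ D := fun x hx => by
      rw [Metric.mem_ball, Real.dist_eq] at hx
      have := hball x _ hx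
      simp only [hD, Metric.mem_ball, dist_zero_right, Real.norm_eq_abs]
      linarith
    exact prod_mono this this
  have b2 : ∫⁻ p in D2ᶜ, ENNReal.ofReal |I p| ≤ ENNReal.ofReal (2048 * (2 * A) *
      (8 * (4 * profileMass + 64) * (M * r ^ s) * (4 * A * profileMass + K))) := by
    subst hD
    refine (lintegral_abs_form_far (by linarith) hγ' h.α_nonneg
      h.α_lt (by linarith) hSD measurableSet_ball hA hum (fun x hx => h.abs_le x
        (Metric.ball_subset_ball (by linarith) hx)) hφb hφS).trans ?_
    rw [ENNReal.ofReal_mul (p := 2048 * (2 * A)) (by positivity),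
      ENNReal.ofReal_mul (p := 8 * (4 * profileMass + 64) * (M * r ^ s)) (by positivity)]
    gcongr
    · refine (lintegral_small_ball_le h.α_nonneg h.α_lt.le (by norm_num) (by linarith) hM.le hr
        (by linarith) hs x₀).trans_eq ?_
      norm_num
    · exact h.lintegral_tail
  have b3 : ∫⁻ p in D2 \ B2, ENNReal.ofReal |I p| ≤
      ENNReal.ofReal N * (∫⁻ p in D2 \ B2,
          ENNReal.ofReal (kernelG γ α p.1 p.2 * (u p.1 - u p.2) ^ 2) *
            ENNReal.ofReal (scaleWeight x₀ r p)) +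
        ENNReal.ofReal N⁻¹ * (ENNReal.ofReal testConst *
          ∫⁻ p in Metric.ball x₀ (4 * r) ×ˢ Metric.ball x₀ (4 * r),
            ENNReal.ofReal (kernelG γ α p.1 p.2 * (u p.1 - u p.2) ^ 2)) := by
    calc _ ≤ ∫⁻ p in D2 \ B2, (ENNReal.ofReal N *
          (ENNReal.ofReal (kernelG γ α p.1 p.2 * (u p.1 - u p.2) ^ 2) *
            ENNReal.ofReal (scaleWeight x₀ r p)) + ENNReal.ofReal N⁻¹ *
          ENNReal.ofReal (kernelG γ α p.1 p.2 * (φ p.1 - φ p.2) ^ 2 *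
            (scaleWeight x₀ r p)⁻¹)) := by
          refine lintegral_mono fun p => ?_
          have g0 := kernelG_nonneg γ α p.1 p.2
          have k0 := scaleWeight_pos (x₀ := x₀) hr p
          rw [← ENNReal.ofReal_mul (by positivity), ← ENNReal.ofReal_mul (by positivity),
            ← ENNReal.ofReal_mul (by positivity), ← ENNReal.ofReal_add (by positivity)
            (by positivity)]
          exact ENNReal.ofReal_le_ofReal (scaleWeight_young k0 hN g0)
      _ ≤ _ := by
          rw [lintegral_add_left (by fun_prop), lintegral_const_mul _ (by fun_prop),
            lintegral_const_mul' _ _ ENNReal.ofReal_ne_top]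
          gcongr
          exact (setLIntegral_le_lintegral _ _).trans hT
  -- on `B2` the form density is the energy density
  have hIB : ∀ p ∈ B2, I p = kernelG γ α p.1 p.2 * (u p.1 - u p.2) ^ 2 := fun p hp => by
    have h1 : |p.1 - x₀| < r := by simpa [Real.dist_eq] using hp.1
    have h2 : |p.2 - x₀| < r := by simpa [Real.dist_eq] using hp.2
    simp only [hIdef, hφ, ψo _ h1, ψo _ h2]; ring
  have hsplit : ∫ p in B2, I p
      = 2 * (∫ x, F x * φ x) - (∫ p in D2 \ B2, I p) - ∫ p in D2ᶜ, I p := by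
    rw [← hIeq, ← integral_add_compl hD2m hI, setIntegral_sdiff hB2m hI.integrableOn hBD]
    ring
  calc _ = ∫⁻ p in B2, ENNReal.ofReal (I p) :=
        setLIntegral_congr_fun hB2m fun p hp => by rw [hIB p hp]
    _ = ENNReal.ofReal (∫ p in B2, I p) := by
        rw [ofReal_integral_eq_lintegral_ofReal hI.integrableOn]
        refine (ae_restrict_iff' hB2m).2 (ae_of_all _ fun p hp => ?_)
        rw [hIB p hp]
        exact mul_nonneg (kernelG_nonneg _ _ _ _) (sq_nonneg _)
    _ ≤ ENNReal.ofReal (2 * |∫ x, F x * φ x| + |∫ p in D2 \ B2, I p| + |∫ p in D2ᶜ, I p|) := by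
        apply ENNReal.ofReal_le_ofReal
        rw [hsplit]
        linarith [le_abs_self (∫ x, F x * φ x), neg_abs_le (∫ p in D2ᶜ, I p),
          neg_abs_le (∫ p in D2 \ B2, I p)]
    _ = 2 * ENNReal.ofReal |∫ x, F x * φ x| + ENNReal.ofReal |∫ p in D2 \ B2, I p| +
          ENNReal.ofReal |∫ p in D2ᶜ, I p| := by
        rw [ENNReal.ofReal_add (by positivity) (by positivity), ENNReal.ofReal_add (by positivity)
          (by positivity), ENNReal.ofReal_mul (by norm_num)]
        simp
    _ ≤ _ := add_le_add (add_le_add (mul_le_mul_right b1 2)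
          ((ofReal_abs_integral_le _).trans b3)) ((ofReal_abs_integral_le _).trans b2)
    _ = _ := by
        have e : ENNReal.ofReal (sourceConst θ₀ M A B K * r ^ s) =
            2 * ENNReal.ofReal
              (2 * A * B * (8 * (4 * profileMass + 32 / (1 - θ₀)) * (M * r ^ s))) +
            ENNReal.ofReal (2048 * (2 * A) *
              (8 * (4 * profileMass + 64) * (M * r ^ s) * (4 * A * profileMass + K))) := by
          rw [← ENNReal.ofReal_ofNat 2, ← ENNReal.ofReal_mul (by norm_num),
            ← ENNReal.ofReal_add (by positivity) (by positivity), sourceConst]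
          congr 1; ring
        rw [e]
        ring

end BoundedSolution

lemma sourceConst_nonneg {θ₀ M A B K : ℝ} (hθ₀ : θ₀ < 1) (hM : 0 ≤ M) (hA : 0 ≤ A) (hB : 0 ≤ B)
    (hK : 0 ≤ K) : 0 ≤ sourceConst θ₀ M A B K := by
  have := profileMass_nonneg
  have : 0 < 1 - θ₀ := by linarith
  unfold sourceConst
  positivity

/-- The energy on the ball of radius `4r` is at most twice the weighted energy at scale `r`. -/
lemma lintegral_ball_four_le {γ α x₀ r : ℝ} {u : ℝ → ℝ} {D : Set ℝ} (hr : 0 < r)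
    (hD : Metric.ball x₀ (4 * r) ⊆ D) :
    ∫⁻ p in Metric.ball x₀ (4 * r) ×ˢ Metric.ball x₀ (4 * r),
        ENNReal.ofReal (kernelG γ α p.1 p.2 * (u p.1 - u p.2) ^ 2)
      ≤ 2 * weightedEnergy γ α u D x₀ r := by
  unfold weightedEnergy
  rw [← lintegral_const_mul' _ _ (by simp)]
  refine le_trans ?_ (lintegral_mono_set (prod_mono hD hD))
  refine setLIntegral_mono' (measurableSet_ball.prod measurableSet_ball) fun p hp => ?_
  have h1 := inv_scaleWeight_le_two hr hp
  have h0 := scaleWeight_pos (x₀ := x₀) hr p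
  rw [inv_le_comm₀ h0 (by norm_num)] at h1
  have hn : 0 ≤ kernelG γ α p.1 p.2 * (u p.1 - u p.2) ^ 2 :=
    mul_nonneg (kernelG_nonneg _ _ _ _) (sq_nonneg _)
  rw [← ENNReal.ofReal_mul hn, ← ENNReal.ofReal_ofNat 2, ← ENNReal.ofReal_mul (by norm_num)]
  apply ENNReal.ofReal_le_ofReal
  nlinarith

/-- Halving the scale gains a fixed fraction of the weighted energy outside the ball of radius
`r`. -/
lemma weightedEnergy_half_add_le {γ α x₀ r : ℝ} {u : ℝ → ℝ} {D : Set ℝ} (hu : Measurable u)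
    (hr : 0 < r) (hDm : MeasurableSet D) (hBD : Metric.ball x₀ r ⊆ D) :
    weightedEnergy γ α u D x₀ (r / 2) +
        ENNReal.ofReal (1 / 4) * (∫⁻ p in (D ×ˢ D) \ (Metric.ball x₀ r ×ˢ Metric.ball x₀ r),
          ENNReal.ofReal (kernelG γ α p.1 p.2 * (u p.1 - u p.2) ^ 2) *
            ENNReal.ofReal (scaleWeight x₀ r p))
      ≤ weightedEnergy γ α u D x₀ r := by
  have hB2m : MeasurableSet (Metric.ball x₀ r ×ˢ Metric.ball x₀ r) :=
    measurableSet_ball.prod measurableSet_ball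
  have hD2m : MeasurableSet (D ×ˢ D) := hDm.prod hDm
  have hsub := inter_eq_self_of_subset_right (prod_mono hBD hBD)
  unfold weightedEnergy
  rw [← lintegral_inter_add_sdiff (A := D ×ˢ D) _ hB2m,
    ← lintegral_inter_add_sdiff (A := D ×ˢ D) (B := Metric.ball x₀ r ×ˢ Metric.ball x₀ r) (fun p =>
      ENNReal.ofReal (kernelG γ α p.1 p.2 * (u p.1 - u p.2) ^ 2) *
        ENNReal.ofReal (scaleWeight x₀ r p)) hB2m, hsub, add_assoc,
    ← lintegral_const_mul' _ _ ENNReal.ofReal_ne_top, ← lintegral_add_left (by fun_prop)]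
  refine add_le_add (lintegral_mono fun p => ?_)
    (setLIntegral_mono' (hD2m.diff hB2m) fun p hp => ?_)
  · gcongr
    exact scaleWeight_half_le hr p
  · rw [mul_left_comm, ← mul_add]
    have h1 := scaleWeight_pos (x₀ := x₀) hr p
    have h2 := scaleWeight_pos (x₀ := x₀) (half_pos hr) p
    gcongr
    rw [← ENNReal.ofReal_mul (by norm_num), ← ENNReal.ofReal_add h2.le (by positivity)]
    exact ENNReal.ofReal_le_ofReal (scaleWeight_half_add_le hr hp.2)

lemma weightedEnergy_eq_add {γ α x₀ r : ℝ} {u : ℝ → ℝ} {D : Set ℝ}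
    (hr : 0 < r) (hBD : Metric.ball x₀ r ⊆ D) :
    weightedEnergy γ α u D x₀ r = (∫⁻ p in Metric.ball x₀ r ×ˢ Metric.ball x₀ r,
        ENNReal.ofReal (kernelG γ α p.1 p.2 * (u p.1 - u p.2) ^ 2)) +
      ∫⁻ p in (D ×ˢ D) \ (Metric.ball x₀ r ×ˢ Metric.ball x₀ r),
          ENNReal.ofReal (kernelG γ α p.1 p.2 * (u p.1 - u p.2) ^ 2) *
            ENNReal.ofReal (scaleWeight x₀ r p) := by
  have hB2m : MeasurableSet (Metric.ball x₀ r ×ˢ Metric.ball x₀ r) :=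
    measurableSet_ball.prod measurableSet_ball
  unfold weightedEnergy
  rw [← lintegral_inter_add_sdiff (A := D ×ˢ D) _ hB2m,
    inter_eq_self_of_subset_right (prod_mono hBD hBD)]
  congr 1
  refine setLIntegral_congr_fun hB2m fun p hp => ?_
  rw [scaleWeight_eq_one hr hp, ENNReal.ofReal_one, mul_one]

namespace BoundedSolution

variable {θ₀ M A B K γ α θ : ℝ} {F u : ℝ → ℝ}

lemma weightedEnergy_le (h : BoundedSolution θ₀ M A B K γ α θ F u) (x₀ : ℝ) {r : ℝ}
    (hr : 0 < r) :
    weightedEnergy γ α u (Metric.ball (0 : ℝ) (3 / 4 * M)) x₀ r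
      ≤ ENNReal.ofReal (energyBound θ₀ M A B K) := by
  refine le_trans (lintegral_mono fun p => ?_) h.caccioppoli
  refine mul_le_of_le_one_right zero_le ?_
  exact ENNReal.ofReal_le_one.2 (scaleWeight_le_one hr p)

/-- Hole filling: passing from scale `r` to scale `r / 2` reduces the weighted energy by a fixed
universal factor, up to a lower order term. -/
lemma hole_filling (h : BoundedSolution θ₀ M A B K γ α θ F u) {s : ℝ} (hs : 0 ≤ s)
    (hs1 : s ≤ 1 / 2) (hs2 : s ≤ 1 - θ₀) {x₀ : ℝ} (hx₀ : |x₀| < M / 2) {r : ℝ} (hr : 0 < r)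
    (hrM : r ≤ M / 32) :
    (weightedEnergy γ α u (Metric.ball (0 : ℝ) (3 / 4 * M)) x₀ (r / 2)).toReal
      ≤ (1 - 1 / holeConst) *
          (weightedEnergy γ α u (Metric.ball (0 : ℝ) (3 / 4 * M)) x₀ r).toReal +
        sourceConst θ₀ M A B K * r ^ s := by
  have hM := h.one_lt_M
  set D := Metric.ball (0 : ℝ) (3 / 4 * M) with hD
  have hc := testConst_pos
  have hN : 0 < 4 * testConst := by positivity
  have hBD : ∀ t, t ≤ 4 * r → Metric.ball x₀ t ⊆ D := fun t ht x hx => by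
    rw [Metric.mem_ball, Real.dist_eq] at hx
    have := abs_sub_abs_le_abs_sub x x₀
    simp only [hD, Metric.mem_ball, dist_zero_right, Real.norm_eq_abs]
    linarith
  have i1 := h.energy_ball_le hs hs1 hs2 hx₀ hr hrM hN hD
  have i2 := lintegral_ball_four_le (γ := γ) (α := α) (u := u) hr (hBD _ le_rfl)
  have i3 := weightedEnergy_half_add_le (γ := γ) (α := α) h.measurable hr measurableSet_ball
    (hBD r (by linarith))
  have i4 := weightedEnergy_eq_add (γ := γ) (α := α) (u := u) hr (hBD r (by linarith))
  have hfin := (h.weightedEnergy_le x₀ hr).trans_lt ENNReal.ofReal_lt_top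
  have hS := sourceConst_nonneg h.θ₀_lt (by linarith : 0 ≤ M) h.A_nonneg h.B_nonneg h.K_nonneg
  have hSr : 0 ≤ sourceConst θ₀ M A B K * r ^ s := by positivity
  generalize sourceConst θ₀ M A B K * r ^ s = Q at i1 hSr ⊢
  generalize weightedEnergy γ α u D x₀ (r / 2) = Φ' at i3 ⊢
  generalize weightedEnergy γ α u D x₀ r = Φ at i2 i3 i4 hfin ⊢
  generalize (∫⁻ p in (D ×ˢ D) \ (Metric.ball x₀ r ×ˢ Metric.ball x₀ r),
          ENNReal.ofReal (kernelG γ α p.1 p.2 * (u p.1 - u p.2) ^ 2) *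
            ENNReal.ofReal (scaleWeight x₀ r p)) = T at i1 i3 i4
  generalize (∫⁻ p in Metric.ball x₀ (4 * r) ×ˢ Metric.ball x₀ (4 * r),
        ENNReal.ofReal (kernelG γ α p.1 p.2 * (u p.1 - u p.2) ^ 2)) = E4 at i1 i2
  generalize (∫⁻ p in Metric.ball x₀ r ×ˢ Metric.ball x₀ r,
        ENNReal.ofReal (kernelG γ α p.1 p.2 * (u p.1 - u p.2) ^ 2)) = E at i1 i4
  -- all quantities are finite, so that the inequalities can be combined in `ℝ`
  have fT : T < ⊤ := lt_of_le_of_lt (i4 ▸ le_add_self) hfin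
  have fE : E < ⊤ := lt_of_le_of_lt (i4 ▸ le_self_add) hfin
  have f4 : E4 < ⊤ := i2.trans_lt (ENNReal.mul_lt_top (by simp) hfin)
  have fΦ' : Φ' < ⊤ := lt_of_le_of_lt (le_self_add.trans i3) hfin
  lift Φ to NNReal using hfin.ne
  lift Φ' to NNReal using fΦ'.ne
  lift T to NNReal using fT.ne
  lift E to NNReal using fE.ne
  lift E4 to NNReal using f4.ne
  have j1 : (E : ℝ) ≤ 4 * testConst * T + (4 * testConst)⁻¹ * (testConst * E4) + Q := by
    have := ENNReal.toReal_mono (by finiteness) i1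
    rwa [ENNReal.toReal_add (by finiteness) (by finiteness), ENNReal.toReal_add (by finiteness)
      (by finiteness), ENNReal.toReal_mul, ENNReal.toReal_mul, ENNReal.toReal_mul,
      ENNReal.toReal_ofReal hN.le, ENNReal.toReal_ofReal (by positivity),
      ENNReal.toReal_ofReal hc.le, ENNReal.toReal_ofReal hSr] at this
  have j2 : (E4 : ℝ) ≤ 2 * Φ := by exact_mod_cast i2
  have j3 : (Φ' : ℝ) + 1 / 4 * T ≤ Φ := by
    have := ENNReal.toReal_mono (by finiteness) i3
    rwa [ENNReal.toReal_add (by finiteness) (by finiteness), ENNReal.toReal_mul,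
      ENNReal.toReal_ofReal (by norm_num)] at this
  have j4 : (Φ : ℝ) = E + T := by exact_mod_cast i4
  simp only [ENNReal.coe_toReal]
  have e1 : (4 * testConst)⁻¹ * (testConst * (E4 : ℝ)) = E4 / 4 := by field_simp
  rw [e1] at j1
  have hH : 8 < holeConst := by unfold holeConst; linarith
  have j5 : (Φ : ℝ) ≤ holeConst * (Φ - Φ') + 2 * Q := by
    have : (Φ : ℝ) ≤ (8 * testConst + 2) * T + 2 * Q := by linarith
    have : (8 * testConst + 2) * (T : ℝ) ≤ (8 * testConst + 2) * (4 * (Φ - Φ')) := by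
      gcongr
      linarith
    have : holeConst = (8 * testConst + 2) * 4 := by unfold holeConst; ring
    rw [this]
    linarith
  have j6 : holeConst * Φ' ≤ holeConst * ((1 - 1 / holeConst) * Φ + Q) := by
    have : holeConst * ((1 - 1 / holeConst) * (Φ : ℝ) + Q)
        = (holeConst - 1) * Φ + holeConst * Q := by field_simp
    rw [this]
    nlinarith
  exact le_of_mul_le_mul_left j6 (by linarith)

end BoundedSolution

/-! ### Decay of the energy and of mean oscillations -/

/-- Dyadic decay from a halving inequality with a lower order term. -/
lemma le_geometric_of_halving {Φ : ℝ → ℝ} {κ Q E s δ r₀ : ℝ} (hκ0 : 0 ≤ κ) (hκ : κ < 1)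
    (hQ : 0 ≤ Q) (hr₀ : 0 < r₀) (hδs : δ ≤ s) (hδ : (1 + κ) / 2 ≤ 2 ^ (-δ)) (hE : 0 ≤ E)
    (h0 : Φ r₀ ≤ E) (hstep : ∀ r, 0 < r → r ≤ r₀ → Φ (r / 2) ≤ κ * Φ r + Q * r ^ s) (n : ℕ) :
    Φ (r₀ / 2 ^ n) ≤ (E + 2 * Q * r₀ ^ s / (1 - κ)) * (2 ^ (-δ)) ^ n := by
  have h1 : 0 < 1 - κ := by linarith
  set N := E + 2 * Q * r₀ ^ s / (1 - κ) with hN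
  have hT : 0 ≤ 2 * Q * r₀ ^ s / (1 - κ) := by positivity
  have hN0 : 0 ≤ N := by positivity
  induction n with
  | zero => simpa using h0.trans (by linarith : E ≤ N)
  | succ n ih =>
    have hp : (0 : ℝ) < 2 ^ n := by positivity
    have e1 : r₀ / 2 ^ (n + 1) = r₀ / 2 ^ n / 2 := by rw [pow_succ]; field_simp
    have e2 : (r₀ / 2 ^ n) ^ s ≤ r₀ ^ s * (2 ^ (-δ)) ^ n := by
      rw [Real.div_rpow hr₀.le hp.le, div_eq_mul_inv, ← Real.rpow_neg hp.le]
      refine mul_le_mul_of_nonneg_left ?_ (by positivity)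
      rw [← Real.rpow_natCast, ← Real.rpow_natCast, ← Real.rpow_mul (by norm_num),
        ← Real.rpow_mul (by norm_num)]
      refine Real.rpow_le_rpow_of_exponent_le (by norm_num) ?_
      have := mul_le_mul_of_nonneg_left hδs (Nat.cast_nonneg n : (0 : ℝ) ≤ n)
      linarith
    have e3 : Q * r₀ ^ s ≤ N * (1 - κ) / 2 := by
      have : N * (1 - κ) = E * (1 - κ) + 2 * Q * r₀ ^ s := by rw [hN]; field_simp
      have : 0 ≤ E * (1 - κ) := by positivity
      linarith
    have hq : 0 ≤ ((2 : ℝ) ^ (-δ)) ^ n := by positivity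
    rw [e1]
    calc _ ≤ κ * Φ (r₀ / 2 ^ n) + Q * (r₀ / 2 ^ n) ^ s :=
          hstep _ (by positivity) (div_le_self hr₀.le (one_le_pow₀ (by norm_num)))
      _ ≤ κ * (N * (2 ^ (-δ)) ^ n) + Q * (r₀ ^ s * (2 ^ (-δ)) ^ n) := by gcongr
      _ = (κ * N + Q * r₀ ^ s) * (2 ^ (-δ)) ^ n := by ring
      _ ≤ (N * ((1 + κ) / 2)) * (2 ^ (-δ)) ^ n := by
          gcongr
          linarith
      _ ≤ (N * 2 ^ (-δ)) * (2 ^ (-δ)) ^ n := by gcongr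
      _ = _ := by rw [pow_succ]; ring

/-- Cauchy-Schwarz against the constant function. -/
lemma sq_integral_le_measure_mul {X : Type*} [MeasurableSpace X] {μ : Measure X}
    [IsFiniteMeasure μ] {f : X → ℝ} (hf : MemLp f 2 μ) :
    (∫ x, f x ∂μ) ^ 2 ≤ μ.real univ * ∫ x, f x ^ 2 ∂μ := by
  have i1 : Integrable f μ := hf.integrable one_le_two
  have i2 := hf.integrable_sq
  set m := μ.real univ with hm
  set c := ∫ x, f x ∂μ with hc
  have h0 : 0 ≤ ∫ x, (m * f x - c) ^ 2 ∂μ := integral_nonneg fun x => sq_nonneg _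
  have h1 : ∫ x, (m * f x - c) ^ 2 ∂μ = m * (m * (∫ x, f x ^ 2 ∂μ) - c ^ 2) := by
    calc _ = ∫ x, (m ^ 2 * f x ^ 2 - 2 * m * c * f x + c ^ 2) ∂μ := by
          congr 1; ext x; ring
      _ = _ := by
          have i3 : Integrable (fun x => m ^ 2 * f x ^ 2 - 2 * m * c * f x) μ :=
            (i2.const_mul _).sub (i1.const_mul _)
          rw [integral_add i3 (integrable_const _), integral_sub (i2.const_mul _)
            (i1.const_mul _), integral_const_mul, integral_const_mul, integral_const, ← hc, ← hm,
            smul_eq_mul]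
          ring
  rw [h1] at h0
  rcases (measureReal_nonneg : 0 ≤ m).eq_or_lt' with h | h
  · have : μ = 0 := by
      rw [← Measure.measure_univ_eq_zero]
      exact (measureReal_eq_zero_iff).1 h
    have hc0 : c = 0 := by rw [hc, this, integral_zero_measure]
    have hm0 : m = 0 := h
    rw [hc0, hm0]; simp
  · have := nonneg_of_mul_nonneg_right h0 h
    linarith

/-- The averages of a bounded function over two sets differ by at most its mean square
oscillation between them. -/
lemma sq_average_sub_le {u : ℝ → ℝ} (hu : Measurable u) {s t : Set ℝ} {A : ℝ}
    (hsm : MeasurableSet s) (htm : MeasurableSet t) (hs : ∀ x ∈ s, |u x| ≤ A)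
    (ht : ∀ x ∈ t, |u x| ≤ A) (hs0 : volume s ≠ 0) (ht0 : volume t ≠ 0) (hs1 : volume s ≠ ⊤)
    (ht1 : volume t ≠ ⊤) :
    ((⨍ x in s, u x) - ⨍ x in t, u x) ^ 2
      ≤ (volume.real s * volume.real t)⁻¹ * ∫ p in s ×ˢ t, (u p.1 - u p.2) ^ 2 := by
  have fs : IsFiniteMeasure (volume.restrict s) := ⟨by simpa using hs1.lt_top⟩
  have ft : IsFiniteMeasure (volume.restrict t) := ⟨by simpa using ht1.lt_top⟩
  have ius : Integrable u (volume.restrict s) :=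
    Integrable.of_bound hu.aestronglyMeasurable A ((ae_restrict_iff' hsm).2 (ae_of_all _ hs))
  have iut : Integrable u (volume.restrict t) :=
    Integrable.of_bound hu.aestronglyMeasurable A ((ae_restrict_iff' htm).2 (ae_of_all _ ht))
  have ms : 0 < volume.real s := ENNReal.toReal_pos hs0 hs1
  have mt : 0 < volume.real t := ENNReal.toReal_pos ht0 ht1
  have hprod : (volume : Measure (ℝ × ℝ)).restrict (s ×ˢ t)
      = (volume.restrict s).prod (volume.restrict t) := by
    rw [Measure.volume_eq_prod, Measure.prod_restrict]
  rw [hprod]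
  have hmem : MemLp (fun p : ℝ × ℝ => u p.1 - u p.2) 2
      ((volume.restrict s).prod (volume.restrict t)) := by
    refine MemLp.of_bound (Measurable.aestronglyMeasurable (by fun_prop)) (2 * A) ?_
    rw [← hprod]
    refine (ae_restrict_iff' (hsm.prod htm)).2 (ae_of_all _ fun p hp => ?_)
    exact (abs_sub _ _).trans (by linarith [hs _ hp.1, ht _ hp.2])
  have h1 := sq_integral_le_measure_mul hmem
  have h2 : ((volume.restrict s).prod (volume.restrict t)).real univ
      = volume.real s * volume.real t := by
    rw [measureReal_def, ← univ_prod_univ, Measure.prod_prod, ENNReal.toReal_mul]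
    simp [measureReal_def]
  have h3 : ∫ p, (u p.1 - u p.2) ∂((volume.restrict s).prod (volume.restrict t))
      = volume.real t * (∫ x in s, u x) - volume.real s * ∫ x in t, u x := by
    rw [integral_sub (ius.comp_fst _) (iut.comp_snd _), integral_fun_fst, integral_fun_snd]
    simp [measureReal_def]
  rw [h2, h3] at h1
  rw [setAverage_eq, setAverage_eq, smul_eq_mul, smul_eq_mul]
  have e : (volume.real s)⁻¹ * (∫ x in s, u x) - (volume.real t)⁻¹ * (∫ x in t, u x)
      = (volume.real s * volume.real t)⁻¹ *
        (volume.real t * (∫ x in s, u x) - volume.real s * ∫ x in t, u x) := by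
    field_simp
  rw [e, mul_pow, sq (volume.real s * volume.real t)⁻¹, mul_assoc]
  gcongr
  rw [inv_mul_le_iff₀ (by positivity)]
  exact h1

lemma abs_average_le {u : ℝ → ℝ} {s : Set ℝ} {A : ℝ} (hA : 0 ≤ A)
    (hs : ∀ x ∈ s, |u x| ≤ A) (hs1 : volume s ≠ ⊤) : |⨍ x in s, u x| ≤ A := by
  rw [setAverage_eq, smul_eq_mul, abs_mul, abs_inv, abs_of_nonneg measureReal_nonneg]
  have h1 : |∫ x in s, u x| ≤ A * volume.real s :=
    norm_setIntegral_le_of_norm_le_const (f := u) (C := A) (s := s) hs1.lt_top hs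
  rcases (measureReal_nonneg : 0 ≤ volume.real s).eq_or_lt' with h | h
  · rw [h]; simpa using hA
  · rw [inv_mul_le_iff₀ h]; linarith

namespace BoundedSolution

variable {θ₀ M A B K γ α θ : ℝ} {F u : ℝ → ℝ}

/-- The constant in the decay of the weighted energy at dyadic scales. -/
noncomputable def decayConst (θ₀ M A B K s : ℝ) : ℝ :=
  energyBound θ₀ M A B K + 2 * sourceConst θ₀ M A B K * (M / 32) ^ s / (1 - (1 - 1 / holeConst))

lemma holeConst_gt : 8 < holeConst := by
  have := testConst_pos
  unfold holeConst; linarith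

lemma energyBound_nonneg (h : BoundedSolution θ₀ M A B K γ α θ F u) :
    0 ≤ energyBound θ₀ M A B K := by
  have hM := h.one_lt_M
  have hA := h.A_nonneg
  have hB := h.B_nonneg
  have hK := h.K_nonneg
  have hpm := profileMass_nonneg
  have : 0 < 1 - θ₀ := by linarith [h.θ₀_lt]
  unfold energyBound
  positivity

lemma decayConst_nonneg (h : BoundedSolution θ₀ M A B K γ α θ F u) (s : ℝ) :
    0 ≤ decayConst θ₀ M A B K s := by
  have h1 := h.energyBound_nonneg
  have hM := h.one_lt_M
  have h2 := sourceConst_nonneg h.θ₀_lt (by linarith : 0 ≤ M) h.A_nonneg h.B_nonneg h.K_nonneg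
  have h3 := holeConst_gt
  unfold decayConst
  have : 0 < 1 - (1 - 1 / holeConst) := by
    have : 0 < 1 / holeConst := by positivity
    linarith
  positivity

/-- Decay of the weighted energy at dyadic scales, by iterating hole filling. -/
lemma weightedEnergy_decay (h : BoundedSolution θ₀ M A B K γ α θ F u) {s δ : ℝ} (hs : 0 ≤ s)
    (hs1 : s ≤ 1 / 2) (hs2 : s ≤ 1 - θ₀) (hδs : δ ≤ s)
    (hδ : (1 + (1 - 1 / holeConst)) / 2 ≤ 2 ^ (-δ)) {x₀ : ℝ} (hx₀ : |x₀| < M / 2) (n : ℕ) :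
    weightedEnergy γ α u (Metric.ball (0 : ℝ) (3 / 4 * M)) x₀ (M / 32 / 2 ^ n)
      ≤ ENNReal.ofReal (decayConst θ₀ M A B K s * (2 ^ (-δ)) ^ n) := by
  have hM := h.one_lt_M
  have hH := holeConst_gt
  have hH1 : 0 < 1 / holeConst := by positivity
  have hH2 : 1 / holeConst ≤ 1 := by rw [div_le_one (by linarith)]; linarith
  have hr₀ : 0 < M / 32 := by linarith
  have hfin := (h.weightedEnergy_le x₀ (r := M / 32 / 2 ^ n) (by positivity)).trans_lt
    ENNReal.ofReal_lt_top
  rw [← ENNReal.ofReal_toReal hfin.ne]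
  apply ENNReal.ofReal_le_ofReal
  refine le_geometric_of_halving
    (Φ := fun r => (weightedEnergy γ α u (Metric.ball (0 : ℝ) (3 / 4 * M)) x₀ r).toReal)
    (by linarith) (by linarith)
    (sourceConst_nonneg h.θ₀_lt (by linarith : 0 ≤ M) h.A_nonneg h.B_nonneg h.K_nonneg) hr₀ hδs hδ
    h.energyBound_nonneg ?_ (fun r hr hr' => h.hole_filling hs hs1 hs2 hx₀ hr hr') n
  exact ENNReal.toReal_le_of_le_ofReal h.energyBound_nonneg (h.weightedEnergy_le x₀ hr₀)

/-- The unweighted oscillation is controlled by the energy, since `|x|^{-α}` is bounded below on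
`(-M, M)`. -/
lemma lintegral_sq_sub_le (h : BoundedSolution θ₀ M A B K γ α θ F u) {x₀ r : ℝ} (hr : 0 < r)
    (hB : Metric.ball x₀ r ⊆ Metric.ball 0 M) :
    ∫⁻ p in Metric.ball x₀ r ×ˢ Metric.ball x₀ r, ENNReal.ofReal ((u p.1 - u p.2) ^ 2)
      ≤ ENNReal.ofReal ((2 * r) ^ (1 + 2 * γ) * M) *
        ∫⁻ p in Metric.ball x₀ r ×ˢ Metric.ball x₀ r,
          ENNReal.ofReal (kernelG γ α p.1 p.2 * (u p.1 - u p.2) ^ 2) := by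
  have hM := h.one_lt_M
  have hM0 : 0 < M := by linarith
  have hγ := h.le_γ
  have hum := h.measurable
  rw [← lintegral_const_mul' _ _ ENNReal.ofReal_ne_top]
  refine lintegral_mono_ae ?_
  filter_upwards [ae_restrict_of_ae ae_prod_ne_zero,
    ae_restrict_mem (measurableSet_ball.prod measurableSet_ball)] with p hp0 hp
  rw [← ENNReal.ofReal_mul (by positivity)]
  apply ENNReal.ofReal_le_ofReal
  rcases eq_or_ne p.1 p.2 with he | he
  · simp [he]
  · have hd : 0 < |p.1 - p.2| := abs_pos.2 (sub_ne_zero.2 he)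
    have hd2 : |p.1 - p.2| ≤ 2 * r := by
      have h1 := hp.1
      have h2 := hp.2
      rw [Metric.mem_ball, Real.dist_eq] at h1 h2
      have := abs_sub_le p.1 x₀ p.2
      rw [abs_sub_comm x₀] at this
      linarith
    have h1 : 1 ≤ (2 * r) ^ (1 + 2 * γ) * |p.1 - p.2| ^ (-(1 + 2 * γ)) := by
      rw [Real.rpow_neg hd.le, ← div_eq_mul_inv, one_le_div (by positivity)]
      gcongr
    have hw : ∀ x : ℝ, x ≠ 0 → x ∈ Metric.ball (0 : ℝ) M → M ^ (-α) ≤ |x| ^ (-α) := by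
      intro x hx hxM
      simp only [Metric.mem_ball, dist_zero_right, Real.norm_eq_abs] at hxM
      exact Real.rpow_le_rpow_of_nonpos (abs_pos.2 hx) hxM.le (by linarith [h.α_nonneg])
    have h2 : 1 ≤ M * (|p.1| ^ (-α) * |p.2| ^ (-α)) := by
      calc (1 : ℝ) ≤ M ^ (1 - 2 * α) := Real.one_le_rpow hM.le (by linarith [h.α_lt])
        _ = M * (M ^ (-α) * M ^ (-α)) := by
            rw [← Real.rpow_add hM0, ← Real.rpow_one_add' hM0.le (by linarith [h.α_lt])]
            congr 1; ring
        _ ≤ _ := mul_le_mul_of_nonneg_left (mul_le_mul (hw _ hp0.1 (hB hp.1))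
            (hw _ hp0.2 (hB hp.2)) (by positivity) (by positivity)) hM0.le
    rw [kernelG_eq]
    calc (u p.1 - u p.2) ^ 2 = 1 * 1 * (u p.1 - u p.2) ^ 2 := by ring
      _ ≤ ((2 * r) ^ (1 + 2 * γ) * |p.1 - p.2| ^ (-(1 + 2 * γ))) *
          (M * (|p.1| ^ (-α) * |p.2| ^ (-α))) * (u p.1 - u p.2) ^ 2 := by gcongr
      _ = _ := by ring

/-- Averages of `u` over comparable intervals at scale `2^{-n}` differ by `O(2^{-δn/4})`. The
exponent `γ` close to `1/2` makes the loss `r^{2γ-1}` smaller than the gain of the energy decay. -/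
lemma abs_average_sub_le (h : BoundedSolution θ₀ M A B K γ α θ F u) {s δ : ℝ} (hs : 0 ≤ s)
    (hs1 : s ≤ 1 / 2) (hs2 : s ≤ 1 - θ₀) (hδs : δ ≤ s)
    (hδ : (1 + (1 - 1 / holeConst)) / 2 ≤ 2 ^ (-δ)) (hγδ : 1 - 2 * γ ≤ δ / 2)
    {x₀ : ℝ} (hx₀ : |x₀| < M / 2) (n : ℕ) {a b ρ ρ' : ℝ}
    (hρ : M / 32 / 2 ^ n / 4 ≤ ρ) (hρ' : M / 32 / 2 ^ n / 4 ≤ ρ')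
    (ha : Metric.closedBall a ρ ⊆ Metric.ball x₀ (M / 32 / 2 ^ n))
    (hb : Metric.closedBall b ρ' ⊆ Metric.ball x₀ (M / 32 / 2 ^ n)) :
    |(⨍ x in Metric.closedBall a ρ, u x) - ⨍ x in Metric.closedBall b ρ', u x|
      ≤ √(512 * M * decayConst θ₀ M A B K s) * (2 ^ (-(δ / 4))) ^ n := by
  have hM := h.one_lt_M
  have hM0 : 0 < M := by linarith
  have hγ := h.le_γ
  have hγ' := h.γ_lt
  have hN := h.decayConst_nonneg s
  set r := M / 32 / 2 ^ n with hr
  have hr0 : 0 < r := by positivity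
  have hrM : r ≤ M / 32 := div_le_self (by positivity) (one_le_pow₀ (by norm_num))
  have hρ0 : 0 < ρ := by linarith
  have hρ'0 : 0 < ρ' := by linarith
  have hballD : Metric.ball x₀ r ⊆ Metric.ball 0 (3 / 4 * M) := fun x hx => by
    rw [Metric.mem_ball, Real.dist_eq] at hx
    have := abs_sub_abs_le_abs_sub x x₀
    simp only [Metric.mem_ball, dist_zero_right, Real.norm_eq_abs]
    linarith
  have hballM : Metric.ball x₀ r ⊆ Metric.ball 0 M :=
    hballD.trans (Metric.ball_subset_ball (by linarith))
  have hvol : ∀ c t : ℝ, 0 < t → volume.real (Metric.closedBall c t) = 2 * t := fun c t ht => by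
    rw [measureReal_def, Real.volume_closedBall, ENNReal.toReal_ofReal (by positivity)]
  have hvol0 : ∀ c t : ℝ, 0 < t → volume (Metric.closedBall c t) ≠ 0 := fun c t ht => by
    rw [Real.volume_closedBall]; simpa using ht
  have hvol1 : ∀ c t : ℝ, volume (Metric.closedBall c t) ≠ ⊤ := fun c t =>
    measure_closedBall_lt_top.ne
  have h1 := sq_average_sub_le h.measurable (A := A) (s := Metric.closedBall a ρ)
    (t := Metric.closedBall b ρ') measurableSet_closedBall measurableSet_closedBall
    (fun x hx => h.abs_le x (hballM (ha hx))) (fun x hx => h.abs_le x (hballM (hb hx)))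
    (hvol0 _ _ hρ0) (hvol0 _ _ hρ'0) (hvol1 _ _) (hvol1 _ _)
  rw [hvol _ _ hρ0, hvol _ _ hρ'0] at h1
  have h2 : ∫ p in Metric.closedBall a ρ ×ˢ Metric.closedBall b ρ', (u p.1 - u p.2) ^ 2
      ≤ (2 * r) ^ (1 + 2 * γ) * M * (decayConst θ₀ M A B K s * (2 ^ (-δ)) ^ n) := by
    have hum := h.measurable
    rw [integral_eq_lintegral_of_nonneg_ae (ae_of_all _ fun p => sq_nonneg _)
      (Measurable.aestronglyMeasurable (by fun_prop))]
    refine ENNReal.toReal_le_of_le_ofReal (by positivity) ?_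
    refine (lintegral_mono_set (prod_mono ha hb)).trans ((h.lintegral_sq_sub_le hr0 hballM).trans ?_)
    rw [ENNReal.ofReal_mul (p := (2 * r) ^ (1 + 2 * γ) * M) (by positivity)]
    gcongr
    refine le_trans ?_ (h.weightedEnergy_decay hs hs1 hs2 hδs hδ hx₀ n)
    rw [weightedEnergy_eq_add hr0 hballD]
    exact le_self_add
  have h3 : (2 * ρ * (2 * ρ'))⁻¹ ≤ 4 * (r ^ 2)⁻¹ := by
    rw [← div_eq_mul_inv, inv_eq_one_div, div_le_div_iff₀ (by positivity) (by positivity)]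
    nlinarith
  have h4 : (r ^ 2)⁻¹ * (2 * r) ^ (1 + 2 * γ) ≤ 128 * (2 ^ (δ / 2)) ^ n := by
    have e1 : (2 * r) ^ (1 + 2 * γ) ≤ 4 * r ^ (1 + 2 * γ) := by
      rw [Real.mul_rpow (by norm_num) hr0.le]
      gcongr
      calc (2 : ℝ) ^ (1 + 2 * γ) ≤ 2 ^ (2 : ℝ) := by gcongr <;> linarith
        _ = 4 := by norm_num
    have e2 : (r ^ 2)⁻¹ * r ^ (1 + 2 * γ) = r ^ (-(1 - 2 * γ)) := by
      rw [← Real.rpow_two, ← Real.rpow_neg hr0.le, ← Real.rpow_add hr0]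
      congr 1; ring
    have e3 : r ^ (-(1 - 2 * γ)) ≤ 32 * (2 ^ (δ / 2)) ^ n := by
      have hlow : 1 / 32 / 2 ^ n ≤ r := by rw [hr]; gcongr
      calc r ^ (-(1 - 2 * γ)) ≤ (1 / 32 / 2 ^ n) ^ (-(1 - 2 * γ)) :=
            Real.rpow_le_rpow_of_nonpos (by positivity) hlow (by linarith)
        _ = 32 ^ (1 - 2 * γ) * ((2 : ℝ) ^ n) ^ (1 - 2 * γ) := by
            rw [div_div, one_div, Real.inv_rpow (by positivity), ← Real.rpow_neg (by positivity),
              neg_neg, Real.mul_rpow (by norm_num) (by positivity)]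
        _ ≤ 32 ^ (1 : ℝ) * ((2 : ℝ) ^ n) ^ (δ / 2) := by
            have : (1 : ℝ) ≤ 2 ^ n := one_le_pow₀ (by norm_num)
            refine mul_le_mul ?_ ?_ (by positivity) (by positivity)
            · exact Real.rpow_le_rpow_of_exponent_le (by norm_num) (by linarith)
            · exact Real.rpow_le_rpow_of_exponent_le this hγδ
        _ = _ := by
            rw [Real.rpow_one, ← Real.rpow_natCast, ← Real.rpow_natCast,
              ← Real.rpow_mul (by norm_num), ← Real.rpow_mul (by norm_num), mul_comm (n : ℝ)]
    calc (r ^ 2)⁻¹ * (2 * r) ^ (1 + 2 * γ) ≤ (r ^ 2)⁻¹ * (4 * r ^ (1 + 2 * γ)) := by gcongr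
      _ = 4 * ((r ^ 2)⁻¹ * r ^ (1 + 2 * γ)) := by ring
      _ ≤ 4 * (32 * (2 ^ (δ / 2)) ^ n) := by rw [e2]; gcongr
      _ = _ := by ring
  have h5 : ((2 : ℝ) ^ (δ / 2)) ^ n * (2 ^ (-δ)) ^ n = ((2 ^ (-(δ / 4))) ^ n) ^ 2 := by
    have e : δ / 2 + -δ = -(δ / 4) + -(δ / 4) := by ring
    rw [← mul_pow, ← Real.rpow_add (by norm_num), e, Real.rpow_add (by norm_num), mul_pow, sq]
  rw [← Real.sqrt_sq (by positivity : (0 : ℝ) ≤ (2 ^ (-(δ / 4))) ^ n), ← Real.sqrt_mul (by positivity)]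
  refine Real.abs_le_sqrt (h1.trans ?_)
  calc _ ≤ 4 * (r ^ 2)⁻¹ *
        ((2 * r) ^ (1 + 2 * γ) * M * (decayConst θ₀ M A B K s * (2 ^ (-δ)) ^ n)) := by gcongr
    _ = 4 * ((r ^ 2)⁻¹ * (2 * r) ^ (1 + 2 * γ)) * (M * decayConst θ₀ M A B K s *
        (2 ^ (-δ)) ^ n) := by ring
    _ ≤ 4 * (128 * (2 ^ (δ / 2)) ^ n) * (M * decayConst θ₀ M A B K s * (2 ^ (-δ)) ^ n) := by gcongr
    _ = 512 * M * decayConst θ₀ M A B K s * ((2 ^ (δ / 2)) ^ n * (2 ^ (-δ)) ^ n) := by ring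
    _ = _ := by rw [h5]

end BoundedSolution

/-! ### Hölder continuity from dyadic averages -/

/-- Campanato-type criterion: if `a n` is, on a set `S`, an approximation of `v` at scale
`r₀ / 2 ^ n` with geometrically small increments, both in `n` and between points at distance
comparable to the scale, then `v` is Hölder continuous on `S`. -/
lemma abs_sub_le_of_dyadic {S : Set ℝ} {a : ℕ → ℝ → ℝ} {v : ℝ → ℝ} {c A r₀ σ : ℝ} (hσ : 0 < σ)
    (hr₀ : 0 < r₀) (hc : 0 ≤ c) (h0 : ∀ x ∈ S, |a 0 x| ≤ A)
    (hstep : ∀ x ∈ S, ∀ n, |a n x - a (n + 1) x| ≤ c * (2 ^ (-σ)) ^ n)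
    (hnear : ∀ x ∈ S, ∀ y ∈ S, ∀ n : ℕ, |x - y| ≤ r₀ / 2 / 2 ^ n →
      |a (n + 1) x - a (n + 1) y| ≤ c * (2 ^ (-σ)) ^ n)
    (hv : ∀ x ∈ S, Filter.Tendsto (fun n => a n x) Filter.atTop (nhds (v x)))
    {x y : ℝ} (hx : x ∈ S) (hy : y ∈ S) :
    |v x - v y| ≤ (c * (1 + 2 / (1 - 2 ^ (-σ))) * (4 / r₀) ^ σ
      + (2 * A + 2 * (c / (1 - 2 ^ (-σ)))) * (2 / r₀) ^ σ) * |x - y| ^ σ := by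
  set q : ℝ := 2 ^ (-σ) with hq
  have hq0 : 0 < q := by positivity
  have hq1 : q < 1 := Real.rpow_lt_one_of_one_lt_of_neg (by norm_num) (by linarith)
  have hq2 : 0 < 1 - q := by linarith
  have hA : 0 ≤ A := (abs_nonneg _).trans (h0 x hx)
  have hlim : ∀ z ∈ S, ∀ n, |a n z - v z| ≤ c * q ^ n / (1 - q) := fun z hz n =>
    dist_le_of_le_geometric_of_tendsto q c hq1 (fun n => hstep z hz n) (hv z hz) n
  rcases eq_or_ne x y with rfl | hxy
  · simp [Real.zero_rpow hσ.ne']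
  have hd : 0 < |x - y| := abs_pos.2 (sub_ne_zero.2 hxy)
  rw [add_mul]
  have hT1 : 0 ≤ c * (1 + 2 / (1 - q)) * (4 / r₀) ^ σ * |x - y| ^ σ := by positivity
  have hT2 : 0 ≤ (2 * A + 2 * (c / (1 - q))) * (2 / r₀) ^ σ * |x - y| ^ σ := by positivity
  rcases le_or_gt |x - y| (r₀ / 2) with hle | hgt
  · obtain ⟨n, hn1, hn2⟩ := exists_nat_pow_near_of_lt_one (x := 2 * |x - y| / r₀) (y := 1 / 2)
      (by positivity) (by rw [div_le_one hr₀]; linarith) (by norm_num) (by norm_num)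
    have hqn : q ^ n ≤ (4 / r₀) ^ σ * |x - y| ^ σ := by
      rw [← Real.mul_rpow (by positivity) hd.le]
      calc q ^ n = ((1 / 2 : ℝ) ^ n) ^ σ := by
            rw [hq, ← Real.rpow_natCast, ← Real.rpow_natCast, ← Real.rpow_mul (by norm_num),
              ← Real.rpow_mul (by norm_num), one_div, Real.inv_rpow (by norm_num),
              ← Real.rpow_neg (by norm_num)]
            congr 1; ring
        _ ≤ (4 / r₀ * |x - y|) ^ σ := by
            refine Real.rpow_le_rpow (by positivity) ?_ hσ.le
            have e1 : 4 / r₀ * |x - y| = 2 * (2 * |x - y| / r₀) := by ring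
            rw [pow_succ] at hn1
            linarith
    have hxyn : |x - y| ≤ r₀ / 2 / 2 ^ n := by
      rw [div_le_iff₀ hr₀, one_div, inv_pow] at hn2
      rw [div_div, le_div_iff₀ (by positivity)]
      have h2n : (0 : ℝ) < 2 ^ n := by positivity
      calc |x - y| * (2 * 2 ^ n) = 2 * |x - y| * 2 ^ n := by ring
        _ ≤ ((2 ^ n)⁻¹ * r₀) * 2 ^ n := by gcongr
        _ = r₀ := by field_simp
    have l1 := hlim x hx (n + 1)
    have l2 := hlim y hy (n + 1)
    have l3 := hnear x hx y hy n hxyn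
    have l4 : c * q ^ (n + 1) / (1 - q) ≤ c * q ^ n / (1 - q) := by
      have := pow_le_pow_of_le_one hq0.le hq1.le (Nat.le_succ n)
      gcongr
    have l5 : |v x - v y| ≤ c * q ^ n + 2 * (c * q ^ n / (1 - q)) := by
      rw [abs_le] at *
      constructor <;> linarith
    have l6 : c * q ^ n + 2 * (c * q ^ n / (1 - q)) = c * (1 + 2 / (1 - q)) * q ^ n := by ring
    have l7 : c * (1 + 2 / (1 - q)) * q ^ n
        ≤ c * (1 + 2 / (1 - q)) * ((4 / r₀) ^ σ * |x - y| ^ σ) :=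
      mul_le_mul_of_nonneg_left hqn (by positivity)
    linarith
  · have l1 := hlim x hx 0
    have l2 := hlim y hy 0
    have l3 := h0 x hx
    have l4 := h0 y hy
    rw [pow_zero, mul_one] at l1 l2
    have l5 : |v x - v y| ≤ 2 * A + 2 * (c / (1 - q)) := by
      rw [abs_le] at *
      constructor <;> linarith
    have l6 : 1 ≤ (2 / r₀) ^ σ * |x - y| ^ σ := by
      rw [← Real.mul_rpow (by positivity) hd.le]
      refine Real.one_le_rpow ?_ hσ.le
      rw [div_mul_eq_mul_div, one_le_div hr₀]; linarith
    have l7 := mul_le_mul_of_nonneg_left l6 (by positivity : 0 ≤ 2 * A + 2 * (c / (1 - q)))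
    linarith

namespace BoundedSolution

variable {θ₀ M A B K γ α θ : ℝ} {F u : ℝ → ℝ}

/-- The Hölder constant produced by the decay of averages with exponent `σ`. -/
noncomputable def holderConst (θ₀ M A B K s σ : ℝ) : ℝ :=
  √(512 * M * decayConst θ₀ M A B K s) * (1 + 2 / (1 - 2 ^ (-σ))) * (4 / (M / 32)) ^ σ
    + (2 * A + 2 * (√(512 * M * decayConst θ₀ M A B K s) / (1 - 2 ^ (-σ)))) * (2 / (M / 32)) ^ σ

/-- The limits of the averages of `u` form a Hölder continuous version of `u`. -/
theorem exists_holder (h : BoundedSolution θ₀ M A B K γ α θ F u) {s δ : ℝ} (hs : 0 ≤ s)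
    (hs1 : s ≤ 1 / 2) (hs2 : s ≤ 1 - θ₀) (hδ0 : 0 < δ) (hδs : δ ≤ s)
    (hδ : (1 + (1 - 1 / holeConst)) / 2 ≤ 2 ^ (-δ)) (hγδ : 1 - 2 * γ ≤ δ / 2) :
    ∃ v : ℝ → ℝ, v =ᵐ[volume.restrict (Ioo (-(M / 2)) (M / 2))] u ∧
      ∀ x ∈ Ioo (-(M / 2)) (M / 2), ∀ y ∈ Ioo (-(M / 2)) (M / 2),
        |v x - v y| ≤ holderConst θ₀ M A B K s (δ / 4) * |x - y| ^ (δ / 4) := by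
  have hM := h.one_lt_M
  have hM0 : 0 < M := by linarith
  set r₀ := M / 32 with hr₀
  have hr₀0 : 0 < r₀ := by positivity
  set c := √(512 * M * decayConst θ₀ M A B K s) with hc
  have hc0 : 0 ≤ c := Real.sqrt_nonneg _
  have hq1 : (2 : ℝ) ^ (-(δ / 4)) < 1 :=
    Real.rpow_lt_one_of_one_lt_of_neg (by norm_num) (by linarith)
  set ρ : ℕ → ℝ := fun n => r₀ / 2 / 2 ^ n with hρ
  have hρ0 : ∀ n, 0 < ρ n := fun n => by simp only [hρ]; positivity
  have hρs : ∀ n, ρ (n + 1) = ρ n / 2 := fun n => by simp only [hρ]; rw [pow_succ]; field_simp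
  have hρr : ∀ n, r₀ / 2 ^ n = 2 * ρ n := fun n => by simp only [hρ]; field_simp
  set a : ℕ → ℝ → ℝ := fun n x => ⨍ z in Metric.closedBall x (ρ n), u z with ha
  have hS : ∀ x ∈ Ioo (-(M / 2)) (M / 2), |x| < M / 2 := fun x hx => abs_lt.2 hx
  have hstep : ∀ x ∈ Ioo (-(M / 2)) (M / 2), ∀ n,
      |a n x - a (n + 1) x| ≤ c * (2 ^ (-(δ / 4))) ^ n := by
    intro x hx n
    refine h.abs_average_sub_le hs hs1 hs2 hδs hδ hγδ (hS x hx) n ?_ ?_ ?_ ?_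
    · rw [← hr₀, hρr]; linarith [hρ0 n]
    · rw [← hr₀, hρr, hρs]; linarith [hρ0 n]
    · rw [← hr₀, hρr]; exact Metric.closedBall_subset_ball (by linarith [hρ0 n])
    · rw [← hr₀, hρr, hρs]; exact Metric.closedBall_subset_ball (by linarith [hρ0 n])
  have hlim : ∀ x ∈ Ioo (-(M / 2)) (M / 2),
      ∃ l, Filter.Tendsto (fun n => a n x) Filter.atTop (nhds l) := fun x hx =>
    cauchySeq_tendsto_of_complete
      (cauchySeq_of_le_geometric _ c hq1 (fun n => hstep x hx n))
  choose! v hv using hlim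
  refine ⟨v, ?_, fun x hx y hy => abs_sub_le_of_dyadic (by positivity) hr₀0 hc0 (A := A) ?_
    hstep ?_ hv hx hy⟩
  · -- Lebesgue differentiation identifies the limit of the averages
    have hL := (Besicovitch.vitaliFamily (volume : Measure ℝ)).ae_tendsto_average h.memL1q.1
    filter_upwards [ae_restrict_of_ae hL, ae_restrict_mem measurableSet_Ioo] with x hx1 hx2
    refine tendsto_nhds_unique (hv x hx2)
      (hx1.comp ((Besicovitch.tendsto_filterAt volume x).comp ?_))
    refine tendsto_nhdsWithin_iff.2 ⟨?_, .of_forall hρ0⟩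
    have := (tendsto_pow_atTop_nhds_zero_of_lt_one (r := (1 / 2 : ℝ)) (by norm_num)
      (by norm_num)).const_mul (r₀ / 2)
    rw [mul_zero] at this
    refine this.congr fun n => ?_
    rw [one_div, inv_pow, ← div_eq_mul_inv]
  · intro x hx
    refine abs_average_le h.A_nonneg (fun z hz => h.abs_le z ?_) measure_closedBall_lt_top.ne
    rw [Metric.mem_closedBall, Real.dist_eq] at hz
    have e : ρ 0 = r₀ / 2 := by simp [hρ]
    have := abs_sub_abs_le_abs_sub z x
    have := hS x hx
    simp only [Metric.mem_ball, dist_zero_right, Real.norm_eq_abs]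
    linarith
  · intro x hx y hy n hxy
    refine h.abs_average_sub_le hs hs1 hs2 hδs hδ hγδ (hS x hx) n ?_ ?_ ?_ ?_
    · rw [← hr₀, hρr, hρs]; linarith [hρ0 n]
    · rw [← hr₀, hρr, hρs]; linarith [hρ0 n]
    · rw [← hr₀, hρr, hρs]; exact Metric.closedBall_subset_ball (by linarith [hρ0 n])
    · rw [← hr₀, hρr, hρs]
      refine Metric.closedBall_subset_ball' ?_
      rw [dist_comm, Real.dist_eq]
      have : |x - y| ≤ ρ n := hxy
      linarith [hρ0 n]

end BoundedSolution

/-! ### Choice of the representative and of the exponents -/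

lemma ae_prod_eq_of_ae_eq {u w : ℝ → ℝ} (h : u =ᵐ[volume] w) :
    ∀ᵐ p : ℝ × ℝ, u p.1 = w p.1 ∧ u p.2 = w p.2 := by
  have h1 : ∀ᵐ p : ℝ × ℝ, u p.1 = w p.1 := Measure.quasiMeasurePreserving_fst.ae h
  have h2 : ∀ᵐ p : ℝ × ℝ, u p.2 = w p.2 := Measure.quasiMeasurePreserving_snd.ae h
  exact h1.and h2

lemma IsWeakSolution.congr {γ α : ℝ} {Ω : Set ℝ} {F u w : ℝ → ℝ}
    (h : IsWeakSolution γ α Ω F u) (huw : u =ᵐ[volume] w) : IsWeakSolution γ α Ω F w := by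
  have hp := ae_prod_eq_of_ae_eq huw
  refine ⟨fun S hS hSΩ => ?_, fun φ hφ => ?_⟩
  · refine lt_of_eq_of_lt ?_ (h.1 S hS hSΩ)
    refine lintegral_congr_ae (ae_restrict_of_ae ?_)
    filter_upwards [hp] with p ⟨h1, h2⟩
    rw [h1, h2]
  · obtain ⟨h1, h2, h3⟩ := h.2 φ hφ
    have e : (fun p : ℝ × ℝ => (u p.1 - u p.2) * (φ p.1 - φ p.2) * kernelG γ α p.1 p.2)
        =ᵐ[volume] fun p => (w p.1 - w p.2) * (φ p.1 - φ p.2) * kernelG γ α p.1 p.2 := by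
      filter_upwards [hp] with p ⟨h1, h2⟩
      rw [h1, h2]
    exact ⟨h1.congr e, h2, by rw [← integral_congr_ae e, h3]⟩

lemma MemL1q.congr {q : ℝ} {u w : ℝ → ℝ} (h : MemL1q q u) (huw : u =ᵐ[volume] w) :
    MemL1q q w :=
  ⟨h.1.congr huw, h.2.congr (huw.mono fun x hx => by simp only [hx])⟩

lemma normL1q_congr {q : ℝ} {u w : ℝ → ℝ} (huw : u =ᵐ[volume] w) : normL1q q u = normL1q q w :=
  integral_congr_ae (huw.mono fun x hx => by simp only [hx])

lemma ae_abs_le_of_eLpNorm_top_le {μ : Measure ℝ} {f : ℝ → ℝ} {A : ℝ}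
    (h : eLpNorm f ∞ μ ≤ ENNReal.ofReal A) : ∀ᵐ x ∂μ, |f x| ≤ max A 0 := by
  rw [eLpNorm_exponent_top] at h
  filter_upwards [ae_le_eLpNormEssSup (f := f) (μ := μ)] with x hx
  have h1 := hx.trans h
  rw [Real.enorm_eq_ofReal_abs] at h1
  rw [← ENNReal.ofReal_toReal_eq_iff.2 (ENNReal.ofReal_ne_top (r := A)), ENNReal.toReal_ofReal'] at h1
  exact (ENNReal.ofReal_le_ofReal_iff (le_max_right _ _)).1 h1

/-- A locally integrable function has a measurable modification that satisfies a given essential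
bound everywhere on a measurable set. -/
lemma exists_measurable_modification {u : ℝ → ℝ} (hu : LocallyIntegrable u) {s : Set ℝ}
    (hs : MeasurableSet s) {A : ℝ} (hA : 0 ≤ A) (hb : ∀ᵐ x ∂volume.restrict s, |u x| ≤ A) :
    ∃ w : ℝ → ℝ, Measurable w ∧ u =ᵐ[volume] w ∧ ∀ x ∈ s, |w x| ≤ A := by
  classical
  have hm := hu.aestronglyMeasurable.aemeasurable
  refine ⟨s.piecewise (fun x => max (-A) (min A (hm.mk u x))) (hm.mk u), ?_, ?_, ?_⟩
  · exact Measurable.piecewise hs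
      (measurable_const.max (measurable_const.min hm.measurable_mk)) hm.measurable_mk
  · filter_upwards [hm.ae_eq_mk, (ae_restrict_iff' hs).1 hb] with x h1 h2
    by_cases hx : x ∈ s
    · have := abs_le.1 (h2 hx)
      rw [piecewise_eq_of_mem _ _ _ hx, ← h1, min_eq_right this.2, max_eq_right this.1]
    · rw [piecewise_eq_of_notMem _ _ _ hx, h1]
  · intro x hx
    rw [piecewise_eq_of_mem _ _ _ hx]
    exact abs_le.2 ⟨le_max_left _ _, max_le (by linarith) (min_le_left _ _)⟩

theorem theorem3p1 (θ₀ : ℝ) (hθ₀ : 0 < θ₀) (hθ₀' : θ₀ < 1) :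
    ∃ γ₀ : ℝ, 0 < γ₀ ∧ γ₀ < 1 / 2 ∧ ∃ σ : ℝ, 0 < σ ∧
      ∀ M : ℝ, 1 < M → ∀ A B K : ℝ, ∃ C : ℝ,
        ∀ γ α θ : ℝ, γ₀ ≤ γ → γ < 1 / 2 → 0 < α → α < 1 / 2 → 0 ≤ θ → θ < θ₀ →
        ∀ f u : ℝ → ℝ,
          MemLp f ∞ (volume.restrict (Ioo (-(2 * M)) (2 * M))) →
          LocallyBoundedOn (Ioo (-(2 * M)) (2 * M)) u →
          MemL1q (1 + 2 * γ + α) u →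
          IsWeakSolution γ α (Ioo (-(2 * M)) (2 * M)) (fun x => f x / |x| ^ θ) u →
          eLpNorm u ∞ (volume.restrict (Ioo (-M) M)) ≤ ENNReal.ofReal A →
          eLpNorm f ∞ (volume.restrict (Ioo (-M) M)) ≤ ENNReal.ofReal B →
          normL1q (1 + 2 * γ + α) u ≤ K →
          ∃ v : ℝ → ℝ,
            v =ᵐ[volume.restrict (Ioo (-(M / 2)) (M / 2))] u ∧
            ∀ x ∈ Ioo (-(M / 2)) (M / 2), ∀ y ∈ Ioo (-(M / 2)) (M / 2),
              |v x - v y| ≤ C * |x - y| ^ σ := by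
  have hH := BoundedSolution.holeConst_gt
  have hH1 : 0 < 1 / holeConst := by positivity
  have hH2 : 1 / holeConst ≤ 1 := by rw [div_le_one (by linarith)]; linarith
  set s := min (1 / 2) (1 - θ₀) with hs
  have hs0 : 0 < s := lt_min (by norm_num) (by linarith)
  -- With the hole filling ratio `κ = 1 - 1 / holeConst`, the decay exponent `δ` is the largest one
  -- up to `s` such that `(1 + κ) / 2 ≤ 2 ^ (-δ)`; the gap between `κ` and `(1 + κ) / 2` absorbs the
  -- lower order term.
  set lam := (1 + (1 - 1 / holeConst)) / 2 with hlam
  have hlam0 : 0 < lam := by rw [hlam]; linarith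
  have hlam1 : lam < 1 := by rw [hlam]; linarith
  set δ := min s (-Real.logb 2 lam) with hδ
  have hδ0 : 0 < δ := lt_min hs0 (by
    have := Real.logb_neg (b := 2) (by norm_num) hlam0 hlam1
    linarith)
  have hδs : δ ≤ s := min_le_left _ _
  have hlamδ : lam ≤ 2 ^ (-δ) := by
    calc lam = 2 ^ Real.logb 2 lam := (Real.rpow_logb (by norm_num) (by norm_num) hlam0).symm
      _ ≤ _ := Real.rpow_le_rpow_of_exponent_le (by norm_num)
        (by linarith [min_le_right s (-Real.logb 2 lam)])
  refine ⟨max (3 / 8) (1 / 2 - δ / 4), by positivity, max_lt (by norm_num) (by linarith), δ / 4,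
    by positivity, fun M hM A B K => ⟨BoundedSolution.holderConst θ₀ M (max A 0) (max B 0)
      (max K 0) s (δ / 4), ?_⟩⟩
  intro γ α θ hγ₀ hγ hα0 hα hθ0 hθ f u hf hloc huq hweak huA hfB huK
  have hball : Ioo (-M) M = Metric.ball (0 : ℝ) M := by simp [Real.ball_eq_Ioo]
  rw [hball] at huA hfB
  obtain ⟨w, hwm, huw, hwA⟩ := exists_measurable_modification huq.1 measurableSet_ball
    (le_max_right A 0) (ae_abs_le_of_eLpNorm_top_le huA)
  have hsol : BoundedSolution θ₀ M (max A 0) (max B 0) (max K 0) γ α θ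
      (fun x => f x / |x| ^ θ) w :=
    { one_lt_M := hM
      A_nonneg := le_max_right _ _
      B_nonneg := le_max_right _ _
      K_nonneg := le_max_right _ _
      le_γ := (le_max_left _ _).trans hγ₀
      γ_lt := hγ
      α_nonneg := hα0.le
      α_lt := hα
      θ_nonneg := hθ0
      θ_le := hθ.le
      θ₀_lt := hθ₀'
      measurable := hwm
      abs_le := hwA
      memL1q := huq.congr huw
      norm_le := by rw [← normL1q_congr huw]; exact huK.trans (le_max_left _ _)
      rhs_le := by
        filter_upwards [ae_abs_le_of_eLpNorm_top_le hfB] with x hx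
        rw [abs_div, abs_of_nonneg (Real.rpow_nonneg (abs_nonneg x) θ),
          Real.rpow_neg (abs_nonneg x), ← div_eq_mul_inv]
        gcongr
      weak := hweak.congr huw }
  obtain ⟨v, hv1, hv2⟩ := hsol.exists_holder hs0.le (min_le_left _ _) (min_le_right _ _) hδ0 hδs
    hlamδ (by linarith [(le_max_right (3 / 8) (1 / 2 - δ / 4)).trans hγ₀])
  exact ⟨v, hv1.trans (ae_restrict_of_ae huw.symm), hv2⟩
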